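/- **Definitions.** An event structure $\mathcal E=(E,\le,\smile)$ is a set $E$ of events with a partial order $\le$ such that $\{e'\in E: e'\le e\}$ is finite for every $e$, and an irreflexive symmetric conflict relation $\smile$ such that $e\smile e'\le e''$ implies $e\smile e''$. Two events are concurrent if they are $\le$-incomparable and not in conflict; a conflict $e\smile e'$ is minimal if there is no $g\ne e,e'$ with ($g\le e$ and $g\smile e'$) or ($g\le e'$ and $g\smile e$). Two events are independent if they are concurrent or in minimal conflict. The degree of $\mathcal E$ is the supremum of the sizes of sets of pairwise independent events. A nice labeling is a map from $E$ to a set of labels giving different labels to independent events. The domain $\mathcal D(\mathcal E)$ is the set of finite, conflict-free, downward-closed subsets of $E$, ordered by inclusion. A connected graph $G$ with distance $d$ is median if for all vertices $x,y,z$ there is exactly one vertex in $I(x,y)\cap I(y,z)\cap I(z,x)$, where $I(u,w)=\{t: d(u,t)+d(t,w)=d(u,w)\}$. The pointed median graph $G_v$ is $G$ with each edge $xy$ directed from $x$ to $y$ when $d(v,x)<d(v,y)$. The relation $\Theta$ on edges, where $xy\,\Theta\,zw$ iff $d(x,z)+d(y,w)\ne d(x,w)+d(y,z)$, is an equivalence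 relation on a median graph. Two classes $\Theta_i,\Theta_j$ cross if some 4-cycle has two opposite edges in $\Theta_i$ and the other two in $\Theta_j$. The pointed contact graph $\Gamma(G_v)$ has the classes of $\Theta$ as vertices; two distinct classes are adjacent iff they cross or contain two directed edges of $G_v$ with a common origin that do not lie in a common 4-cycle. Each class $\Theta_i$ splits the vertex set into two halfspaces (for $xy\in\Theta_i$: the vertices closer to $x$, and those closer to $y$); $\Theta_i$ separates $v$ from $\Theta_j$ if they do not cross and all edges of $\Theta_j$ lie in the halfspace of $\Theta_i$ not containing $v$. The event structure $\mathcal E_v$ of $G_v$ has as events the classes of $\Theta$, with $\Theta_i\le\Theta_j$ iff $\Theta_i=\Theta_j$ or $\Theta_i$ separates $v$ from $\Theta_j$, and $\Theta_i\smile\Theta_j$ iff $\Theta_i\neq\Theta_j$, they do not cross, and neither separates $v$ from the other. Let $\mathcal B=\{B_1,\dots,B_m\}$ be a finite family of (nondegenerate, closed) axis-parallel boxes in the open first octant of $\mathbb R^3$, and let $B_0$ be an axis-parallel box containing all of them with one corner at the origin $\alpha$ and opposite corner $\beta$. The clique number and the chromatic number of $\mathcal B$ are those of its intersection graph. Subdivide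 $B_0$ by all planes parallel to the coordinate planes through the corners of the $B_i$, and let $G$ be the resulting grid graph. The lifted graph $\widetilde G$ is obtained from $G$ by adding, for each $i$, a disjoint copy of the subgrid of $G$ contained in $B_i$ and joining each vertex of this subgrid to its copy. **Theorem.** There exist, for $n=1,2,\dots$, families $\mathcal B(n)$ and boxes $B_0(n)$ as above, with $\mathcal B(n)$ of clique number $2$ and chromatic number larger than $n$, such that the following holds. Let $\widetilde G(n)$ be the lifted graphs, with corners $\alpha(n),\beta(n)$, let $\widetilde G^*$ be the graph obtained from their disjoint union by identifying $\beta(n-1)$ with $\alpha(n)$ for all $n>1$, and let $\alpha=\alpha(1)$. Then each $\widetilde G(n)$ is 2-connected, the articulation vertices of $\widetilde G^*$ are exactly the identified vertices, and $\widetilde G^*$ is an infinite median graph; the pointed median graph $\widetilde G^*_\alpha$ has maximum out-degree $5$; and the chromatic number of its pointed contact graph $\Gamma(\widetilde G^*_\alpha)$ is infinite. Moreover, $\mathcal E_\alpha$ is an event structure of degree $5$, the Hasse diagram of its domain is isomorphic (as a directed graph) to $\widetilde G^*_\alpha$, and every nice labeling of $\mathcal E_\alpha$ uses infinitely many labels.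 In particular, the conjecture of Rozoy and Thiagarajan, that every event structure of finite degree has a nice labeling with finitely many labels, is false. -/

import Mathlib

/-! ### Event structures -/

/-- An event structure `(E, ≤, ⌣)` (coherent, i.e. with a binary conflict relation, and finitary). -/
structure EventStructure (E : Type*) where
  le : E → E → Prop
  conflict : E → E → Prop
  le_refl : ∀ e, le e e
  le_antisymm : ∀ e f, le e f → le f e → e = f
  le_trans : ∀ e f g, le e f → le f g → le e g
  conflict_irrefl : ∀ e, ¬ conflict e e
  conflict_symm : ∀ e f, conflict e f → conflict f e
  conflict_inherit : ∀ e f g, conflict e f → le f g → conflict e g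
  finitary : ∀ e, {f | le f e}.Finite

namespace EventStructure

variable {E : Type*} (S : EventStructure E)

/-- Concurrent events: order-incomparable and not in conflict. -/
def Concurrent (e f : E) : Prop :=
  ¬ S.le e f ∧ ¬ S.le f e ∧ ¬ S.conflict e f

/-- Minimal conflict. -/
def MinimalConflict (e f : E) : Prop :=
  S.conflict e f ∧
    ¬ ∃ g, g ≠ e ∧ g ≠ f ∧ ((S.le g e ∧ S.conflict g f) ∨ (S.le g f ∧ S.conflict g e))

/-- Independent (orthogonal) events: concurrent or in minimal conflict. -/
def Independent (e f : E) : Prop :=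
  S.Concurrent e f ∨ S.MinimalConflict e f

/-- The degree: the least upper bound of the sizes of the sets of pairwise independent events. -/
noncomputable def degree : ℕ∞ :=
  ⨆ A : {A : Set E // A.Pairwise S.Independent}, (A : Set E).encard

/-- A nice labeling: independent events have different labels. -/
def IsNiceLabeling {L : Type*} (lab : E → L) : Prop :=
  ∀ e f, S.Independent e f → lab e ≠ lab f

/-- Finite configurations: finite, conflict-free and downward closed sets of events. -/
def IsConfiguration (C : Set E) : Prop :=
  C.Finite ∧ (∀ e ∈ C, ∀ f ∈ C, ¬ S.conflict e f) ∧ (∀ e ∈ C, ∀ f, S.le f e → f ∈ C)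

/-- The domain: the set of configurations; as a subtype of `Set E` it is ordered by inclusion. -/
abbrev Domain : Type _ := {C : Set E // S.IsConfiguration C}

end EventStructure

/-! ### Median graphs, pointed median graphs, and the associated event structures -/

namespace SimpleGraph

variable {V : Type*} (G : SimpleGraph V)

/-- The (metric) interval `I(u, v)`. -/
def metricInterval (u v : V) : Set V :=
  {x | G.dist u x + G.dist x v = G.dist u v}

/-- Median graphs: connected graphs in which every triplet of vertices has a unique median. -/
def IsMedian : Prop :=
  G.Connected ∧ ∀ x y z : V,
    ∃! m, m ∈ G.metricInterval x y ∩ G.metricInterval y z ∩ G.metricInterval z x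

/-- The directed edge `x → y` of the graph `G` pointed at `v`. -/
def DirEdge (v x y : V) : Prop :=
  G.Adj x y ∧ G.dist v x < G.dist v y

/-- The maximum out-degree of the graph `G` pointed at `v`. -/
noncomputable def maxOutDegree (v : V) : ℕ∞ :=
  ⨆ x, {y | G.DirEdge v x y}.encard

/-- The Djokovic-Winkler relation on the edges of `G`. -/
def Theta (e f : G.edgeSet) : Prop :=
  ∃ x y z w : V, (e : Sym2 V) = s(x, y) ∧ (f : Sym2 V) = s(z, w) ∧
    G.dist x z + G.dist y w ≠ G.dist x w + G.dist y z

/-- The classes of the relation `Theta`, which is an equivalence relation if `G` is median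
(in general, the classes of the equivalence relation that it generates). -/
def ThetaClass : Type _ := Quot G.Theta

/-- The edge `xy` of `G` belongs to the class `i`. -/
def EdgeIn (i : G.ThetaClass) (x y : V) : Prop :=
  ∃ h : G.Adj x y, (Quot.mk G.Theta ⟨s(x, y), h⟩ : Quot G.Theta) = i

/-- `a b c d` is a 4-cycle of `G`. -/
def IsSquare (a b c d : V) : Prop :=
  G.Adj a b ∧ G.Adj b c ∧ G.Adj c d ∧ G.Adj d a ∧ a ≠ c ∧ b ≠ d

/-- Crossing (incompatible) classes: some 4-cycle has two opposite edges in one of them and the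
other two edges in the other one. -/
def Cross (i j : G.ThetaClass) : Prop :=
  ∃ a b c d : V, G.IsSquare a b c d ∧
    G.EdgeIn i a b ∧ G.EdgeIn i c d ∧ G.EdgeIn j b c ∧ G.EdgeIn j d a

/-- The classes `i` and `j` osculate in two directed edges `u → x`, `u → y` with common origin:
these edges do not belong to a common 4-cycle. -/
def OsculateFromOrigin (v : V) (i j : G.ThetaClass) : Prop :=
  ∃ u x y : V, G.DirEdge v u x ∧ G.DirEdge v u y ∧ G.EdgeIn i u x ∧ G.EdgeIn j u y ∧
    ¬ ∃ z, G.IsSquare u x z y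

/-- The pointed contact graph of `G` pointed at `v`. -/
def pointedContactGraph (v : V) : SimpleGraph G.ThetaClass :=
  SimpleGraph.fromRel fun i j => G.Cross i j ∨ G.OsculateFromOrigin v i j

/-- The halfspace of the convex split defined by the class `i` that does not contain the basepoint
`v`: the vertices closer to `y` than to `x`, for an edge `xy` in the class with `v` closer
to `x`. -/
def farHalfspace (v : V) (i : G.ThetaClass) : Set V :=
  {z | ∃ x y : V, G.EdgeIn i x y ∧ G.dist v x < G.dist v y ∧ G.dist z y < G.dist z x}

/-- The class `i` separates the basepoint `v` from the class `j`. -/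
def Separates (v : V) (i j : G.ThetaClass) : Prop :=
  ¬ G.Cross i j ∧
    ∀ x y : V, G.EdgeIn j x y → x ∈ G.farHalfspace v i ∧ y ∈ G.farHalfspace v i

/-- `S` is the event structure associated with `G` pointed at `v`: its events are the classes of
`Theta`, with causal dependency and conflict as prescribed. -/
def IsEventStructureOf (v : V) (S : EventStructure G.ThetaClass) : Prop :=
  (∀ i j, S.le i j ↔ i = j ∨ G.Separates v i j) ∧
  (∀ i j, S.conflict i j ↔
    i ≠ j ∧ ¬ G.Cross i j ∧ ¬ G.Separates v i j ∧ ¬ G.Separates v j i)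

/-- `G` pointed at `v` is isomorphic, as a directed graph, to the Hasse diagram of the domain
of `S`. -/
def IsHasseOfDomain (v : V) {E : Type*} (S : EventStructure E) : Prop :=
  ∃ φ : V ≃ S.Domain, ∀ x y : V, G.DirEdge v x y ↔ φ x ⋖ φ y

/-- `x` is an articulation vertex: deleting it disconnects the (connected) graph `G`. -/
def IsArticulation (x : V) : Prop :=
  ¬ (G.induce {x}ᶜ).Preconnected

/-- 2-connected graphs. -/
def IsTwoConnected : Prop :=
  3 ≤ ENat.card V ∧ G.Connected ∧ ∀ x, ¬ G.IsArticulation x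

end SimpleGraph

/-! ### Chains of graphs -/

section Chain

variable {V : ℕ → Type*}

/-- The identifications `β n = α (n + 1)` in the disjoint union of the `V n`. -/
inductive ChainGlue (α β : ∀ n, V n) : (Σ n, V n) → (Σ n, V n) → Prop
  | glue (n : ℕ) : ChainGlue α β ⟨n, β n⟩ ⟨n + 1, α (n + 1)⟩

/-- The vertices of the chain. -/
def ChainVertex (α β : ∀ n, V n) : Type _ := Quot (ChainGlue α β)

/-- The vertex of the chain given by the vertex `x` of the `n`-th graph. -/
def chainMk (α β : ∀ n, V n) (n : ℕ) (x : V n) : ChainVertex α β :=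
  Quot.mk (ChainGlue α β) ⟨n, x⟩

/-- The graph obtained from the disjoint union of the graphs `G n` by identifying `β n`
with `α (n + 1)` for all `n`. -/
def chainGraph (G : ∀ n, SimpleGraph (V n)) (α β : ∀ n, V n) :
    SimpleGraph (ChainVertex α β) :=
  SimpleGraph.fromRel fun p q =>
    ∃ (n : ℕ) (x y : V n), (G n).Adj x y ∧ chainMk α β n x = p ∧ chainMk α β n y = q

end Chain

/-! ### Box hypergraphs and the lifting procedure -/

/-- A finite family of axis-parallel 3-dimensional boxes `∏ k, [lo i k, hi i k]` in the open first
octant, with a box `∏ k, [0, corner k]` containing all of them. -/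
structure BoxHypergraph where
  size : ℕ
  lo : Fin size → Fin 3 → ℝ
  hi : Fin size → Fin 3 → ℝ
  corner : Fin 3 → ℝ
  lo_pos : ∀ i k, 0 < lo i k
  lo_lt_hi : ∀ i k, lo i k < hi i k
  hi_le_corner : ∀ i k, hi i k ≤ corner k
  corner_pos : ∀ k, 0 < corner k

namespace BoxHypergraph

variable (B : BoxHypergraph)

/-- The `i`-th box. -/
def box (i : Fin B.size) : Set (Fin 3 → ℝ) := Set.Icc (B.lo i) (B.hi i)

/-- The intersection graph of the boxes. -/
def intersectionGraph : SimpleGraph (Fin B.size) :=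
  SimpleGraph.fromRel fun i j => (B.box i ∩ B.box j).Nonempty

/-- The positions of the planes orthogonal to the `k`-th axis: those through the corners of the
boxes, and the two bounding faces of the big box. -/
def planes (k : Fin 3) : Set ℝ :=
  {0, B.corner k} ∪ Set.range (fun i => B.lo i k) ∪ Set.range (fun i => B.hi i k)

/-- The vertices of the grid subdividing the big box. -/
def gridPoints : Set (Fin 3 → ℝ) := {p | ∀ k, p k ∈ B.planes k}

/-- Adjacency in the grid: the points differ in exactly one coordinate `k`, and their `k`-th
coordinates are consecutive in `planes k`. -/
def GridAdj (p q : Fin 3 → ℝ) : Prop :=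
  ∃ k, (∀ l, l ≠ k → p l = q l) ∧ p k ≠ q k ∧
    ∀ r ∈ B.planes k, ¬ (p k < r ∧ r < q k) ∧ ¬ (q k < r ∧ r < p k)

/-- The vertices of the lifted complex in `ℝ ^ (m + 3)`, where `m = size`. The pair `(none, p)` is
the grid point `(0, p)`, and `(some i, p)`, with `p` in the `i`-th box, is the point `(e_i, p)`
where `e_i` is the `i`-th unit vector of `ℝ ^ m`. -/
def LiftedVertex : Type :=
  {x : Option (Fin B.size) × (Fin 3 → ℝ) //
    x.2 ∈ B.gridPoints ∧ ∀ i, x.1 = some i → x.2 ∈ B.box i}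

/-- The 1-skeleton of the lifted complex. -/
def liftedGraph : SimpleGraph B.LiftedVertex :=
  SimpleGraph.fromRel fun x y =>
    (x.1.1 = y.1.1 ∧ B.GridAdj x.1.2 y.1.2) ∨
    (x.1.2 = y.1.2 ∧ x.1.1 = none ∧ y.1.1 ≠ none)

/-- The corner of the big box at the origin. -/
def originVertex : B.LiftedVertex :=
  ⟨(none, fun _ => 0), fun _ => Or.inl (Or.inl (Or.inl rfl)), fun _ h => nomatch h⟩

/-- The opposite corner of the big box. -/
def cornerVertex : B.LiftedVertex :=
  ⟨(none, B.corner), fun _ => Or.inl (Or.inl (Or.inr rfl)), fun _ h => nomatch h⟩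

end BoxHypergraph

/-! ### The infinite chain of lifted graphs -/

/-- The vertices of the chain of the lifted graphs of the box hypergraphs `B 0, B 1, …`. -/
abbrev BoxChainVertex (B : ℕ → BoxHypergraph) : Type :=
  ChainVertex (fun n => (B n).originVertex) (fun n => (B n).cornerVertex)

/-- The vertex of the chain given by the vertex `x` of the `n`-th lifted graph. -/
def boxChainMk (B : ℕ → BoxHypergraph) (n : ℕ) (x : (B n).LiftedVertex) : BoxChainVertex B :=
  chainMk (fun n => (B n).originVertex) (fun n => (B n).cornerVertex) n x

/-- The chain of the lifted graphs: the corner vertex of the `n`-th one is identified with the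
origin vertex of the next one. -/
def boxChain (B : ℕ → BoxHypergraph) : SimpleGraph (BoxChainVertex B) :=
  chainGraph (fun n => (B n).liftedGraph)
    (fun n => (B n).originVertex) (fun n => (B n).cornerVertex)

/-- The basepoint: the origin vertex of the first lifted graph. -/
def boxChainBase (B : ℕ → BoxHypergraph) : BoxChainVertex B :=
  boxChainMk B 0 (B 0).originVertex

/-!
Every graph in the statement is the covering graph of the domain of an explicit event structure,
so that all assertions about the graph become assertions about events.

For any event structure `S`, let `G` be the graph whose vertices are the configurations of `S`,
two of them being adjacent if they differ in one event (`DomainModel`). If two configurations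
differ, a maximal event of their difference can be removed from one of them; hence `G` is
isometric in the hypercube of sets of events (`DomainModel.dist_eq`). Everything else follows from
this distance formula: medians are given by majority votes, two edges are in relation `Theta`
exactly if they correspond to the same event (`DomainModel.theta_iff`), crossing is concurrency,
the halfspace of an event consists of the configurations containing it, and the event structure of
`G` pointed at the empty configuration is `S`. The out-degree of a configuration counts its
enabled events. These are pairwise independent, and conversely finitely many pairwise independent
events are all enabled at the configuration of their strict predecessors; so the maximum
out-degree is the degree of `S`, and every coloring of the pointed contact graph is a nice
labeling of `S`.

The lifted graph of a box hypergraph is of this form (`BoxHypergraph.liftedModel`): the events are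
the gaps between consecutive planes and the boxes; a box lies above the gaps below it, and is in
conflict with the gaps above it and with all other boxes. The conflict of two boxes is minimal
exactly if no plane separates them, that is, if they intersect. So a set of pairwise independent
events consists of at most one gap for each of the three axes and of a clique of boxes, and a nice
labeling colors the intersection graph. If the boxes do not touch the far faces of the big box,
then the gaps form a maximal configuration, the far corner.

A chain of graphs glued at such corners is the covering graph of the domain of a chain of event
structures (`chainModel`), in which the gaps of each level precede all later events and the boxes
of each level are in conflict with all later events. Conflicts between different levels are never
minimal, because they are inherited from a gap of the lower level; so the degree does not grow,
while a nice labeling must properly color all the intersection graphs at once.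

Families of boxes with triangle-free intersection graphs of unbounded chromatic number are built
by Burling's recursion (`BurlingFamily.step`), which maintains finitely many probes such that in
every proper coloring the boxes seen by some probe have many colors.
-/

open scoped symmDiff

/-! ### Configurations of an event structure -/

namespace EventStructure

variable {E : Type*} {S : EventStructure E}

theorem isConfiguration_empty : S.IsConfiguration ∅ := by
  refine ⟨Set.finite_empty, ?_, ?_⟩ <;> simp

theorem not_conflict_of_le {a b e : E} (ha : S.le a e) (hb : S.le b e) : ¬ S.conflict a b := by
  intro h
  have h1 : S.conflict a e := S.conflict_inherit _ _ _ h hb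
  exact S.conflict_irrefl _ (S.conflict_inherit _ _ _ (S.conflict_symm _ _ h1) ha)

theorem isConfiguration_principal (e : E) : S.IsConfiguration {f | S.le f e} :=
  ⟨S.finitary e, fun _ ha _ hb => not_conflict_of_le ha hb,
    fun _ ha _ hb => S.le_trans _ _ _ hb ha⟩

theorem insert_principal_sdiff (e : E) :
    insert e ({f | S.le f e} \ {e}) = {f | S.le f e} := by
  rw [Set.insert_sdiff_singleton]
  exact Set.insert_eq_of_mem (S.le_refl e)

theorem IsConfiguration.diff_singleton {C : Set E} (hC : S.IsConfiguration C) {e : E}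
    (he : ∀ f ∈ C, S.le e f → f = e) : S.IsConfiguration (C \ {e}) := by
  refine ⟨hC.1.sdiff, fun a ha b hb => hC.2.1 a ha.1 b hb.1, fun a ha b hb => ?_⟩
  refine ⟨hC.2.2 a ha.1 b hb, ?_⟩
  rintro rfl
  exact ha.2 (he a ha.1 hb)

/-- An event that is maximal among those of a configuration `A` outside a configuration `B` is
maximal in `A`, because `B` is downward closed. -/
theorem IsConfiguration.exists_maximal_diff {A B : Set E} (hA : S.IsConfiguration A)
    (hB : S.IsConfiguration B) (h : (A \ B).Nonempty) :
    ∃ e ∈ A \ B, ∀ f ∈ A, S.le e f → f = e := by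
  let _ : PartialOrder E :=
    { le := S.le
      le_refl := S.le_refl
      le_trans := S.le_trans
      le_antisymm := S.le_antisymm }
  obtain ⟨e, he⟩ := (hA.1.sdiff (t := B)).exists_maximal h
  refine ⟨e, he.1, fun f hf hef => ?_⟩
  by_cases hfB : f ∈ B
  · exact absurd (hB.2.2 f hfB e hef) he.1.2
  · exact S.le_antisymm _ _ (he.2 ⟨hf, hfB⟩ hef) hef

/-- The majority vote of three configurations is a configuration: any two of its events lie
together in one of the three. -/
theorem IsConfiguration.majority {A B C : Set E} (hA : S.IsConfiguration A)
    (hB : S.IsConfiguration B) (hC : S.IsConfiguration C) :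
    S.IsConfiguration (A ∩ B ∪ B ∩ C ∪ C ∩ A) := by
  refine ⟨(hA.1.union hB.1).subset ?_, ?_, ?_⟩
  · rintro e ((h | h) | h)
    exacts [Or.inl h.1, Or.inr h.1, Or.inl h.2]
  · have hA' := hA.2.1
    have hB' := hB.2.1
    have hC' := hC.2.1
    rintro e ((⟨h, h'⟩ | ⟨h, h'⟩) | ⟨h, h'⟩) f ((⟨k, k'⟩ | ⟨k, k'⟩) | ⟨k, k'⟩) <;>
      first
      | exact hA' e ‹_› f ‹_›
      | exact hB' e ‹_› f ‹_›
      | exact hC' e ‹_› f ‹_›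
  · rintro e ((⟨h, h'⟩ | ⟨h, h'⟩) | ⟨h, h'⟩) f hf
    exacts [Or.inl (Or.inl ⟨hA.2.2 e h f hf, hB.2.2 e h' f hf⟩),
      Or.inl (Or.inr ⟨hB.2.2 e h f hf, hC.2.2 e h' f hf⟩),
      Or.inr ⟨hC.2.2 e h f hf, hA.2.2 e h' f hf⟩]

theorem Independent.not_le {a b : E} (h : S.Independent a b) : ¬ S.le a b := by
  rcases h with h | h
  · exact h.1
  · exact fun hab => not_conflict_of_le hab (S.le_refl b) h.1

theorem Independent.symm {a b : E} (h : S.Independent a b) : S.Independent b a := by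
  rcases h with ⟨h1, h2, h3⟩ | ⟨h1, h2⟩
  · exact Or.inl ⟨h2, h1, fun h => h3 (S.conflict_symm _ _ h)⟩
  · refine Or.inr ⟨S.conflict_symm _ _ h1, ?_⟩
    rintro ⟨g, ha, hb, h⟩
    exact h2 ⟨g, hb, ha, h.symm⟩

theorem Independent.ne {a b : E} (h : S.Independent a b) : a ≠ b := by
  rintro rfl
  exact h.not_le (S.le_refl _)

/-- A predecessor of one of two independent events is not in conflict with the other one. -/
theorem Independent.not_conflict_of_lt {a b g : E} (h : S.Independent a b) (hg : S.le g a)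
    (hga : g ≠ a) : ¬ S.conflict g b := by
  intro hgb
  have hab : S.conflict a b :=
    S.conflict_symm _ _ (S.conflict_inherit _ _ _ (S.conflict_symm _ _ hgb) hg)
  rcases h with h | h
  · exact h.2.2 hab
  · refine h.2 ⟨g, hga, ?_, Or.inl ⟨hg, hgb⟩⟩
    rintro rfl
    exact S.conflict_irrefl _ hgb

/-- Finitely many pairwise independent events are all enabled at the configuration of
their strict predecessors. -/
theorem exists_isConfiguration_insert {A : Set E} (hA : A.Finite)
    (h : A.Pairwise S.Independent) :
    ∃ C, S.IsConfiguration C ∧ ∀ a ∈ A, a ∉ C ∧ S.IsConfiguration (insert a C) := by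
  set C : Set E := {g | ∃ a ∈ A, S.le g a ∧ g ≠ a} with hCdef
  have hfin : C.Finite := by
    refine (hA.biUnion fun a _ => S.finitary a).subset ?_
    rintro g ⟨a, ha, hg, -⟩
    exact Set.mem_biUnion ha hg
  have hmem : ∀ g ∈ C, ∀ b ∈ A, ¬ S.conflict g b := by
    rintro g ⟨a, ha, hg, hga⟩ b hb
    by_cases hab : a = b
    · subst hab
      exact not_conflict_of_le hg (S.le_refl _)
    · exact (h ha hb hab).not_conflict_of_lt hg hga
  have hC : S.IsConfiguration C := by
    refine ⟨hfin, ?_, ?_⟩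
    · rintro g hg g' ⟨b, hb, hg', -⟩ hgg
      exact hmem g hg b hb (S.conflict_inherit _ _ _ hgg hg')
    · rintro g ⟨a, ha, hg, hga⟩ f hf
      refine ⟨a, ha, S.le_trans _ _ _ hf hg, ?_⟩
      rintro rfl
      exact hga (S.le_antisymm _ _ hg hf)
  refine ⟨C, hC, fun a ha => ⟨?_, hfin.insert a, ?_, ?_⟩⟩
  · rintro ⟨b, hb, hab, hne⟩
    exact (h ha hb hne).not_le hab
  · rintro e (rfl | he) f (rfl | hf)
    · exact S.conflict_irrefl _
    · exact fun hc => hmem f hf e ha (S.conflict_symm _ _ hc)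
    · exact hmem e he f ha
    · exact hC.2.1 e he f hf
  · rintro e (rfl | he) f hf
    · by_cases hfe : f = e
      · exact Or.inl hfe
      · exact Or.inr ⟨e, ha, hf, hfe⟩
    · exact Or.inr (hC.2.2 e he f hf)

/-- Distinct events enabled at the same configuration are independent. -/
theorem independent_of_enabled {C : Set E} {a b : E} (hab : a ≠ b) (ha : a ∉ C) (hb : b ∉ C)
    (hCa : S.IsConfiguration (insert a C)) (hCb : S.IsConfiguration (insert b C)) :
    S.Independent a b := by
  have key : ∀ y, S.IsConfiguration (insert y C) → ∀ g, g ≠ y → S.le g y → g ∈ C :=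
    fun y hy g hgy hg => (hy.2.2 y (Set.mem_insert _ _) g hg).resolve_left hgy
  by_cases hc : S.conflict a b
  · refine Or.inr ⟨hc, ?_⟩
    rintro ⟨g, hga, hgb, ⟨hg, hgc⟩ | ⟨hg, hgc⟩⟩
    · exact hCb.2.1 g (Or.inr (key a hCa g hga hg)) b (Or.inl rfl) hgc
    · exact hCa.2.1 g (Or.inr (key b hCb g hgb hg)) a (Or.inl rfl) hgc
  · exact Or.inl ⟨fun h => ha (key b hCb a hab h), fun h => hb (key a hCa b hab.symm h), hc⟩

/-- Covering in the domain is the addition of one event. -/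
theorem covBy_iff {C D : S.Domain} : C ⋖ D ↔ ∃ e, e ∉ C.1 ∧ D.1 = insert e C.1 := by
  constructor
  · intro h
    have hss : C.1 ⊂ D.1 := h.lt
    obtain ⟨e, he, hmax⟩ := D.2.exists_maximal_diff C.2 (Set.nonempty_of_ssubset hss)
    refine ⟨e, he.2, ?_⟩
    let D' : S.Domain := ⟨D.1 \ {e}, D.2.diff_singleton hmax⟩
    have hCD' : C ≤ D' := fun x hx => ⟨hss.1 hx, fun hxe => he.2 (hxe ▸ hx)⟩
    have hD'D : D' < D := by
      refine lt_of_le_of_ne (fun x hx => hx.1) fun heq => ?_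
      have : e ∈ D'.1 := heq ▸ he.1
      exact this.2 rfl
    have : C = D' := by
      by_contra hne
      exact h.2 (lt_of_le_of_ne hCD' hne) hD'D
    have hC : C.1 = D.1 \ {e} := congrArg Subtype.val this
    rw [hC, Set.insert_sdiff_singleton, Set.insert_eq_of_mem he.1]
  · rintro ⟨e, he, hD⟩
    refine ⟨lt_of_le_of_ne (fun x hx => hD ▸ Set.mem_insert_of_mem e hx) ?_, ?_⟩
    · rintro rfl
      exact he (hD ▸ Set.mem_insert e _)
    · intro F hCF hFD
      have h1 : C.1 ⊂ F.1 := hCF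
      have h2 : F.1 ⊂ insert e C.1 := hD ▸ (show F.1 ⊂ D.1 from hFD)
      obtain ⟨x, hx, hxC⟩ := Set.exists_of_ssubset h1
      have hxe : x = e := (h2.1 hx).resolve_right hxC
      subst hxe
      exact h2.2 (Set.insert_subset hx h1.1)

/-- The event structure transported along a bijection. -/
def comap {F : Type*} (S : EventStructure E) (θ : F ≃ E) : EventStructure F where
  le a b := S.le (θ a) (θ b)
  conflict a b := S.conflict (θ a) (θ b)
  le_refl _ := S.le_refl _
  le_antisymm _ _ h h' := θ.injective (S.le_antisymm _ _ h h')
  le_trans _ _ _ := S.le_trans _ _ _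
  conflict_irrefl _ := S.conflict_irrefl _
  conflict_symm _ _ := S.conflict_symm _ _
  conflict_inherit _ _ _ := S.conflict_inherit _ _ _
  finitary a := (S.finitary (θ a)).preimage θ.injective.injOn

section comap

variable {F : Type*} (θ : F ≃ E)

theorem comap_independent_iff {a b : F} :
    (S.comap θ).Independent a b ↔ S.Independent (θ a) (θ b) := by
  have : (∃ g, g ≠ a ∧ g ≠ b ∧ ((S.le (θ g) (θ a) ∧ S.conflict (θ g) (θ b)) ∨
      (S.le (θ g) (θ b) ∧ S.conflict (θ g) (θ a)))) ↔
      ∃ g, g ≠ θ a ∧ g ≠ θ b ∧ ((S.le g (θ a) ∧ S.conflict g (θ b)) ∨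
      (S.le g (θ b) ∧ S.conflict g (θ a))) := by
    rw [← θ.exists_congr_right]
    simp only [ne_eq, EmbeddingLike.apply_eq_iff_eq]
  unfold Independent MinimalConflict Concurrent
  rw [← this]
  rfl

theorem comap_isConfiguration_iff {C : Set F} :
    (S.comap θ).IsConfiguration C ↔ S.IsConfiguration (θ '' C) := by
  unfold IsConfiguration
  refine and_congr (Set.finite_image_iff θ.injective.injOn).symm (and_congr ?_ ?_)
  · simp only [Set.forall_mem_image]
    rfl
  · simp only [Set.forall_mem_image, ← θ.forall_congr_right (q := fun f => S.le f _ → _),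
      θ.injective.mem_set_image]
    rfl

/-- Transport along a bijection of the events does not change the domain. -/
def comapDomain (S : EventStructure E) : S.Domain ≃o (S.comap θ).Domain where
  toFun C := ⟨θ ⁻¹' C.1, by
    rw [comap_isConfiguration_iff, θ.image_preimage]
    exact C.2⟩
  invFun C := ⟨θ '' C.1, (comap_isConfiguration_iff θ).1 C.2⟩
  left_inv C := Subtype.ext (θ.image_preimage _)
  right_inv C := Subtype.ext (θ.preimage_image _)
  map_rel_iff' {C D} := by
    change θ ⁻¹' C.1 ⊆ θ ⁻¹' D.1 ↔ C.1 ⊆ D.1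
    exact θ.surjective.preimage_subset_preimage_iff

theorem degree_le_of_forall {d : ℕ∞}
    (h : ∀ A : Set E, A.Pairwise S.Independent → A.encard ≤ d) : S.degree ≤ d :=
  iSup_le fun A => h A.1 A.2

theorem degree_comap : (S.comap θ).degree = S.degree := by
  apply _root_.le_antisymm
  · refine degree_le_of_forall fun A hA => ?_
    have : (θ '' A).Pairwise S.Independent := by
      rintro _ ⟨a, ha, rfl⟩ _ ⟨b, hb, rfl⟩ hab
      exact (comap_independent_iff θ).1 (hA ha hb fun h => hab (h ▸ rfl))
    rw [← θ.injective.encard_image]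
    exact le_iSup (fun A : {A : Set E // A.Pairwise S.Independent} => (A : Set E).encard) ⟨_, this⟩
  · refine degree_le_of_forall fun A hA => ?_
    have : (θ.symm '' A).Pairwise (S.comap θ).Independent := by
      rintro _ ⟨a, ha, rfl⟩ _ ⟨b, hb, rfl⟩ hab
      rw [comap_independent_iff, θ.apply_symm_apply, θ.apply_symm_apply]
      exact hA ha hb fun h => hab (h ▸ rfl)
    rw [← θ.symm.injective.encard_image]
    exact le_iSup
      (fun A : {A : Set F // A.Pairwise (S.comap θ).Independent} => (A : Set F).encard) ⟨_, this⟩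

end comap

end EventStructure

/-! ### Covering graphs of domains -/

section FlipEvent

variable {E : Type*}

theorem mem_symmDiff_singleton {A : Set E} {e f : E} :
    f ∈ A ∆ {e} ↔ ¬ (f ∈ A ↔ f = e) := by
  simp only [Set.mem_symmDiff, Set.mem_singleton_iff]
  tauto

theorem symmDiff_eq_singleton_iff {A B : Set E} {e : E} : A ∆ B = {e} ↔ B = A ∆ {e} := by
  constructor
  · intro h
    rw [← h, symmDiff_symmDiff_cancel_left]
  · rintro rfl
    rw [symmDiff_symmDiff_cancel_left]

theorem symmDiff_singleton_of_mem {A : Set E} {e : E} (he : e ∈ A) : A ∆ {e} = A \ {e} := by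
  ext f
  rw [mem_symmDiff_singleton, Set.mem_sdiff, Set.mem_singleton_iff]
  by_cases hfe : f = e
  · simp [hfe, he]
  · simp [hfe]

theorem symmDiff_singleton_of_notMem {A : Set E} {e : E} (he : e ∉ A) : A ∆ {e} = insert e A := by
  ext f
  rw [mem_symmDiff_singleton, Set.mem_insert_iff]
  by_cases hfe : f = e
  · simp [hfe, he]
  · simp [hfe]

open Classical in
theorem ncard_symmDiff_singleton {A : Set E} (hA : A.Finite) (e : E) :
    ((A ∆ {e}).ncard : ℤ) = A.ncard + if e ∈ A then -1 else 1 := by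
  split_ifs with he
  · rw [symmDiff_singleton_of_mem he, ← Set.ncard_sdiff_singleton_add_one he hA]
    push_cast
    ring
  · rw [symmDiff_singleton_of_notMem he, Set.ncard_insert_of_notMem he hA]
    push_cast
    ring

end FlipEvent

/-- An identification of the vertices of `G` with the configurations of `S` under which adjacency
means differing in exactly one event; that is, `G` is the covering graph of the domain of `S`. -/
structure DomainModel {V E : Type*} (G : SimpleGraph V) (S : EventStructure E) where
  conf : V ≃ S.Domain
  adj_iff : ∀ x y, G.Adj x y ↔ ∃ e, (conf x).1 ∆ (conf y).1 = {e}

namespace DomainModel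

variable {V E : Type*} {G : SimpleGraph V} {S : EventStructure E} (M : DomainModel G S)

/-- The set of events of a vertex. -/
def ev (x : V) : Set E := (M.conf x).1

theorem isConfiguration_ev (x : V) : S.IsConfiguration (M.ev x) := (M.conf x).2

theorem finite_ev (x : V) : (M.ev x).Finite := (M.isConfiguration_ev x).1

theorem finite_symmDiff (x y : V) : (M.ev x ∆ M.ev y).Finite :=
  (M.finite_ev x).symmDiff (M.finite_ev y)

theorem ev_injective : Function.Injective M.ev := fun _ _ h =>
  M.conf.injective (Subtype.ext h)

theorem exists_ev {C : Set E} (hC : S.IsConfiguration C) : ∃ x, M.ev x = C :=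
  ⟨M.conf.symm ⟨C, hC⟩, by simp [ev]⟩

theorem adj_iff_flip {x y : V} : G.Adj x y ↔ ∃ e, M.ev y = M.ev x ∆ {e} := by
  rw [M.adj_iff]
  exact exists_congr fun e => symmDiff_eq_singleton_iff

/-! ### Distances -/

theorem exists_adj_lt {x y : V} (h : (M.ev x \ M.ev y).Nonempty) :
    ∃ z, G.Adj x z ∧ (M.ev z ∆ M.ev y).ncard + 1 = (M.ev x ∆ M.ev y).ncard := by
  obtain ⟨e, he, hmax⟩ := (M.isConfiguration_ev x).exists_maximal_diff (M.isConfiguration_ev y) h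
  obtain ⟨z, hz⟩ := M.exists_ev ((M.isConfiguration_ev x).diff_singleton hmax)
  rw [← symmDiff_singleton_of_mem he.1] at hz
  refine ⟨z, M.adj_iff_flip.2 ⟨e, hz⟩, ?_⟩
  have hmem : e ∈ M.ev x ∆ M.ev y := Or.inl he
  have h1 := ncard_symmDiff_singleton (M.finite_symmDiff x y) e
  rw [if_pos hmem, symmDiff_right_comm, ← hz] at h1
  omega

theorem exists_walk (n : ℕ) : ∀ x y : V, (M.ev x ∆ M.ev y).ncard = n →
    ∃ p : G.Walk x y, p.length = n := by
  induction n with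
  | zero =>
    intro x y h
    rw [Set.ncard_eq_zero (M.finite_symmDiff x y), ← Set.bot_eq_empty, symmDiff_eq_bot] at h
    obtain rfl := M.ev_injective h
    exact ⟨.nil, rfl⟩
  | succ n ih =>
    intro x y h
    by_cases hxy : (M.ev x \ M.ev y).Nonempty
    · obtain ⟨z, hz, hc⟩ := M.exists_adj_lt hxy
      obtain ⟨p, hp⟩ := ih z y (by omega)
      exact ⟨.cons hz p, by simp [hp]⟩
    · have hyx : (M.ev y \ M.ev x).Nonempty := by
        rw [Set.not_nonempty_iff_eq_empty] at hxy
        have hne : (M.ev x ∆ M.ev y).Nonempty := by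
          rw [← Set.ncard_pos (M.finite_symmDiff x y)]
          omega
        rw [Set.symmDiff_def, hxy, Set.empty_union] at hne
        exact hne
      obtain ⟨z, hz, hc⟩ := M.exists_adj_lt hyx
      rw [symmDiff_comm, symmDiff_comm (M.ev y)] at hc
      obtain ⟨p, hp⟩ := ih x z (by omega)
      exact ⟨p.concat hz.symm, by simp [hp]⟩

theorem ncard_le_length {x y : V} (p : G.Walk x y) : (M.ev x ∆ M.ev y).ncard ≤ p.length := by
  induction p with
  | nil => simp
  | @cons x z y hxz p ih =>
    obtain ⟨e, he⟩ := M.adj_iff_flip.1 hxz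
    have h1 := ncard_symmDiff_singleton (M.finite_symmDiff x y) e
    rw [symmDiff_right_comm, ← he] at h1
    rw [SimpleGraph.Walk.length_cons]
    split_ifs at h1 <;> omega

/-- The covering graph of a domain is isometric in the hypercube of sets of events. -/
theorem dist_eq (x y : V) : G.dist x y = (M.ev x ∆ M.ev y).ncard := by
  obtain ⟨p, hp⟩ := M.exists_walk _ x y rfl
  apply le_antisymm
  · exact hp ▸ SimpleGraph.dist_le p
  · obtain ⟨q, hq⟩ := p.reachable.exists_walk_length_eq_dist
    exact hq ▸ M.ncard_le_length q

include M in
theorem connected : G.Connected := by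
  obtain ⟨x, -⟩ := M.exists_ev S.isConfiguration_empty
  have : Nonempty V := ⟨x⟩
  exact ⟨fun x y => (M.exists_walk _ x y rfl).choose.reachable⟩

/-! ### Medians -/

theorem mem_metricInterval_iff {x y z : V} :
    z ∈ G.metricInterval x y ↔ M.ev x ∩ M.ev y ⊆ M.ev z ∧ M.ev z ⊆ M.ev x ∪ M.ev y := by
  change G.dist x z + G.dist z y = G.dist x y ↔ _
  rw [M.dist_eq, M.dist_eq, M.dist_eq]
  have hsub : M.ev x ∆ M.ev y ⊆ M.ev x ∆ M.ev z ∪ M.ev z ∆ M.ev y := fun e he => by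
    simp only [Set.mem_union, Set.mem_symmDiff] at he ⊢
    tauto
  have hfin := (M.finite_symmDiff x z).union (M.finite_symmDiff z y)
  have hie := Set.ncard_union_add_ncard_inter (M.ev x ∆ M.ev z) (M.ev z ∆ M.ev y)
    (M.finite_symmDiff x z) (M.finite_symmDiff z y)
  have hle := Set.ncard_le_ncard hsub hfin
  constructor
  · intro h
    have h0 : (M.ev x ∆ M.ev z ∩ M.ev z ∆ M.ev y).ncard = 0 := by omega
    rw [Set.ncard_eq_zero ((M.finite_symmDiff x z).inter_of_left _)] at h0
    have h0' : ∀ e, ¬ (e ∈ M.ev x ∆ M.ev z ∧ e ∈ M.ev z ∆ M.ev y) := fun e he =>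
      (h0 ▸ he : e ∈ (∅ : Set E))
    simp only [Set.mem_symmDiff] at h0'
    constructor
    · intro e he
      have := h0' e
      have h1 := he.1
      have h2 := he.2
      tauto
    · intro e he
      have := h0' e
      rw [Set.mem_union]
      tauto
  · rintro ⟨h1, h2⟩
    have h0 : M.ev x ∆ M.ev z ∩ M.ev z ∆ M.ev y = ∅ := by
      rw [Set.eq_empty_iff_forall_notMem]
      intro e he
      have h1' := @h1 e
      have h2' := @h2 e
      simp only [Set.mem_inter_iff, Set.mem_union, Set.mem_symmDiff] at he h1' h2'
      tauto
    have h3 : M.ev x ∆ M.ev z ∪ M.ev z ∆ M.ev y ⊆ M.ev x ∆ M.ev y := by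
      intro e he
      have h1' := @h1 e
      have h2' := @h2 e
      simp only [Set.mem_inter_iff, Set.mem_union, Set.mem_symmDiff] at he h1' h2' ⊢
      tauto
    have h4 := Set.ncard_le_ncard h3 (M.finite_symmDiff x y)
    rw [h0, Set.ncard_empty] at hie
    omega

include M in
theorem isMedian : G.IsMedian := by
  refine ⟨M.connected, fun x y z => ?_⟩
  obtain ⟨m, hm⟩ := M.exists_ev ((M.isConfiguration_ev x).majority (M.isConfiguration_ev y)
    (M.isConfiguration_ev z))
  simp only [Set.mem_inter_iff, M.mem_metricInterval_iff]
  refine ⟨m, ?_, ?_⟩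
  · simp only [hm, Set.subset_def, Set.mem_inter_iff, Set.mem_union]
    refine ⟨⟨⟨?_, ?_⟩, ⟨?_, ?_⟩⟩, ⟨?_, ?_⟩⟩ <;> intro e <;> tauto
  · rintro m' ⟨⟨⟨h1, h2⟩, ⟨h3, h4⟩⟩, ⟨h5, h6⟩⟩
    apply M.ev_injective
    rw [hm]
    refine Set.Subset.antisymm (fun e he => ?_) (Set.union_subset (Set.union_subset h1 h3) h5)
    have k2 := h2 he
    have k4 := h4 he
    have k6 := h6 he
    clear h1 h2 h3 h4 h5 h6 hm he
    simp only [Set.mem_inter_iff, Set.mem_union] at *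
    tauto

/-! ### The classes of `Theta` are the events -/

theorem exists_label (f : G.edgeSet) :
    ∃ e, ∀ x y, (f : Sym2 V) = s(x, y) → M.ev x ∆ M.ev y = {e} := by
  obtain ⟨⟨x, y⟩, h⟩ := f
  obtain ⟨e, he⟩ := (M.adj_iff x y).1 h
  refine ⟨e, fun x' y' h' => ?_⟩
  rcases Sym2.eq_iff.1 h' with ⟨rfl, rfl⟩ | ⟨rfl, rfl⟩
  · exact he
  · rw [symmDiff_comm]
    exact he

/-- The event in which the two ends of an edge differ. -/
noncomputable def label (f : G.edgeSet) : E := (M.exists_label f).choose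

theorem label_eq_iff {x y : V} (h : G.Adj x y) {e : E} :
    M.label ⟨s(x, y), h⟩ = e ↔ M.ev x ∆ M.ev y = {e} := by
  rw [(M.exists_label ⟨s(x, y), h⟩).choose_spec x y rfl, Set.singleton_eq_singleton_iff]
  rfl

/-- Two edges are in relation `Theta` exactly if their ends differ in the same event: every other
event contributes the same to both sides of the inequality defining `Theta`. -/
theorem theta_iff (f g : G.edgeSet) : G.Theta f g ↔ M.label f = M.label g := by
  classical
  have key : ∀ {x y z w : V} (h : G.Adj x y) (h' : G.Adj z w),
      G.dist x z + G.dist y w ≠ G.dist x w + G.dist y z ↔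
        M.label ⟨s(x, y), h⟩ = M.label ⟨s(z, w), h'⟩ := by
    intro x y z w h h'
    set a := M.label ⟨s(x, y), h⟩ with ha
    set b := M.label ⟨s(z, w), h'⟩ with hb
    have hy := symmDiff_eq_singleton_iff.1 ((M.label_eq_iff h).1 ha.symm)
    have hw := symmDiff_eq_singleton_iff.1 ((M.label_eq_iff h').1 hb.symm)
    have h1 := ncard_symmDiff_singleton (M.finite_symmDiff x z) a
    have h2 := ncard_symmDiff_singleton (M.finite_symmDiff x w) a
    rw [symmDiff_right_comm, ← hy] at h1 h2
    have h3 : a ∈ M.ev x ∆ M.ev w ↔ ¬ (a ∈ M.ev x ∆ M.ev z ↔ a = b) := by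
      rw [hw, ← symmDiff_assoc, mem_symmDiff_singleton]
    rw [M.dist_eq, M.dist_eq, M.dist_eq, M.dist_eq]
    have h4 : a = b ↔ ¬ (a ∈ M.ev x ∆ M.ev w ↔ a ∈ M.ev x ∆ M.ev z) := by tauto
    rw [h4]
    by_cases hz : a ∈ M.ev x ∆ M.ev z <;> by_cases hw' : a ∈ M.ev x ∆ M.ev w
    all_goals
      simp only [hz, hw', if_true, if_false, iff_self, iff_true, iff_false, not_true,
        not_false_iff] at h1 h2 ⊢
      omega
  constructor
  · rintro ⟨x, y, z, w, hf, hg, h⟩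
    obtain ⟨f, hf'⟩ := f
    obtain ⟨g, hg'⟩ := g
    obtain rfl : f = s(x, y) := hf
    obtain rfl : g = s(z, w) := hg
    exact (key hf' hg').1 h
  · intro h
    obtain ⟨⟨x, y⟩, hf⟩ := f
    obtain ⟨⟨z, w⟩, hg⟩ := g
    exact ⟨x, y, z, w, rfl, rfl, (key hf hg).2 h⟩

/-- Every event is added at the configuration of its strict predecessors. -/
theorem exists_edge (e : E) : ∃ x y, M.ev y = {f | S.le f e} ∧ M.ev x = {f | S.le f e} \ {e} := by
  have hC := S.isConfiguration_principal e
  obtain ⟨y, hy⟩ := M.exists_ev hC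
  obtain ⟨x, hx⟩ := M.exists_ev (hC.diff_singleton fun f hf hef => S.le_antisymm _ _ hf hef)
  exact ⟨x, y, hy, hx⟩

theorem adj_of_insert {x y : V} {e : E} (he : e ∉ M.ev x) (h : M.ev y = insert e (M.ev x)) :
    G.Adj x y ∧ M.ev x ∆ M.ev y = {e} := by
  rw [← symmDiff_singleton_of_notMem he] at h
  exact ⟨M.adj_iff_flip.2 ⟨e, h⟩, symmDiff_eq_singleton_iff.2 h⟩

/-- The bijection between the classes of `Theta` and the events. -/
noncomputable def eventEquiv : G.ThetaClass ≃ E :=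
  Equiv.ofBijective (Quot.lift M.label fun f g h => (M.theta_iff f g).1 h) <| by
    constructor
    · rintro ⟨f⟩ ⟨g⟩ h
      exact Quot.sound ((M.theta_iff f g).2 h)
    · intro e
      obtain ⟨x, y, hy, hx⟩ := M.exists_edge e
      obtain ⟨hadj, h⟩ := M.adj_of_insert (x := x) (y := y) (e := e) (by simp [hx]) (by
        rw [hx, hy, S.insert_principal_sdiff])
      exact ⟨Quot.mk _ ⟨s(x, y), hadj⟩, (M.label_eq_iff hadj).2 h⟩

theorem edgeIn_iff {i : G.ThetaClass} {x y : V} :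
    G.EdgeIn i x y ↔ M.ev x ∆ M.ev y = {M.eventEquiv i} := by
  constructor
  · rintro ⟨h, rfl⟩
    exact (M.label_eq_iff h).1 rfl
  · intro h
    have hadj : G.Adj x y := (M.adj_iff x y).2 ⟨_, h⟩
    refine ⟨hadj, M.eventEquiv.injective ?_⟩
    exact (M.label_eq_iff hadj).2 h

theorem edgeIn_iff_flip {i : G.ThetaClass} {x y : V} :
    G.EdgeIn i x y ↔ M.ev y = M.ev x ∆ {M.eventEquiv i} := by
  rw [M.edgeIn_iff, symmDiff_eq_singleton_iff]

theorem exists_edgeIn (i : G.ThetaClass) : ∃ x y, G.EdgeIn i x y ∧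
    M.ev y = {f | S.le f (M.eventEquiv i)} ∧
    M.ev x = {f | S.le f (M.eventEquiv i)} \ {M.eventEquiv i} := by
  obtain ⟨x, y, hy, hx⟩ := M.exists_edge (M.eventEquiv i)
  refine ⟨x, y, M.edgeIn_iff.2 (M.adj_of_insert (by simp [hx]) ?_).2, hy, hx⟩
  rw [hx, hy, S.insert_principal_sdiff]

theorem exists_of_square {P Q : V → Prop} {a b c d : V} (hb1 : P b ↔ ¬ P a) (hb2 : Q b ↔ Q a)
    (hc1 : P c ↔ P b) (hc2 : Q c ↔ ¬ Q b) (hd1 : P d ↔ ¬ P c) (hd2 : Q d ↔ Q c) :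
    (∃ x, ¬ P x ∧ Q x) ∧ (∃ x, P x ∧ ¬ Q x) ∧ ∃ x, P x ∧ Q x := by
  rw [hb2] at hc2
  rw [hb1] at hc1
  rw [hc1] at hd1
  rw [hc2] at hd2
  by_cases h1 : P a <;> by_cases h2 : Q a <;> simp only [h1, h2, not_true, not_false_iff, iff_true,
    iff_false] at hb1 hb2 hc1 hc2 hd1 hd2
  exacts [⟨⟨b, hb1, hb2⟩, ⟨d, hd1, hd2⟩, ⟨a, h1, h2⟩⟩, ⟨⟨c, hc1, hc2⟩, ⟨a, h1, h2⟩, ⟨d, hd1, hd2⟩⟩,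
    ⟨⟨a, h1, h2⟩, ⟨c, hc1, hc2⟩, ⟨b, hb1, hb2⟩⟩, ⟨⟨d, hd1, hd2⟩, ⟨b, hb1, hb2⟩, ⟨c, hc1, hc2⟩⟩]

theorem cross_iff (i j : G.ThetaClass) :
    G.Cross i j ↔ S.Concurrent (M.eventEquiv i) (M.eventEquiv j) := by
  set e := M.eventEquiv i with he
  set f := M.eventEquiv j with hf
  constructor
  · rintro ⟨a, b, c, d, ⟨-, -, -, -, hac, -⟩, hab, hcd, hbc, hda⟩
    rw [M.edgeIn_iff_flip, ← he] at hab hcd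
    rw [M.edgeIn_iff_flip, ← hf] at hbc hda
    have hef : e ≠ f := by
      intro hef
      apply hac
      apply M.ev_injective
      rw [hbc, hab, hef, symmDiff_symmDiff_cancel_right]
    -- the four vertices of the square realise all four combinations of `e` and `f`
    have hb1 : e ∈ M.ev b ↔ ¬ e ∈ M.ev a := by rw [hab, mem_symmDiff_singleton]; simp
    have hb2 : f ∈ M.ev b ↔ f ∈ M.ev a := by rw [hab, mem_symmDiff_singleton]; simp [hef.symm]
    have hc1 : e ∈ M.ev c ↔ e ∈ M.ev b := by rw [hbc, mem_symmDiff_singleton]; simp [hef]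
    have hc2 : f ∈ M.ev c ↔ ¬ f ∈ M.ev b := by rw [hbc, mem_symmDiff_singleton]; simp
    have hd1 : e ∈ M.ev d ↔ ¬ e ∈ M.ev c := by rw [hcd, mem_symmDiff_singleton]; simp
    have hd2 : f ∈ M.ev d ↔ f ∈ M.ev c := by rw [hcd, mem_symmDiff_singleton]; simp [hef.symm]
    obtain ⟨⟨x, hx1, hx2⟩, ⟨y, hy1, hy2⟩, ⟨z, hz1, hz2⟩⟩ :=
      exists_of_square (P := (e ∈ M.ev ·)) (Q := (f ∈ M.ev ·)) hb1 hb2 hc1 hc2 hd1 hd2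
    exact ⟨fun hle => hx1 ((M.isConfiguration_ev x).2.2 f hx2 e hle),
      fun hle => hy2 ((M.isConfiguration_ev y).2.2 e hy1 f hle),
      (M.isConfiguration_ev z).2.1 e hz1 f hz2⟩
  · intro h
    have hind : S.Independent e f := Or.inl h
    have hef := hind.ne
    obtain ⟨C, hC, hA⟩ := S.exists_isConfiguration_insert (A := {e, f}) (Set.toFinite _) (by
      intro x hx y hy hxy
      rcases hx with rfl | rfl <;> rcases hy with rfl | rfl
      exacts [absurd rfl hxy, hind, hind.symm, absurd rfl hxy])
    obtain ⟨heC, hCe⟩ := hA e (Or.inl rfl)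
    obtain ⟨hfC, hCf⟩ := hA f (Or.inr rfl)
    have hCef : S.IsConfiguration (insert f (insert e C)) := by
      refine ⟨hCe.1.insert f, ?_, ?_⟩
      · rintro x (rfl | rfl | hx) y (rfl | rfl | hy)
        · exact S.conflict_irrefl _
        · exact fun hc => h.2.2 (S.conflict_symm _ _ hc)
        · exact hCf.2.1 _ (Or.inl rfl) y (Or.inr hy)
        · exact h.2.2
        · exact S.conflict_irrefl _
        · exact hCe.2.1 _ (Or.inl rfl) y (Or.inr hy)
        · exact hCf.2.1 _ (Or.inr hx) _ (Or.inl rfl)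
        · exact hCe.2.1 _ (Or.inr hx) _ (Or.inl rfl)
        · exact hC.2.1 x hx y hy
      · rintro x (rfl | hx) y hy
        · rcases hCf.2.2 _ (Or.inl rfl) y hy with rfl | hy
          exacts [Or.inl rfl, Or.inr (Or.inr hy)]
        · exact Or.inr (hCe.2.2 x hx y hy)
    obtain ⟨a, ha⟩ := M.exists_ev hC
    obtain ⟨b, hb⟩ := M.exists_ev hCe
    obtain ⟨d, hd⟩ := M.exists_ev hCf
    obtain ⟨c, hc⟩ := M.exists_ev hCef
    have hab := (M.adj_of_insert (x := a) (y := b) (e := e) (by rwa [ha]) (by rw [ha, hb])).2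
    have hbc := (M.adj_of_insert (x := b) (y := c) (e := f)
      (by rw [hb]; rintro (h | h); exacts [hef h.symm, hfC h]) (by rw [hb, hc])).2
    have had := (M.adj_of_insert (x := a) (y := d) (e := f) (by rwa [ha]) (by rw [ha, hd])).2
    have hdc := (M.adj_of_insert (x := d) (y := c) (e := e)
      (by rw [hd]; rintro (h | h); exacts [hef h, heC h])
      (by rw [hd, hc, Set.insert_comm])).2
    rw [symmDiff_comm] at hdc had
    refine ⟨a, b, c, d, ⟨(M.adj_iff _ _).2 ⟨_, hab⟩, (M.adj_iff _ _).2 ⟨_, hbc⟩,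
      (M.adj_iff _ _).2 ⟨_, hdc⟩, (M.adj_iff _ _).2 ⟨_, had⟩, ?_, ?_⟩,
      M.edgeIn_iff.2 hab, M.edgeIn_iff.2 hdc, M.edgeIn_iff.2 hbc, M.edgeIn_iff.2 had⟩
    · rintro rfl
      exact heC (ha ▸ hc ▸ Or.inr (Or.inl rfl))
    · rintro rfl
      have : e ∈ insert f C := hd ▸ hb ▸ Or.inl rfl
      exact this.elim hef heC

/-! ### The pointed graph -/

variable {v : V} (hv : M.ev v = ∅)

include hv

theorem dist_base (x : V) : G.dist v x = (M.ev x).ncard := by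
  rw [M.dist_eq, hv, ← Set.bot_eq_empty, bot_symmDiff]

theorem dist_base_lt_iff {x y : V} {e : E} (h : M.ev x ∆ M.ev y = {e}) :
    G.dist v x < G.dist v y ↔ e ∉ M.ev x ∧ M.ev y = insert e (M.ev x) := by
  classical
  have hy := symmDiff_eq_singleton_iff.1 h
  have h1 := ncard_symmDiff_singleton (M.finite_ev x) e
  rw [← hy] at h1
  rw [M.dist_base hv, M.dist_base hv]
  by_cases he : e ∈ M.ev x
  · rw [if_pos he] at h1
    simp only [he, not_true, false_and, iff_false]
    omega
  · rw [if_neg he] at h1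
    simp only [he, not_false_iff, true_and, ← symmDiff_singleton_of_notMem he, hy, iff_true]
    rw [← hy]
    omega

theorem dirEdge_iff {x y : V} :
    G.DirEdge v x y ↔ ∃ e, e ∉ M.ev x ∧ M.ev y = insert e (M.ev x) := by
  constructor
  · rintro ⟨hadj, hlt⟩
    obtain ⟨e, he⟩ := (M.adj_iff x y).1 hadj
    exact ⟨e, (M.dist_base_lt_iff hv he).1 hlt⟩
  · rintro ⟨e, he, h⟩
    obtain ⟨hadj, h'⟩ := M.adj_of_insert he h
    exact ⟨hadj, (M.dist_base_lt_iff hv h').2 ⟨he, h⟩⟩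

theorem farHalfspace_eq (i : G.ThetaClass) :
    G.farHalfspace v i = {z | M.eventEquiv i ∈ M.ev z} := by
  classical
  have key : ∀ {x y : V}, G.EdgeIn i x y → G.dist v x < G.dist v y → ∀ z,
      (G.dist z y < G.dist z x ↔ M.eventEquiv i ∈ M.ev z) := by
    intro x y hxy hlt z
    obtain ⟨hx, -⟩ := (M.dist_base_lt_iff hv (M.edgeIn_iff.1 hxy)).1 hlt
    have h1 := ncard_symmDiff_singleton (M.finite_symmDiff x z) (M.eventEquiv i)
    rw [symmDiff_right_comm, ← M.edgeIn_iff_flip.1 hxy] at h1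
    have h2 : M.eventEquiv i ∈ M.ev x ∆ M.ev z ↔ M.eventEquiv i ∈ M.ev z := by
      rw [Set.mem_symmDiff]
      tauto
    rw [SimpleGraph.dist_comm, SimpleGraph.dist_comm (u := z), M.dist_eq, M.dist_eq, ← h2]
    split_ifs at h1 with h
    · simp only [h, iff_true]
      omega
    · simp only [h, iff_false]
      omega
  ext z
  constructor
  · rintro ⟨x, y, hxy, hlt, hz⟩
    exact (key hxy hlt z).1 hz
  · intro hz
    obtain ⟨x, y, hxy, hy, hx⟩ := M.exists_edgeIn i
    have hlt : G.dist v x < G.dist v y := by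
      rw [M.dist_base_lt_iff hv (M.edgeIn_iff.1 hxy), hx, hy, S.insert_principal_sdiff]
      exact ⟨fun h => h.2 rfl, rfl⟩
    exact ⟨x, y, hxy, hlt, (key hxy hlt z).2 hz⟩

theorem separates_iff (i j : G.ThetaClass) :
    G.Separates v i j ↔ S.le (M.eventEquiv i) (M.eventEquiv j) ∧ i ≠ j := by
  simp only [SimpleGraph.Separates, M.farHalfspace_eq hv, Set.mem_ofPred_eq, M.cross_iff]
  constructor
  · rintro ⟨-, h⟩
    obtain ⟨x, y, hxy, hy, hx⟩ := M.exists_edgeIn j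
    have := (h x y hxy).1
    rw [hx] at this
    exact ⟨this.1, fun hij => this.2 (by rw [hij]; rfl)⟩
  · rintro ⟨hle, hij⟩
    have hne : M.eventEquiv i ≠ M.eventEquiv j := fun h => hij (M.eventEquiv.injective h)
    refine ⟨fun h => h.1 hle, fun x y hxy => ?_⟩
    have h := M.edgeIn_iff_flip.1 hxy
    have hj : M.eventEquiv j ∈ M.ev y ↔ ¬ M.eventEquiv j ∈ M.ev x := by
      rw [h, mem_symmDiff_singleton]
      tauto
    have hi : M.eventEquiv i ∈ M.ev y ↔ M.eventEquiv i ∈ M.ev x := by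
      rw [h, mem_symmDiff_singleton]
      tauto
    have h1 : M.eventEquiv j ∈ M.ev x → M.eventEquiv i ∈ M.ev x := fun h =>
      (M.isConfiguration_ev x).2.2 _ h _ hle
    have h2 : M.eventEquiv j ∈ M.ev y → M.eventEquiv i ∈ M.ev y := fun h =>
      (M.isConfiguration_ev y).2.2 _ h _ hle
    tauto

theorem isEventStructureOf : G.IsEventStructureOf v (S.comap M.eventEquiv) := by
  constructor
  · intro i j
    change S.le _ _ ↔ _
    rw [M.separates_iff hv]
    constructor
    · intro h
      by_cases hij : i = j
      exacts [Or.inl hij, Or.inr ⟨h, hij⟩]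
    · rintro (rfl | h)
      exacts [S.le_refl _, h.1]
  · intro i j
    change S.conflict _ _ ↔ _
    rw [M.separates_iff hv, M.separates_iff hv, M.cross_iff]
    constructor
    · intro h
      refine ⟨?_, fun hc => hc.2.2 h, fun hs => ?_, fun hs => ?_⟩
      · rintro rfl
        exact S.conflict_irrefl _ h
      · exact S.not_conflict_of_le hs.1 (S.le_refl _) h
      · exact S.not_conflict_of_le (S.le_refl _) hs.1 h
    · rintro ⟨hij, hc, h1, h2⟩
      by_contra hcon
      exact hc ⟨fun h => h1 ⟨h, hij⟩, fun h => h2 ⟨h, fun h => hij h.symm⟩, hcon⟩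

theorem isHasseOfDomain : G.IsHasseOfDomain v (S.comap M.eventEquiv) := by
  refine ⟨M.conf.trans (S.comapDomain M.eventEquiv).toEquiv, fun x y => ?_⟩
  rw [M.dirEdge_iff hv]
  change _ ↔ S.comapDomain M.eventEquiv (M.conf x) ⋖ S.comapDomain M.eventEquiv (M.conf y)
  rw [apply_covBy_apply_iff, EventStructure.covBy_iff]
  rfl

/-- The edges leaving a vertex correspond to the events enabled at its configuration. -/
theorem maxOutDegree_eq_degree : G.maxOutDegree v = S.degree := by
  classical
  have houtdeg : ∀ x, {y | G.DirEdge v x y}.encard =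
      {e | e ∉ M.ev x ∧ S.IsConfiguration (insert e (M.ev x))}.encard := by
    intro x
    have himg : M.ev '' {y | G.DirEdge v x y} = (fun e => insert e (M.ev x)) ''
        {e | e ∉ M.ev x ∧ S.IsConfiguration (insert e (M.ev x))} := by
      ext C
      constructor
      · rintro ⟨y, hy, rfl⟩
        obtain ⟨e, he, h⟩ := (M.dirEdge_iff hv).1 hy
        exact ⟨e, ⟨he, h ▸ M.isConfiguration_ev y⟩, h.symm⟩
      · rintro ⟨e, ⟨he, hC⟩, rfl⟩
        obtain ⟨y, hy⟩ := M.exists_ev hC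
        exact ⟨y, (M.dirEdge_iff hv).2 ⟨e, he, hy⟩, hy⟩
    rw [← M.ev_injective.encard_image, himg, Set.InjOn.encard_image]
    intro e he f _ hef
    have : e ∈ insert f (M.ev x) := by
      rw [← show insert e (M.ev x) = insert f (M.ev x) from hef]
      exact Set.mem_insert _ _
    exact this.resolve_right he.1
  apply le_antisymm
  · refine iSup_le fun x => ?_
    rw [houtdeg x]
    refine le_iSup_of_le (f := fun A : {A : Set E // A.Pairwise S.Independent} =>
      (A : Set E).encard) ⟨_, ?_⟩ le_rfl
    intro a ha b hb hab
    exact S.independent_of_enabled hab ha.1 hb.1 ha.2 hb.2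
  · refine S.degree_le_of_forall fun A hA => ?_
    -- the degree is approached by finite sets of pairwise independent events
    refine ENat.forall_natCast_le_iff_le.1 fun n hn => ?_
    obtain ⟨A', hA', hcard⟩ := Set.exists_subset_encard_eq hn
    have hfin : A'.Finite := Set.finite_of_encard_eq_coe hcard
    obtain ⟨C, hC, hC'⟩ := S.exists_isConfiguration_insert hfin (hA.mono hA')
    obtain ⟨x, hx⟩ := M.exists_ev hC
    refine le_trans ?_ (le_iSup _ x)
    rw [houtdeg x, ← hcard, hx]
    exact Set.encard_le_encard hC'

theorem pointedContactGraph_adj_of_independent {i j : G.ThetaClass}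
    (h : S.Independent (M.eventEquiv i) (M.eventEquiv j)) :
    (G.pointedContactGraph v).Adj i j := by
  rw [SimpleGraph.pointedContactGraph, SimpleGraph.fromRel_adj]
  refine ⟨fun hij => h.ne (congrArg _ hij), Or.inl ?_⟩
  by_cases hc : S.Concurrent (M.eventEquiv i) (M.eventEquiv j)
  · exact Or.inl ((M.cross_iff i j).2 hc)
  right
  have hconf : S.conflict (M.eventEquiv i) (M.eventEquiv j) := by
    by_contra hcon
    exact hc ⟨h.not_le, h.symm.not_le, hcon⟩
  obtain ⟨C, hC, hA⟩ := S.exists_isConfiguration_insert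
    (A := {M.eventEquiv i, M.eventEquiv j}) (Set.toFinite _) (by
      intro x hx y hy hxy
      rcases hx with rfl | rfl <;> rcases hy with rfl | rfl
      exacts [absurd rfl hxy, h, h.symm, absurd rfl hxy])
  obtain ⟨hi, hCi⟩ := hA _ (Or.inl rfl)
  obtain ⟨hj, hCj⟩ := hA _ (Or.inr rfl)
  obtain ⟨u, hu⟩ := M.exists_ev hC
  obtain ⟨x, hx⟩ := M.exists_ev hCi
  obtain ⟨y, hy⟩ := M.exists_ev hCj
  rw [← hu] at hi hj hx hy
  have hux := M.adj_of_insert hi hx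
  have huy := M.adj_of_insert hj hy
  refine ⟨u, x, y, (M.dirEdge_iff hv).2 ⟨_, hi, hx⟩, (M.dirEdge_iff hv).2 ⟨_, hj, hy⟩,
    M.edgeIn_iff.2 hux.2, M.edgeIn_iff.2 huy.2, ?_⟩
  -- the fourth vertex of a square would contain both conflicting events
  rintro ⟨z, -, hxz, hzy, -, huz, -⟩
  obtain ⟨e, he⟩ := M.adj_iff_flip.1 hxz
  obtain ⟨f, hf⟩ := M.adj_iff_flip.1 hzy.symm
  have hne := h.ne
  have hix : M.eventEquiv i ∈ M.ev x := hx ▸ Or.inl rfl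
  have hjy : M.eventEquiv j ∈ M.ev y := hy ▸ Or.inl rfl
  have hiz : M.eventEquiv i ∈ M.ev z := by
    by_contra hiz
    rw [he, mem_symmDiff_singleton, not_not] at hiz
    rw [← hiz.1 hix, hx, ← symmDiff_singleton_of_notMem hi, symmDiff_symmDiff_cancel_right] at he
    exact huz (M.ev_injective he.symm)
  have hjz : M.eventEquiv j ∈ M.ev z := by
    by_contra hjz
    rw [hf, mem_symmDiff_singleton, not_not] at hjz
    rw [← hjz.1 hjy, hy, ← symmDiff_singleton_of_notMem hj, symmDiff_symmDiff_cancel_right] at hf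
    exact huz (M.ev_injective hf.symm)
  exact (M.isConfiguration_ev z).2.1 _ hiz _ hjz hconf

/-- If no nice labeling has a finite range, then the pointed contact graph is not finitely
colorable. -/
theorem chromaticNumber_pointedContactGraph_eq_top
    (h : ∀ (L : Type) (lab : E → L), S.IsNiceLabeling lab → (Set.range lab).Infinite) :
    (G.pointedContactGraph v).chromaticNumber = ⊤ := by
  by_contra hne
  obtain ⟨n, ⟨c⟩⟩ := SimpleGraph.chromaticNumber_ne_top_iff_exists.1 hne
  refine h (Fin n) (fun e => c (M.eventEquiv.symm e)) (fun e f hef => ?_) (Set.toFinite _)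
  apply c.valid
  apply M.pointedContactGraph_adj_of_independent hv
  simpa using hef

end DomainModel

/-! ### Chains of event structures -/

section ChainEvents

variable {E : ℕ → Type*} (S : ∀ n, EventStructure (E n)) (T : ∀ n, Set (E n))

/-- Causal dependency in a chain of event structures: the events of the spine `T n` precede
all events of the later levels. -/
inductive ChainLe : (Σ n, E n) → (Σ n, E n) → Prop
  | level {n : ℕ} {e f : E n} : (S n).le e f → ChainLe ⟨n, e⟩ ⟨n, f⟩
  | below {n m : ℕ} {e : E n} {f : E m} : n < m → e ∈ T n → ChainLe ⟨n, e⟩ ⟨m, f⟩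

/-- Conflict in a chain of event structures: the events outside of the spine are in conflict with
all events of the later levels. -/
inductive ChainConflict : (Σ n, E n) → (Σ n, E n) → Prop
  | level {n : ℕ} {e f : E n} : (S n).conflict e f → ChainConflict ⟨n, e⟩ ⟨n, f⟩
  | below {n m : ℕ} {e : E n} {f : E m} : n < m → e ∉ T n → ChainConflict ⟨n, e⟩ ⟨m, f⟩
  | above {n m : ℕ} {e : E n} {f : E m} : m < n → f ∉ T m → ChainConflict ⟨n, e⟩ ⟨m, f⟩

variable {S T}

theorem chainLe_level_iff {n : ℕ} {e f : E n} :
    ChainLe S T ⟨n, e⟩ ⟨n, f⟩ ↔ (S n).le e f := by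
  constructor
  · intro h
    cases h with
    | level h => exact h
    | below h => exact absurd h (lt_irrefl n)
  · exact .level

theorem chainConflict_level_iff {n : ℕ} {e f : E n} :
    ChainConflict S T ⟨n, e⟩ ⟨n, f⟩ ↔ (S n).conflict e f := by
  constructor
  · intro h
    cases h with
    | level h => exact h
    | below h => exact absurd h (lt_irrefl n)
    | above h => exact absurd h (lt_irrefl n)
  · exact .level

theorem chainLe_iff_of_lt {n m : ℕ} (hnm : n < m) {e : E n} {f : E m} :
    ChainLe S T ⟨n, e⟩ ⟨m, f⟩ ↔ e ∈ T n := by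
  constructor
  · intro h
    cases h with
    | level h => exact absurd hnm (lt_irrefl n)
    | below _ h => exact h
  · exact .below hnm

theorem chainConflict_iff_of_lt {n m : ℕ} (hnm : n < m) {e : E n} {f : E m} :
    ChainConflict S T ⟨n, e⟩ ⟨m, f⟩ ↔ e ∉ T n := by
  constructor
  · intro h
    cases h with
    | level h => exact absurd hnm (lt_irrefl n)
    | below _ h => exact h
    | above h => exact absurd hnm h.not_gt
  · exact .below hnm

theorem ChainLe.fst_le {p q : Σ n, E n} (h : ChainLe S T p q) : p.1 ≤ q.1 := by
  cases h with
  | level => exact le_rfl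
  | below h => exact h.le

variable (S T) in
/-- The chain of the event structures `S n`, where the `n`-th one is left through its
configuration `T n`. -/
def chainEvents (hT : ∀ n, (S n).IsConfiguration (T n)) : EventStructure (Σ n, E n) where
  le := ChainLe S T
  conflict := ChainConflict S T
  le_refl p := .level ((S p.1).le_refl p.2)
  le_antisymm p q h h' := by
    cases h with
    | level h => rw [(S _).le_antisymm _ _ h (chainLe_level_iff.1 h')]
    | below h => exact absurd h h'.fst_le.not_gt
  le_trans p q r h h' := by
    cases h with
    | level h =>
      cases h' with
      | level h' => exact .level ((S _).le_trans _ _ _ h h')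
      | below h' hf => exact .below h' ((hT _).2.2 _ hf _ h)
    | below h he => exact .below (h.trans_le h'.fst_le) he
  conflict_irrefl p h := (S p.1).conflict_irrefl p.2 (chainConflict_level_iff.1 h)
  conflict_symm p q h := by
    cases h with
    | level h => exact .level ((S _).conflict_symm _ _ h)
    | below h he => exact .above h he
    | above h he => exact .below h he
  conflict_inherit p q r h h' := by
    cases h with
    | level h =>
      cases h' with
      | level h' => exact .level ((S _).conflict_inherit _ _ _ h h')
      | below h' hf => exact .below h' fun he => (hT _).2.1 _ he _ hf h
    | below h he => exact .below (h.trans_le h'.fst_le) he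
    | above h he =>
      cases h' with
      | level h' => exact .above h fun hf => he ((hT _).2.2 _ hf _ h')
      | below h' hf => exact absurd hf he
  finitary p := by
    refine ((((Set.finite_Iio p.1).biUnion fun m _ => (hT m).1.image (Sigma.mk m))).union
      (((S p.1).finitary p.2).image (Sigma.mk p.1))).subset ?_
    rintro q (h : ChainLe S T q p)
    cases h with
    | level h => exact Or.inr ⟨_, h, rfl⟩
    | below h he => exact Or.inl (Set.mem_biUnion h ⟨_, he, rfl⟩)

variable {hT : ∀ n, (S n).IsConfiguration (T n)}

/-! ### Independence in a chain -/

theorem chainEvents_independent_level_iff {n : ℕ} {e f : E n} :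
    (chainEvents S T hT).Independent ⟨n, e⟩ ⟨n, f⟩ ↔ (S n).Independent e f := by
  refine or_congr (and_congr chainLe_level_iff.not
    (and_congr chainLe_level_iff.not chainConflict_level_iff.not))
    (and_congr chainConflict_level_iff (not_congr ⟨?_, ?_⟩))
  · rintro ⟨⟨m, g⟩, hge, hgf, h⟩
    rcases lt_trichotomy m n with hm | rfl | hm
    · rcases h with ⟨h1, h2⟩ | ⟨h1, h2⟩ <;>
        exact absurd ((chainLe_iff_of_lt hm).1 h1) ((chainConflict_iff_of_lt hm).1 h2)
    · refine ⟨g, fun h => hge (h ▸ rfl), fun h => hgf (h ▸ rfl), ?_⟩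
      exact h.imp (And.imp chainLe_level_iff.1 chainConflict_level_iff.1)
        (And.imp chainLe_level_iff.1 chainConflict_level_iff.1)
    · rcases h with ⟨h1, -⟩ | ⟨h1, -⟩ <;> exact absurd hm (ChainLe.fst_le h1).not_gt
  · rintro ⟨g, hge, hgf, h⟩
    refine ⟨⟨n, g⟩, fun h => hge (eq_of_heq (Sigma.mk.inj h).2),
      fun h => hgf (eq_of_heq (Sigma.mk.inj h).2), ?_⟩
    exact h.imp (And.imp chainLe_level_iff.2 chainConflict_level_iff.2)
        (And.imp chainLe_level_iff.2 chainConflict_level_iff.2)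

/-- If every event outside of the spine is in conflict with an event of the spine, then no conflict
between events of different levels is minimal. -/
theorem fst_eq_of_independent (hmax : ∀ n, ∀ e ∉ T n, ∃ g ∈ T n, (S n).conflict g e)
    {p q : Σ n, E n} (h : (chainEvents S T hT).Independent p q) : p.1 = q.1 := by
  have key : ∀ {n m : ℕ} {e : E n} {f : E m}, n < m →
      ¬ (chainEvents S T hT).Independent ⟨n, e⟩ ⟨m, f⟩ := by
    intro n m e f hnm h
    have he : e ∉ T n := fun he => h.not_le ((chainLe_iff_of_lt hnm).2 he)
    obtain ⟨g, hg, hge⟩ := hmax n e he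
    refine h.symm.not_conflict_of_lt (g := ⟨n, g⟩)
      (show ChainLe S T _ _ from .below hnm hg) ?_
      (show ChainConflict S T _ _ from .level hge)
    intro h
    exact hnm.ne (Sigma.mk.inj h).1
  rcases lt_trichotomy p.1 q.1 with hlt | heq | hlt
  · exact absurd h (key hlt)
  · exact heq
  · exact absurd h.symm (key hlt)

theorem degree_chainEvents (hmax : ∀ n, ∀ e ∉ T n, ∃ g ∈ T n, (S n).conflict g e) {d : ℕ∞}
    (hd : ∀ n, (S n).degree = d) : (chainEvents S T hT).degree = d := by
  apply le_antisymm
  · refine EventStructure.degree_le_of_forall fun A hA => ?_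
    rcases A.eq_empty_or_nonempty with rfl | ⟨⟨n, e⟩, he⟩
    · simp
    have hlevel : ∀ q ∈ A, q.1 = n := by
      intro q hq
      by_cases hqe : q = ⟨n, e⟩
      · rw [hqe]
      · exact fst_eq_of_independent hmax (hA hq he hqe)
    have himg : A = Sigma.mk n '' {f | ⟨n, f⟩ ∈ A} := by
      ext q
      constructor
      · intro hq
        obtain ⟨m, f⟩ := q
        obtain rfl : m = n := hlevel _ hq
        exact ⟨f, hq, rfl⟩
      · rintro ⟨f, hf, rfl⟩
        exact hf
    rw [himg, sigma_mk_injective.encard_image, ← hd n]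
    refine le_iSup_of_le (f := fun A : {A : Set (E n) // A.Pairwise (S n).Independent} =>
      (A : Set (E n)).encard) ⟨_, ?_⟩ le_rfl
    intro f hf g hg hfg
    exact chainEvents_independent_level_iff.1
      (hA hf hg fun h => hfg (eq_of_heq (Sigma.mk.inj h).2))
  · rw [← hd 0]
    refine EventStructure.degree_le_of_forall fun A hA => ?_
    rw [← (sigma_mk_injective (β := E) (i := 0)).encard_image]
    refine le_iSup_of_le (f := fun A : {A : Set (Σ n, E n) //
      A.Pairwise (chainEvents S T hT).Independent} => (A : Set (Σ n, E n)).encard) ⟨_, ?_⟩ le_rfl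
    rintro _ ⟨f, hf, rfl⟩ _ ⟨g, hg, rfl⟩ hfg
    exact chainEvents_independent_level_iff.2 (hA hf hg fun h => hfg (h ▸ rfl))

/-! ### Configurations of a chain -/

/-- The set of events obtained by passing through the spines of the levels below `n`
and then performing the events of `A` in level `n`. -/
def chainSet (T : ∀ n, Set (E n)) (n : ℕ) (A : Set (E n)) : Set (Σ n, E n) :=
  {p | (p.1 < n ∧ p.2 ∈ T p.1) ∨ p ∈ Sigma.mk n '' A}

theorem mem_chainSet_level {n : ℕ} {A : Set (E n)} {e : E n} :
    ⟨n, e⟩ ∈ chainSet T n A ↔ e ∈ A := by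
  constructor
  · rintro (h | ⟨f, hf, h⟩)
    · exact absurd h.1 (lt_irrefl n)
    · rwa [← eq_of_heq (Sigma.mk.inj h).2]
  · exact fun h => Or.inr ⟨e, h, rfl⟩

theorem mem_chainSet_of_lt {n m : ℕ} (hm : m < n) {A : Set (E n)} {e : E m} :
    ⟨m, e⟩ ∈ chainSet T n A ↔ e ∈ T m := by
  constructor
  · rintro (h | ⟨f, hf, h⟩)
    · exact h.2
    · exact absurd (Sigma.mk.inj h).1 hm.ne'
  · exact fun h => Or.inl ⟨hm, h⟩

theorem fst_le_of_mem_chainSet {n : ℕ} {A : Set (E n)} {p : Σ n, E n} (h : p ∈ chainSet T n A) :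
    p.1 ≤ n := by
  rcases h with h | ⟨f, hf, rfl⟩
  exacts [h.1.le, le_rfl]

theorem chainSet_injective (n : ℕ) : Function.Injective (chainSet T n) := by
  intro A B h
  ext e
  rw [← mem_chainSet_level (T := T), h, mem_chainSet_level]

/-- Completing the spine of a level is the same as having done nothing in the next level. -/
theorem chainSet_spine (n : ℕ) : chainSet T n (T n) = chainSet T (n + 1) ∅ := by
  ext ⟨m, e⟩
  constructor
  · rintro (h | ⟨f, hf, h⟩)
    · exact Or.inl ⟨h.1.trans (Nat.lt_succ_self n), h.2⟩
    · obtain ⟨rfl, h⟩ := Sigma.mk.inj h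
      obtain rfl := eq_of_heq h
      exact Or.inl ⟨Nat.lt_succ_self n, hf⟩
  · rintro (⟨h, he⟩ | ⟨f, hf, h⟩)
    · rcases (Nat.lt_succ_iff.1 h).lt_or_eq with h | rfl
      · exact Or.inl ⟨h, he⟩
      · exact Or.inr ⟨e, he, rfl⟩
    · exact absurd hf (Set.notMem_empty f)

theorem isConfiguration_chainSet {n : ℕ} {A : Set (E n)} (hA : (S n).IsConfiguration A) :
    (chainEvents S T hT).IsConfiguration (chainSet T n A) := by
  refine ⟨?_, ?_, ?_⟩
  · refine ((((Set.finite_Iio n).biUnion fun m _ => (hT m).1.image (Sigma.mk m))).union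
      (hA.1.image (Sigma.mk n))).subset ?_
    rintro ⟨m, e⟩ (⟨h, he⟩ | h)
    · exact Or.inl (Set.mem_biUnion h ⟨e, he, rfl⟩)
    · exact Or.inr h
  · intro p hp q hq h
    cases h with
    | @level m e f h =>
      rcases (fst_le_of_mem_chainSet hp).lt_or_eq with hm | rfl
      · exact (hT m).2.1 _ ((mem_chainSet_of_lt hm).1 hp) _ ((mem_chainSet_of_lt hm).1 hq) h
      · exact hA.2.1 _ (mem_chainSet_level.1 hp) _ (mem_chainSet_level.1 hq) h
    | below h he =>
      exact he ((mem_chainSet_of_lt (h.trans_le (fst_le_of_mem_chainSet hq))).1 hp)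
    | above h he =>
      exact he ((mem_chainSet_of_lt (h.trans_le (fst_le_of_mem_chainSet hp))).1 hq)
  · rintro p hp q (h : ChainLe S T q p)
    cases h with
    | @level m e f h =>
      rcases (fst_le_of_mem_chainSet hp).lt_or_eq with hm | rfl
      · exact (mem_chainSet_of_lt hm).2 ((hT m).2.2 _ ((mem_chainSet_of_lt hm).1 hp) _ h)
      · exact mem_chainSet_level.2 (hA.2.2 _ (mem_chainSet_level.1 hp) _ h)
    | below h he =>
      exact (mem_chainSet_of_lt (h.trans_le (fst_le_of_mem_chainSet hp))).2 he

/-- A configuration that contains the spines of the levels below `n`, and no other events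
outside of level `n`, is given by a configuration of level `n`. -/
theorem exists_eq_chainSet {C : Set (Σ n, E n)} (hC : (chainEvents S T hT).IsConfiguration C)
    {n : ℕ} (h1 : ∀ p ∈ C, p.1 ≤ n) (h2 : ∀ m < n, ∀ e : E m, ⟨m, e⟩ ∈ C ↔ e ∈ T m) :
    ∃ A, (S n).IsConfiguration A ∧ C = chainSet T n A := by
  have hA : (S n).IsConfiguration (Sigma.mk n ⁻¹' C) := by
    refine ⟨hC.1.preimage sigma_mk_injective.injOn, ?_, ?_⟩
    · exact fun e he f hf h => hC.2.1 ⟨n, e⟩ he ⟨n, f⟩ hf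
        (show ChainConflict S T _ _ from .level h)
    · exact fun e he f hf => hC.2.2 ⟨n, e⟩ he ⟨n, f⟩ (show ChainLe S T _ _ from .level hf)
  refine ⟨_, hA, ?_⟩
  ext ⟨m, e⟩
  rcases lt_trichotomy m n with hm | rfl | hm
  · rw [h2 m hm, mem_chainSet_of_lt hm]
  · rw [mem_chainSet_level, Set.mem_preimage]
  · exact iff_of_false (fun h => hm.not_ge (h1 ⟨m, e⟩ h))
      fun h => hm.not_ge (fst_le_of_mem_chainSet h)

theorem mem_iff_of_mem_above {C : Set (Σ n, E n)} (hC : (chainEvents S T hT).IsConfiguration C)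
    {n m : ℕ} {f : E n} (hf : ⟨n, f⟩ ∈ C) (hm : m < n) (e : E m) : ⟨m, e⟩ ∈ C ↔ e ∈ T m := by
  constructor
  · intro he
    by_contra hcon
    exact hC.2.1 _ he _ hf (.below hm hcon)
  · exact fun he => hC.2.2 _ hf _ (.below hm he)

theorem exists_chainSet {C : Set (Σ n, E n)} (hC : (chainEvents S T hT).IsConfiguration C) :
    ∃ n A, (S n).IsConfiguration A ∧ C = chainSet T n A := by
  rcases C.eq_empty_or_nonempty with rfl | hne
  · refine ⟨0, exists_eq_chainSet hC ?_ ?_⟩ <;> simp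
  · obtain ⟨⟨n, f⟩, hf, hmax⟩ := hC.1.exists_maximalFor Sigma.fst C hne
    have hle : ∀ p ∈ C, p.1 ≤ n := fun p hp => (le_total p.1 n).elim id fun h => hmax hp h
    exact ⟨n, exists_eq_chainSet hC hle fun m hm e => mem_iff_of_mem_above hC hf hm e⟩

/-- Two configurations that differ in one event of level `n` are both given by configurations of
level `n`. -/
theorem exists_chainSet_insert {C : Set (Σ n, E n)} {n : ℕ} {e : E n}
    (hC : (chainEvents S T hT).IsConfiguration C) (he : ⟨n, e⟩ ∉ C)
    (hC' : (chainEvents S T hT).IsConfiguration (insert ⟨n, e⟩ C)) :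
    ∃ A, (S n).IsConfiguration A ∧ (S n).IsConfiguration (insert e A) ∧ e ∉ A ∧
      C = chainSet T n A ∧ insert ⟨n, e⟩ C = chainSet T n (insert e A) := by
  have hle : ∀ p ∈ insert ⟨n, e⟩ C, p.1 ≤ n := by
    rintro ⟨m, f⟩ hf
    by_contra hlt
    have hlt : n < m := not_le.1 hlt
    have hfC : ⟨m, f⟩ ∈ C := hf.resolve_left fun h => hlt.ne' (Sigma.mk.inj h).1
    have heT := (mem_iff_of_mem_above hC' hf hlt e).1 (Or.inl rfl)
    exact he ((mem_iff_of_mem_above hC hfC hlt e).2 heT)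
  have hmem := fun m (hm : m < n) f => mem_iff_of_mem_above hC' (Or.inl rfl) hm f
  obtain ⟨A, hA, hCA⟩ := exists_eq_chainSet hC (fun p hp => hle p (Or.inr hp)) (n := n) (by
    intro m hm f
    rw [← hmem m hm f, Set.mem_insert_iff, or_iff_right]
    exact fun h => hm.ne (Sigma.mk.inj h).1)
  obtain ⟨B, hB, hCB⟩ := exists_eq_chainSet hC' hle hmem
  have hBA : B = insert e A := by
    ext f
    rw [← mem_chainSet_level (T := T), ← hCB, Set.mem_insert_iff, Set.mem_insert_iff, hCA,
      mem_chainSet_level]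
    refine or_congr ⟨fun h => eq_of_heq (Sigma.mk.inj h).2, fun h => h ▸ rfl⟩ Iff.rfl
  rw [hCA, mem_chainSet_level] at he
  exact ⟨A, hA, hBA ▸ hB, he, hCA, hBA ▸ hCB⟩

end ChainEvents

section ChainModel

variable {V E : ℕ → Type*} {G : ∀ n, SimpleGraph (V n)} {S : ∀ n, EventStructure (E n)}
  {T : ∀ n, Set (E n)} {hT : ∀ n, (S n).IsConfiguration (T n)} {α β : ∀ n, V n}
  (M : ∀ n, DomainModel (G n) (S n))
  (hα : ∀ n, (M n).ev (α n) = ∅) (hβ : ∀ n, (M n).ev (β n) = T n)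

/-- The events of a vertex of the chain. -/
def chainEv : ChainVertex α β → Set (Σ n, E n) :=
  Quot.lift (fun p => chainSet T p.1 ((M p.1).ev p.2)) <| by
    rintro _ _ ⟨n⟩
    change chainSet T n ((M n).ev (β n)) = chainSet T (n + 1) ((M (n + 1)).ev (α (n + 1)))
    rw [hα, hβ, chainSet_spine]

theorem chainEv_chainMk (n : ℕ) (x : V n) :
    chainEv M hα hβ (chainMk α β n x) = chainSet T n ((M n).ev x) := rfl

theorem chainMk_spine (n : ℕ) : chainMk α β n (β n) = chainMk α β (n + 1) (α (n + 1)) :=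
  Quot.sound (.glue n)

theorem exists_chainMk (p : ChainVertex α β) : ∃ n x, chainMk α β n x = p := by
  obtain ⟨⟨n, x⟩⟩ := p
  exact ⟨n, x, rfl⟩

theorem isConfiguration_chainEv (p : ChainVertex α β) :
    (chainEvents S T hT).IsConfiguration (chainEv M hα hβ p) := by
  obtain ⟨n, x, rfl⟩ := exists_chainMk p
  exact isConfiguration_chainSet ((M n).isConfiguration_ev x)

theorem chainEv_injective (hne : ∀ n, (T n).Nonempty) :
    Function.Injective (chainEv M hα hβ) := by
  have key : ∀ n m x y, n ≤ m →
      chainEv M hα hβ (chainMk α β n x) = chainEv M hα hβ (chainMk α β m y) →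
      chainMk α β n x = chainMk α β m y := by
    intro n m x y hnm h
    rw [chainEv_chainMk, chainEv_chainMk] at h
    rcases hnm.eq_or_lt with rfl | hlt
    · rw [(M n).ev_injective (chainSet_injective n h)]
    -- the configuration contains the whole spine of level `n`, but nothing above
    have hx : x = β n := by
      apply (M n).ev_injective
      rw [hβ]
      ext e
      rw [← mem_chainSet_level (T := T), h, mem_chainSet_of_lt hlt]
    have hm : m = n + 1 := by
      by_contra hm
      have hlt' : n + 1 < m := by omega
      obtain ⟨e, he⟩ := hne (n + 1)
      rw [← mem_chainSet_of_lt (A := (M m).ev y) hlt', ← h] at he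
      have := fst_le_of_mem_chainSet he
      simp at this
    subst hm
    have hy : y = α (n + 1) := by
      apply (M (n + 1)).ev_injective
      rw [hα]
      apply chainSet_injective (T := T)
      rw [← h, hx, hβ, chainSet_spine]
    rw [hx, hy]
    exact Quot.sound (.glue n)
  intro p q h
  obtain ⟨n, x, rfl⟩ := exists_chainMk p
  obtain ⟨m, y, rfl⟩ := exists_chainMk q
  rcases le_total n m with hnm | hnm
  · exact key n m x y hnm h
  · exact (key m n y x hnm h.symm).symm

theorem exists_chainEv {C : Set (Σ n, E n)} (hC : (chainEvents S T hT).IsConfiguration C) :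
    ∃ p, chainEv M hα hβ p = C := by
  obtain ⟨n, A, hA, rfl⟩ := exists_chainSet hC
  obtain ⟨x, rfl⟩ := (M n).exists_ev hA
  exact ⟨chainMk α β n x, rfl⟩

include M hα hβ in
theorem chainMk_injective (n : ℕ) : Function.Injective (chainMk α β n) := by
  intro x y h
  have := congrArg (chainEv M hα hβ) h
  exact (M n).ev_injective (chainSet_injective n this)

include M hα hβ in
theorem chainGraph_adj {n : ℕ} {x y : V n} (h : (G n).Adj x y) :
    (chainGraph G α β).Adj (chainMk α β n x) (chainMk α β n y) :=
  (SimpleGraph.fromRel_adj _ _ _).2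
    ⟨fun heq => h.ne (chainMk_injective M hα hβ n heq), Or.inl ⟨n, x, y, h, rfl, rfl⟩⟩

theorem chainEv_symmDiff {n : ℕ} {x y : V n} (h : (G n).Adj x y) :
    ∃ e, chainEv M hα hβ (chainMk α β n x) ∆ chainEv M hα hβ (chainMk α β n y) = {e} := by
  obtain ⟨e, he⟩ := ((M n).adj_iff x y).1 h
  refine ⟨⟨n, e⟩, ?_⟩
  rw [chainEv_chainMk, chainEv_chainMk]
  ext ⟨m, f⟩
  rw [Set.mem_symmDiff, Set.mem_singleton_iff]
  rcases lt_trichotomy m n with hm | rfl | hm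
  · rw [mem_chainSet_of_lt hm, mem_chainSet_of_lt hm]
    have : (⟨m, f⟩ : Σ n, E n) ≠ ⟨n, e⟩ := fun h => hm.ne (Sigma.mk.inj h).1
    tauto
  · rw [mem_chainSet_level, mem_chainSet_level, ← Set.mem_symmDiff]
    change f ∈ ((M m).conf x).1 ∆ ((M m).conf y).1 ↔ _
    rw [he]
    exact ⟨fun h => congrArg _ h, fun h => eq_of_heq (Sigma.mk.inj h).2⟩
  · have h1 : ∀ z, ⟨m, f⟩ ∉ chainSet T n ((M n).ev z) := fun z hz =>
      hm.not_ge (fst_le_of_mem_chainSet hz)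
    have : (⟨m, f⟩ : Σ n, E n) ≠ ⟨n, e⟩ := fun h => hm.ne' (Sigma.mk.inj h).1
    have h2 := h1 x
    have h3 := h1 y
    tauto

/-- Vertices of the chain whose configurations differ in one event of level `n` are the
images of adjacent vertices of the `n`-th graph. -/
theorem exists_chainMk_adj (hne : ∀ n, (T n).Nonempty) {p q : ChainVertex α β} {n : ℕ} {e : E n}
    (he : ⟨n, e⟩ ∉ chainEv M hα hβ p)
    (h : chainEv M hα hβ q = insert ⟨n, e⟩ (chainEv M hα hβ p)) :
    ∃ x y, (G n).Adj x y ∧ chainMk α β n x = p ∧ chainMk α β n y = q ∧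
      (M n).ev y = insert e ((M n).ev x) := by
  have hinj := chainEv_injective M hα hβ hne
  obtain ⟨A, hA, hA', heA, h1, h2⟩ := exists_chainSet_insert (hT := fun n => hβ n ▸
    (M n).isConfiguration_ev _) (isConfiguration_chainEv M hα hβ p) he
      (h ▸ isConfiguration_chainEv M hα hβ q)
  obtain ⟨x, rfl⟩ := (M n).exists_ev hA
  obtain ⟨y, hy⟩ := (M n).exists_ev hA'
  refine ⟨x, y, ((M n).adj_of_insert heA hy).1, ?_, ?_, hy⟩
  · exact hinj h1.symm
  · apply hinj
    rw [h, h2, chainEv_chainMk, hy]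

/-- A chain of covering graphs of domains is the covering graph of the domain of the
chain of event structures. -/
noncomputable def chainModel (hne : ∀ n, (T n).Nonempty) :
    DomainModel (chainGraph G α β) (chainEvents S T hT) where
  conf := Equiv.ofBijective
    (fun p => ⟨chainEv M hα hβ p, isConfiguration_chainEv M hα hβ p⟩)
    ⟨fun p q h => chainEv_injective M hα hβ hne (congrArg Subtype.val h), fun C =>
      (exists_chainEv M hα hβ C.2).imp fun _ h => Subtype.ext h⟩
  adj_iff p q := by
    change (chainGraph G α β).Adj p q ↔ ∃ e, chainEv M hα hβ p ∆ chainEv M hα hβ q = {e}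
    constructor
    · intro h
      rcases ((SimpleGraph.fromRel_adj _ _ _).1 h).2 with
        ⟨n, x, y, hxy, rfl, rfl⟩ | ⟨n, x, y, hxy, rfl, rfl⟩
      · exact chainEv_symmDiff M hα hβ hxy
      · rw [symmDiff_comm]
        exact chainEv_symmDiff M hα hβ hxy
    · have key : ∀ p q e, e ∉ chainEv M hα hβ p →
          chainEv M hα hβ q = insert e (chainEv M hα hβ p) → (chainGraph G α β).Adj p q := by
        rintro p q ⟨n, e⟩ he h
        obtain ⟨x, y, hxy, rfl, rfl, -⟩ := exists_chainMk_adj M hα hβ hne he h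
        exact chainGraph_adj M hα hβ hxy
      rintro ⟨e, he⟩
      by_cases hep : e ∈ chainEv M hα hβ p
      · rw [symmDiff_comm] at he
        have heq : e ∉ chainEv M hα hβ q := by
          intro heq
          have : e ∈ chainEv M hα hβ q ∆ chainEv M hα hβ p := he ▸ rfl
          rw [Set.mem_symmDiff] at this
          tauto
        refine (key q p e heq ?_).symm
        rw [symmDiff_eq_singleton_iff.1 he, symmDiff_singleton_of_notMem heq]
      · refine key p q e hep ?_
        rw [symmDiff_eq_singleton_iff.1 he, symmDiff_singleton_of_notMem hep]

/-! ### Articulation vertices of a chain -/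

include M hα hβ in
/-- A vertex `β n` is an articulation vertex of the chain: every edge entering the set of the
vertices whose configuration contains the spine of level `n` ends at `β n`. -/
theorem isArticulation_chainMk_spine (hne : ∀ n, (T n).Nonempty)
    (hmax : ∀ n, ∀ e ∉ T n, ∃ g ∈ T n, (S n).conflict g e) (n : ℕ) :
    (chainGraph G α β).IsArticulation (chainMk α β n (β n)) := by
  have hT : ∀ n, (S n).IsConfiguration (T n) := fun n => hβ n ▸ (M n).isConfiguration_ev _
  set p := chainMk α β n (β n) with hp
  let N := chainModel (hT := hT) M hα hβ hne
  let U : ChainVertex α β → Prop := fun q => ∀ e ∈ T n, ⟨n, e⟩ ∈ chainEv M hα hβ q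
  have hstep : ∀ q r, q ≠ p → r ≠ p → (chainGraph G α β).Adj q r → U q → U r := by
    intro q r hq hr hqr hU
    obtain ⟨⟨m, f⟩, hf⟩ := N.adj_iff_flip.1 hqr
    change chainEv M hα hβ r = chainEv M hα hβ q ∆ _ at hf
    by_contra hUr
    simp only [U, not_forall] at hUr
    obtain ⟨e, he, her⟩ := hUr
    have heq := hU e he
    rw [hf, mem_symmDiff_singleton, not_not] at her
    obtain ⟨rfl, h⟩ := Sigma.mk.inj (her.1 heq)
    obtain rfl := eq_of_heq h
    have her' : ⟨n, e⟩ ∉ chainEv M hα hβ r := by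
      rw [hf, mem_symmDiff_singleton, not_not]
      exact her
    have hins : chainEv M hα hβ q = insert ⟨n, e⟩ (chainEv M hα hβ r) := by
      rw [← symmDiff_singleton_of_notMem her', hf, symmDiff_symmDiff_cancel_right]
    obtain ⟨x, y, -, -, rfl, -⟩ := exists_chainMk_adj M hα hβ hne her' hins
    apply hq
    rw [hp]
    congr 1
    apply (M n).ev_injective
    rw [hβ]
    have hsub : T n ⊆ (M n).ev y := fun g hg => mem_chainSet_level.1 (hU g hg)
    refine Set.Subset.antisymm (fun g hg => ?_) hsub
    by_contra hgT
    obtain ⟨g', hg', hc⟩ := hmax n g hgT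
    exact ((M n).isConfiguration_ev y).2.1 _ (hsub hg') _ hg hc
  intro hpre
  have hreach : ∀ a b : ({p}ᶜ : Set (ChainVertex α β)),
      ((chainGraph G α β).induce {p}ᶜ).Reachable a b → U a.1 → U b.1 := by
    rintro a b ⟨w⟩
    induction w with
    | nil => exact id
    | @cons a b _ h _ ih => exact fun hU => ih (hstep _ _ a.2 b.2 h hU)
  have h1 : chainMk α β n (α n) ≠ p := by
    intro h
    have := chainMk_injective M hα hβ n h
    have h' := hβ n
    rw [← this, hα] at h'
    exact (hne n).ne_empty h'.symm
  have h2 : chainMk α β (n + 1) (β (n + 1)) ≠ p := by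
    rw [hp, chainMk_spine n]
    intro h
    have := chainMk_injective M hα hβ (n + 1) h
    have h' := hβ (n + 1)
    rw [this, hα] at h'
    exact (hne (n + 1)).ne_empty h'.symm
  obtain ⟨e, he⟩ := hne n
  have := hreach ⟨_, h2⟩ ⟨_, h1⟩ (hpre _ _)
    (fun e he => (mem_chainSet_of_lt (Nat.lt_succ_self n)).2 he) e he
  change ⟨n, e⟩ ∈ chainSet T n ((M n).ev (α n)) at this
  rw [mem_chainSet_level, hα] at this
  exact this

include M hα hβ in
/-- If no graph of the chain has an articulation vertex, then the chain has no articulation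
vertices other than the glued ones. -/
theorem exists_eq_of_isArticulation_chainGraph
    (hG : ∀ n x, ¬ (G n).IsArticulation x) {p : ChainVertex α β}
    (hp : (chainGraph G α β).IsArticulation p) : ∃ n, p = chainMk α β n (β n) := by
  by_contra! hcon
  apply hp
  have hlevel : ∀ n x y (hx : chainMk α β n x ≠ p) (hy : chainMk α β n y ≠ p),
      ((chainGraph G α β).induce {p}ᶜ).Reachable ⟨_, hx⟩ ⟨_, hy⟩ := by
    intro n x y hx hy
    let W : Set (V n) := {z | chainMk α β n z ≠ p}
    have hW : ((G n).induce W).Preconnected := by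
      by_cases hz : ∃ z, chainMk α β n z = p
      · obtain ⟨z, rfl⟩ := hz
        have : W = {z}ᶜ := by
          ext w
          exact (chainMk_injective M hα hβ n).ne_iff
        rw [this]
        exact not_not.1 (hG n z)
      · have : W = Set.univ := Set.eq_univ_of_forall fun z h => hz ⟨z, h⟩
        rw [this]
        exact (SimpleGraph.induceUnivIso (G n)).preconnected_iff.2 (M n).connected.preconnected
    let φ : (G n).induce W →g (chainGraph G α β).induce {p}ᶜ :=
      { toFun := fun z => ⟨chainMk α β n z.1, z.2⟩
        map_rel' := fun h => chainGraph_adj M hα hβ h }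
    exact (hW ⟨x, hx⟩ ⟨y, hy⟩).map φ
  have hspine : ∀ n, ((chainGraph G α β).induce {p}ᶜ).Reachable
      ⟨chainMk α β n (β n), (hcon n).symm⟩ ⟨chainMk α β 0 (β 0), (hcon 0).symm⟩ := by
    intro n
    induction n with
    | zero => rfl
    | succ n ih =>
      refine SimpleGraph.Reachable.trans ?_ ih
      have hx : chainMk α β (n + 1) (α (n + 1)) ≠ p := by
        rw [← chainMk_spine n]
        exact (hcon n).symm
      have := hlevel (n + 1) _ _ (hcon (n + 1)).symm hx
      simpa only [← chainMk_spine n] using this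
  have hall : ∀ q : ({p}ᶜ : Set (ChainVertex α β)),
      ((chainGraph G α β).induce {p}ᶜ).Reachable q ⟨chainMk α β 0 (β 0), (hcon 0).symm⟩ := by
    rintro ⟨q, hq⟩
    obtain ⟨n, x, rfl⟩ := exists_chainMk q
    exact (hlevel n _ _ hq (hcon n).symm).trans (hspine n)
  exact fun q r => (hall q).trans (hall r).symm

end ChainModel

/-! ### Articulation vertices and links -/

section Link

variable {V : Type*} {G : SimpleGraph V}

/-- A vertex of a connected graph is not an articulation vertex if its neighbors are pairwise
connected in its complement: a walk through it can be rerouted. -/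
theorem not_isArticulation_of_link (hG : G.Preconnected) {x : V}
    (h : ∀ y z (hy : G.Adj x y) (hz : G.Adj x z),
      (G.induce {x}ᶜ).Reachable ⟨y, hy.ne'⟩ ⟨z, hz.ne'⟩) : ¬ G.IsArticulation x := by
  have key : ∀ {a b : V} (_ : G.Walk a b) (hb : b ≠ x),
      (∀ ha : a ≠ x, (G.induce {x}ᶜ).Reachable ⟨a, ha⟩ ⟨b, hb⟩) ∧
      (a = x → ∀ y (hy : G.Adj x y), (G.induce {x}ᶜ).Reachable ⟨y, hy.ne'⟩ ⟨b, hb⟩) := by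
    intro a b w hb
    induction w with
    | nil => exact ⟨fun _ => .rfl, fun ha => absurd ha hb⟩
    | @cons a c b hac w ih =>
      obtain ⟨ih1, ih2⟩ := ih hb
      constructor
      · intro ha
        by_cases hc : c = x
        · subst hc
          exact ih2 rfl a hac.symm
        · have : (G.induce {x}ᶜ).Adj ⟨a, ha⟩ ⟨c, hc⟩ := hac
          exact this.reachable.trans (ih1 hc)
      · rintro rfl y hy
        exact (h y c hy hac).trans (ih1 hac.ne')
  refine not_not.2 ?_
  rintro ⟨a, ha⟩ ⟨b, hb⟩
  obtain ⟨w⟩ := hG a b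
  exact (key w hb).1 ha

/-- Opposite vertices of a path of length two avoiding `x`. -/
theorem reachable_induce_compl {x y w z : V} (hy : y ≠ x) (hw : w ≠ x) (hz : z ≠ x)
    (hyw : G.Adj y w) (hwz : G.Adj w z) : (G.induce {x}ᶜ).Reachable ⟨y, hy⟩ ⟨z, hz⟩ := by
  have h1 : (G.induce {x}ᶜ).Adj ⟨y, hy⟩ ⟨w, hw⟩ := hyw
  have h2 : (G.induce {x}ᶜ).Adj ⟨w, hw⟩ ⟨z, hz⟩ := hwz
  exact h1.reachable.trans h2.reachable

end Link

theorem exists_symmDiff_eq_singleton_iff {E : Type*} {A B : Set E} :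
    (∃ e, A ∆ B = {e}) ↔ (∃ e, e ∉ A ∧ B = insert e A) ∨ ∃ e, e ∉ B ∧ A = insert e B := by
  constructor
  · rintro ⟨e, he⟩
    by_cases heA : e ∈ A
    · rw [symmDiff_comm] at he
      have heB : e ∉ B := by
        intro heB
        have : e ∈ B ∆ A := he ▸ rfl
        rw [Set.mem_symmDiff] at this
        tauto
      refine Or.inr ⟨e, heB, ?_⟩
      rw [symmDiff_eq_singleton_iff.1 he, symmDiff_singleton_of_notMem heB]
    · refine Or.inl ⟨e, heA, ?_⟩
      rw [symmDiff_eq_singleton_iff.1 he, symmDiff_singleton_of_notMem heA]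
  · rintro (⟨e, he, h⟩ | ⟨e, he, h⟩)
    · exact ⟨e, symmDiff_eq_singleton_iff.2 (by rw [h, symmDiff_singleton_of_notMem he])⟩
    · refine ⟨e, ?_⟩
      rw [symmDiff_comm, symmDiff_eq_singleton_iff, h, symmDiff_singleton_of_notMem he]

namespace BoxHypergraph

variable (B : BoxHypergraph)

/-! ### Planes -/

theorem zero_mem_planes (k : Fin 3) : 0 ∈ B.planes k := Or.inl (Or.inl (Or.inl rfl))

theorem corner_mem_planes (k : Fin 3) : B.corner k ∈ B.planes k := Or.inl (Or.inl (Or.inr rfl))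

theorem lo_mem_planes (i : Fin B.size) (k : Fin 3) : B.lo i k ∈ B.planes k :=
  Or.inl (Or.inr ⟨i, rfl⟩)

theorem hi_mem_planes (i : Fin B.size) (k : Fin 3) : B.hi i k ∈ B.planes k := Or.inr ⟨i, rfl⟩

variable {B}

theorem nonneg_of_mem_planes {k : Fin 3} {t : ℝ} (ht : t ∈ B.planes k) : 0 ≤ t := by
  rcases ht with ((rfl | rfl) | ⟨i, rfl⟩) | ⟨i, rfl⟩
  exacts [le_rfl, (B.corner_pos k).le, (B.lo_pos i k).le,
    ((B.lo_pos i k).trans (B.lo_lt_hi i k)).le]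

theorem le_corner_of_mem_planes {k : Fin 3} {t : ℝ} (ht : t ∈ B.planes k) : t ≤ B.corner k := by
  rcases ht with ((rfl | rfl) | ⟨i, rfl⟩) | ⟨i, rfl⟩
  exacts [(B.corner_pos k).le, le_rfl, (B.lo_lt_hi i k).le.trans (B.hi_le_corner i k),
    B.hi_le_corner i k]

variable (B) in
theorem finite_planes (k : Fin 3) : (B.planes k).Finite :=
  ((Set.toFinite _).union (Set.finite_range _)).union (Set.finite_range _)

theorem exists_next_plane {k : Fin 3} {s t : ℝ} (ht : t ∈ B.planes k) (hst : s < t) :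
    ∃ u ∈ B.planes k, s < u ∧ u ≤ t ∧ ∀ r ∈ B.planes k, s < r → u ≤ r := by
  obtain ⟨u, hu, hmin⟩ := ((B.finite_planes k).inter_of_left {r | s < r}).exists_minimal
    ⟨t, ht, hst⟩
  have : ∀ r ∈ B.planes k, s < r → u ≤ r := fun r hr hsr =>
    (le_total u r).elim id fun h => hmin ⟨hr, hsr⟩ h
  exact ⟨u, hu.1, hu.2, this t ht hst, this⟩

theorem exists_prev_plane {k : Fin 3} {s t : ℝ} (hs : s ∈ B.planes k) (hst : s < t) :
    ∃ u ∈ B.planes k, u < t ∧ s ≤ u ∧ ∀ r ∈ B.planes k, r < t → r ≤ u := by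
  obtain ⟨u, hu, hmax⟩ := ((B.finite_planes k).inter_of_left {r | r < t}).exists_maximal
    ⟨s, hs, hst⟩
  have : ∀ r ∈ B.planes k, r < t → r ≤ u := fun r hr hsr =>
    (le_total r u).elim id fun h => hmax ⟨hr, hsr⟩ h
  exact ⟨u, hu.1, hu.2, this s hs hst, this⟩

/-- Inside an interval bounded by planes, every plane has a neighbor. -/
theorem exists_neighbor_plane {k : Fin 3} {a b t : ℝ} (ha : a ∈ B.planes k)
    (hb : b ∈ B.planes k) (hab : a < b) (hat : a ≤ t) (htb : t ≤ b) :
    ∃ u ∈ B.planes k, a ≤ u ∧ u ≤ b ∧ t ≠ u ∧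
      ∀ r ∈ B.planes k, ¬ (t < r ∧ r < u) ∧ ¬ (u < r ∧ r < t) := by
  rcases htb.lt_or_eq with h | rfl
  · obtain ⟨u, hu, htu, hub, hmin⟩ := exists_next_plane hb h
    refine ⟨u, hu, hat.trans htu.le, hub, htu.ne, fun r hr => ⟨fun h => ?_, fun h => ?_⟩⟩
    · exact h.2.not_ge (hmin r hr h.1)
    · exact (h.1.trans h.2).not_gt htu
  · obtain ⟨u, hu, hut, hau, hmax⟩ := exists_prev_plane ha hab
    refine ⟨u, hu, hau, hut.le, hut.ne', fun r hr => ⟨fun h => ?_, fun h => ?_⟩⟩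
    · exact (h.1.trans h.2).not_gt hut
    · exact h.1.not_ge (hmax r hr h.2)

/-! ### The event structure of a box hypergraph -/

variable (B) in
/-- The events of the lifted graph of `B`: the gap between consecutive planes orthogonal to an
axis `k`, given by its upper end, and the boxes. -/
inductive Event : Type
  | plane (k : Fin 3) (t : {t : ℝ // t ∈ B.planes k ∧ 0 < t}) : Event
  | box (i : Fin B.size) : Event

instance : Finite B.Event := by
  have : ∀ k, Finite {t : ℝ // t ∈ B.planes k ∧ 0 < t} := fun k =>
    ((B.finite_planes k).subset fun t (ht : t ∈ B.planes k ∧ 0 < t) => ht.1).to_subtype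
  refine Finite.of_surjective
    (Sum.elim (fun p : Σ k, {t : ℝ // t ∈ B.planes k ∧ 0 < t} => Event.plane p.1 p.2) Event.box) ?_
  rintro (⟨k, t⟩ | i)
  exacts [⟨Sum.inl ⟨k, t⟩, rfl⟩, ⟨Sum.inr i, rfl⟩]

/-- A gap precedes the higher gaps of the same axis, and the boxes above it. -/
def EventLe : B.Event → B.Event → Prop
  | .plane k s, .plane l t => k = l ∧ s.1 ≤ t.1
  | .plane k s, .box i => s.1 ≤ B.lo i k
  | .box _, .plane _ _ => False
  | .box i, .box j => i = j

/-- A box is in conflict with the gaps above it and with the other boxes. -/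
def EventConflict : B.Event → B.Event → Prop
  | .plane _ _, .plane _ _ => False
  | .plane k s, .box i => B.hi i k < s.1
  | .box i, .plane k s => B.hi i k < s.1
  | .box i, .box j => i ≠ j

variable (B) in
/-- The event structure whose domain is the lifted graph of `B`. -/
def eventStructure : EventStructure B.Event where
  le := EventLe
  conflict := EventConflict
  le_refl e := by
    rcases e with ⟨k, s⟩ | i
    exacts [⟨rfl, le_rfl⟩, rfl]
  le_antisymm e f h h' := by
    rcases e with ⟨k, s⟩ | i <;> rcases f with ⟨l, t⟩ | j
    · obtain ⟨rfl, h⟩ := h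
      rw [Subtype.ext (le_antisymm h h'.2)]
    · exact h'.elim
    · exact h.elim
    · exact congrArg _ h
  le_trans e f g h h' := by
    rcases e with ⟨k, s⟩ | i <;> rcases f with ⟨l, t⟩ | j <;> rcases g with ⟨m, u⟩ | i'
    · obtain ⟨rfl, h⟩ := h
      exact ⟨h'.1, h.trans h'.2⟩
    · obtain ⟨rfl, h⟩ := h
      exact le_trans h h'
    · exact h'.elim
    · obtain rfl : j = i' := h'
      exact h
    · exact h.elim
    · exact h.elim
    · exact h'.elim
    · exact Eq.trans h h'
  conflict_irrefl e h := by
    rcases e with ⟨k, s⟩ | i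
    exacts [h, h rfl]
  conflict_symm e f h := by
    rcases e with ⟨k, s⟩ | i <;> rcases f with ⟨l, t⟩ | j
    exacts [h, h, h, Ne.symm h]
  conflict_inherit e f g h h' := by
    rcases e with ⟨k, s⟩ | i <;> rcases f with ⟨l, t⟩ | j <;> rcases g with ⟨m, u⟩ | i'
    · exact h
    · exact h.elim
    · exact h'.elim
    · obtain rfl : j = i' := h'
      exact h
    · obtain ⟨rfl, h'⟩ := h'
      exact lt_of_lt_of_le h h'
    · rintro rfl
      exact (B.lo_lt_hi i l).not_gt (lt_of_lt_of_le h h')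
    · exact h'.elim
    · obtain rfl : j = i' := h'
      exact h
  finitary e := Set.toFinite _

variable (B) in
/-- The gaps, without the boxes: the configuration of the corner opposite to the origin. -/
def spine : Set B.Event := {e | ∃ k t, e = .plane k t}

variable (B) in
theorem isConfiguration_spine : B.eventStructure.IsConfiguration B.spine := by
  refine ⟨Set.toFinite _, ?_, ?_⟩
  · rintro _ ⟨k, s, rfl⟩ _ ⟨l, t, rfl⟩
    exact id
  · rintro _ ⟨k, s, rfl⟩ (⟨l, t⟩ | i) h
    exacts [⟨l, t, rfl⟩, h.elim]

variable (B) in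
theorem spine_nonempty : B.spine.Nonempty :=
  ⟨.plane 0 ⟨B.corner 0, B.corner_mem_planes 0, B.corner_pos 0⟩, _, _, rfl⟩

theorem exists_conflict_of_notMem_spine (hB : ∀ i k, B.hi i k < B.corner k) (e : B.Event)
    (he : e ∉ B.spine) : ∃ g ∈ B.spine, B.eventStructure.conflict g e := by
  rcases e with ⟨k, s⟩ | i
  · exact absurd ⟨k, s, rfl⟩ he
  · exact ⟨.plane 0 ⟨B.corner 0, B.corner_mem_planes 0, B.corner_pos 0⟩, ⟨_, _, rfl⟩, hB i 0⟩

/-! ### The lifted graph as a domain -/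

/-- The events that have occurred at a vertex of the lifted graph. -/
def vertexEvents (x : B.LiftedVertex) : Set B.Event
  | .plane k t => t.1 ≤ x.1.2 k
  | .box i => x.1.1 = some i

theorem plane_mem_vertexEvents {x : B.LiftedVertex} {k : Fin 3}
    {t : {t : ℝ // t ∈ B.planes k ∧ 0 < t}} :
    .plane k t ∈ vertexEvents x ↔ t.1 ≤ x.1.2 k := Iff.rfl

theorem box_mem_vertexEvents {x : B.LiftedVertex} {i : Fin B.size} :
    .box i ∈ vertexEvents x ↔ x.1.1 = some i := Iff.rfl

theorem isConfiguration_vertexEvents (x : B.LiftedVertex) :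
    B.eventStructure.IsConfiguration (vertexEvents x) := by
  have hbox : ∀ i, x.1.1 = some i → ∀ k, B.lo i k ≤ x.1.2 k ∧ x.1.2 k ≤ B.hi i k :=
    fun i hi k => ⟨(x.2.2 i hi).1 k, (x.2.2 i hi).2 k⟩
  refine ⟨Set.toFinite _, ?_, ?_⟩
  · rintro (⟨k, s⟩ | i) he (⟨l, t⟩ | j) hf h
    · exact h
    · exact (lt_of_lt_of_le h he).not_ge (hbox j hf k).2
    · exact (lt_of_lt_of_le h hf).not_ge (hbox i he l).2
    · exact h (Option.some_injective _ ((box_mem_vertexEvents.1 he).symm.trans hf))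
  · rintro (⟨k, s⟩ | i) he (⟨l, t⟩ | j) h
    · obtain ⟨rfl, h⟩ := h
      exact le_trans h he
    · exact h.elim
    · exact le_trans h (hbox i he l).1
    · obtain rfl : j = i := h
      exact he

theorem le_of_plane_mem {x y : B.LiftedVertex} {k : Fin 3}
    (h : ∀ t, .plane k t ∈ vertexEvents x → .plane k t ∈ vertexEvents y) :
    x.1.2 k ≤ y.1.2 k := by
  by_contra! hlt
  have hpos : 0 < x.1.2 k := (nonneg_of_mem_planes (y.2.1 k)).trans_lt hlt
  exact hlt.not_ge (h ⟨x.1.2 k, x.2.1 k, hpos⟩ (le_refl (x.1.2 k)))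

theorem eq_of_plane_mem_iff {x y : B.LiftedVertex} {k : Fin 3}
    (h : ∀ t, .plane k t ∈ vertexEvents x ↔ .plane k t ∈ vertexEvents y) :
    x.1.2 k = y.1.2 k :=
  le_antisymm (le_of_plane_mem fun t => (h t).1) (le_of_plane_mem fun t => (h t).2)

theorem vertexEvents_injective : Function.Injective (vertexEvents (B := B)) := by
  intro x y h
  have h1 : x.1.2 = y.1.2 := funext fun k => eq_of_plane_mem_iff fun t => by rw [h]
  have h2 : x.1.1 = y.1.1 := by
    refine Option.ext fun i => ?_
    rw [← box_mem_vertexEvents, h, box_mem_vertexEvents]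
  exact Subtype.ext (Prod.ext h2 h1)

theorem exists_vertexEvents {C : Set B.Event} (hC : B.eventStructure.IsConfiguration C) :
    ∃ x, vertexEvents x = C := by
  have hp : ∀ k, ∃ a ∈ B.planes k, ∀ t, .plane k t ∈ C ↔ t.1 ≤ a := by
    intro k
    by_cases hne : ∃ t, .plane k t ∈ C
    · have hfin : {t | Event.plane k t ∈ C}.Finite :=
        hC.1.preimage (f := Event.plane k) fun s _ t _ h => by simpa using h
      obtain ⟨a, ha, hmax⟩ := hfin.exists_maximal hne
      refine ⟨a.1, a.2.1, fun t => ⟨fun ht => ?_, fun ht => ?_⟩⟩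
      · exact (le_total t a).elim id fun h => hmax ht h
      · exact hC.2.2 _ ha _ ⟨rfl, ht⟩
    · refine ⟨0, B.zero_mem_planes k, fun t => iff_of_false (fun ht => hne ⟨t, ht⟩) ?_⟩
      exact not_le.2 t.2.2
  choose p hp hpC using hp
  have ho : ∃ o : Option (Fin B.size), ∀ i, .box i ∈ C ↔ o = some i := by
    by_cases hne : ∃ i, .box i ∈ C
    · obtain ⟨i, hi⟩ := hne
      refine ⟨some i, fun j => ⟨fun hj => ?_, fun hj => Option.some_injective _ hj ▸ hi⟩⟩
      by_contra hij
      exact hC.2.1 _ hi _ hj fun h => hij (congrArg _ h)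
    · refine ⟨none, fun i => iff_of_false (fun hi => hne ⟨i, hi⟩) (by simp)⟩
  obtain ⟨o, ho⟩ := ho
  refine ⟨⟨(o, p), hp, fun i hi => ⟨fun k => ?_, fun k => ?_⟩⟩, ?_⟩
  · have hi := (ho i).2 hi
    exact (hpC k ⟨B.lo i k, B.lo_mem_planes i k, B.lo_pos i k⟩).1
      (hC.2.2 _ hi _ (le_refl (B.lo i k)))
  · have hi := (ho i).2 hi
    by_contra! hlt
    have hpos : 0 < p k := ((B.lo_pos i k).trans (B.lo_lt_hi i k)).trans hlt
    exact hC.2.1 _ ((hpC k ⟨p k, hp k, hpos⟩).2 le_rfl) _ hi hlt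
  · ext (⟨k, t⟩ | i)
    exacts [(hpC k t).symm, (ho i).symm]

theorem gridAdj_symm {p q : Fin 3 → ℝ} (h : B.GridAdj p q) : B.GridAdj q p := by
  obtain ⟨k, h1, h2, h3⟩ := h
  exact ⟨k, fun l hl => (h1 l hl).symm, h2.symm, fun r hr => (h3 r hr).symm⟩

theorem liftedGraph_adj_iff {x y : B.LiftedVertex} :
    B.liftedGraph.Adj x y ↔ (x.1.1 = y.1.1 ∧ B.GridAdj x.1.2 y.1.2) ∨
      (x.1.2 = y.1.2 ∧ x.1.1 = none ∧ y.1.1 ≠ none) ∨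
      (x.1.2 = y.1.2 ∧ x.1.1 ≠ none ∧ y.1.1 = none) := by
  rw [liftedGraph, SimpleGraph.fromRel_adj]
  constructor
  · rintro ⟨-, (⟨h, h'⟩ | h) | (⟨h, h'⟩ | ⟨h, h', h''⟩)⟩
    exacts [Or.inl ⟨h, h'⟩, Or.inr (Or.inl h), Or.inl ⟨h.symm, gridAdj_symm h'⟩,
      Or.inr (Or.inr ⟨h.symm, h'', h'⟩)]
  · rintro (⟨h, h'⟩ | h | ⟨h, h', h''⟩)
    · refine ⟨?_, Or.inl (Or.inl ⟨h, h'⟩)⟩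
      rintro rfl
      obtain ⟨k, -, h2, -⟩ := h'
      exact h2 rfl
    · refine ⟨?_, Or.inl (Or.inr h)⟩
      rintro rfl
      exact h.2.2 h.2.1
    · refine ⟨?_, Or.inr (Or.inr ⟨h.symm, h'', h'⟩)⟩
      rintro rfl
      exact h' h''

theorem vertexEvents_eq_insert_of_gridAdj {x y : B.LiftedVertex} (h1 : x.1.1 = y.1.1) {k : Fin 3}
    (h2 : ∀ l, l ≠ k → x.1.2 l = y.1.2 l) (hlt : x.1.2 k < y.1.2 k)
    (h3 : ∀ r ∈ B.planes k, ¬ (x.1.2 k < r ∧ r < y.1.2 k)) :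
    ∃ e, e ∉ vertexEvents x ∧ vertexEvents y = insert e (vertexEvents x) := by
  have hpos : 0 < y.1.2 k := (nonneg_of_mem_planes (x.2.1 k)).trans_lt hlt
  refine ⟨.plane k ⟨y.1.2 k, y.2.1 k, hpos⟩, hlt.not_ge, ?_⟩
  ext (⟨l, t⟩ | i)
  · rw [Set.mem_insert_iff, plane_mem_vertexEvents, plane_mem_vertexEvents]
    by_cases hl : l = k
    · subst hl
      constructor
      · intro ht
        rcases ht.lt_or_eq with ht | ht
        · exact Or.inr (not_lt.1 fun h => h3 t.1 t.2.1 ⟨h, ht⟩)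
        · exact Or.inl (congrArg _ (Subtype.ext ht))
      · rintro (ht | ht)
        · obtain rfl := eq_of_heq (Event.plane.inj ht).2
          exact le_rfl
        · exact ht.trans hlt.le
    · rw [← h2 l hl]
      exact ⟨Or.inr, fun h => h.resolve_left fun h => hl (Event.plane.inj h).1⟩
  · rw [Set.mem_insert_iff, box_mem_vertexEvents, box_mem_vertexEvents, h1]
    exact ⟨Or.inr, fun h => h.resolve_left (by simp)⟩

theorem vertexEvents_eq_insert_of_lift {x y : B.LiftedVertex} (h1 : x.1.2 = y.1.2)
    (h2 : x.1.1 = none) (h3 : y.1.1 ≠ none) :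
    ∃ e, e ∉ vertexEvents x ∧ vertexEvents y = insert e (vertexEvents x) := by
  obtain ⟨i, hi⟩ := Option.ne_none_iff_exists'.1 h3
  refine ⟨.box i, ?_, ?_⟩
  · rw [box_mem_vertexEvents, h2]
    simp
  ext (⟨l, t⟩ | j)
  · rw [Set.mem_insert_iff, plane_mem_vertexEvents, plane_mem_vertexEvents, h1]
    exact ⟨Or.inr, fun h => h.resolve_left (by simp)⟩
  · rw [Set.mem_insert_iff, box_mem_vertexEvents, box_mem_vertexEvents, h2, hi]
    simp [eq_comm]

theorem liftedGraph_adj_of_insert {x y : B.LiftedVertex} {e : B.Event}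
    (he : e ∉ vertexEvents x) (h : vertexEvents y = insert e (vertexEvents x)) :
    B.liftedGraph.Adj x y := by
  have hmem : ∀ f, f ≠ e → (f ∈ vertexEvents x ↔ f ∈ vertexEvents y) := by
    intro f hf
    rw [h, Set.mem_insert_iff, or_iff_right hf]
  have hey : e ∈ vertexEvents y := h ▸ Set.mem_insert e _
  rw [liftedGraph_adj_iff]
  rcases e with ⟨k, t⟩ | i
  · have h1 : x.1.1 = y.1.1 := Option.ext fun i => hmem (.box i) (by simp)
    have htx : x.1.2 k < t.1 := not_le.1 he
    have hty : t.1 = y.1.2 k := by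
      refine le_antisymm hey (not_lt.1 fun hlt => ?_)
      have hpos := t.2.2.trans hlt
      have : Event.plane k ⟨y.1.2 k, y.2.1 k, hpos⟩ ∈ vertexEvents x :=
        (hmem _ fun h => hlt.ne (congrArg Subtype.val (eq_of_heq (Event.plane.inj h).2)).symm).2
          (le_refl (y.1.2 k))
      exact (htx.trans hlt).not_ge this
    refine Or.inl ⟨h1, k, fun l hl => ?_, (hty ▸ htx).ne, fun r hr => ⟨?_, ?_⟩⟩
    · exact eq_of_plane_mem_iff fun s => hmem _ fun h => hl (Event.plane.inj h).1
    · rintro ⟨h2, h3⟩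
      have hpos := (nonneg_of_mem_planes (x.2.1 k)).trans_lt h2
      have : Event.plane k ⟨r, hr, hpos⟩ ∈ vertexEvents x := by
        refine (hmem _ fun h => ?_).2 h3.le
        exact h3.ne ((congrArg Subtype.val (eq_of_heq (Event.plane.inj h).2)).trans hty)
      exact h2.not_ge this
    · rintro ⟨h2, h3⟩
      exact (h2.trans h3).not_gt (hty ▸ htx)
  · refine Or.inr (Or.inl ⟨funext fun k => eq_of_plane_mem_iff fun t => hmem _ (by simp), ?_, ?_⟩)
    · by_contra hx
      obtain ⟨j, hj⟩ := Option.ne_none_iff_exists'.1 hx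
      by_cases hji : j = i
      · subst hji
        exact he hj
      · have hjy := (hmem (.box j) (by simpa using hji)).1 hj
        have := (box_mem_vertexEvents.1 hjy).symm.trans (box_mem_vertexEvents.1 hey)
        exact hji (Option.some_injective _ this)
    · rw [box_mem_vertexEvents.1 hey]
      simp

variable (B) in
/-- The lifted graph is the covering graph of the domain of the event structure of gaps and
boxes. -/
noncomputable def liftedModel : DomainModel B.liftedGraph B.eventStructure where
  conf := Equiv.ofBijective (fun x => ⟨vertexEvents x, isConfiguration_vertexEvents x⟩)
    ⟨fun _ _ h => vertexEvents_injective (congrArg Subtype.val h), fun C =>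
      (exists_vertexEvents C.2).imp fun _ h => Subtype.ext h⟩
  adj_iff x y := by
    change _ ↔ ∃ e, vertexEvents x ∆ vertexEvents y = {e}
    rw [exists_symmDiff_eq_singleton_iff]
    constructor
    · intro h
      rcases liftedGraph_adj_iff.1 h with ⟨h1, k, h2, h3, h4⟩ | ⟨h1, h2, h3⟩ | ⟨h1, h2, h3⟩
      · rcases h3.lt_or_gt with hlt | hlt
        · exact Or.inl (vertexEvents_eq_insert_of_gridAdj h1 h2 hlt fun r hr => (h4 r hr).1)
        · exact Or.inr (vertexEvents_eq_insert_of_gridAdj h1.symm (fun l hl => (h2 l hl).symm) hlt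
            fun r hr => (h4 r hr).2)
      · exact Or.inl (vertexEvents_eq_insert_of_lift h1 h2 h3)
      · exact Or.inr (vertexEvents_eq_insert_of_lift h1.symm h3 h2)
    · rintro (⟨e, he, h⟩ | ⟨e, he, h⟩)
      · exact liftedGraph_adj_of_insert he h
      · exact (liftedGraph_adj_of_insert he h).symm

variable (B) in
theorem liftedModel_ev_originVertex : B.liftedModel.ev B.originVertex = ∅ := by
  rw [Set.eq_empty_iff_forall_notMem]
  rintro (⟨k, t⟩ | i) h
  · exact t.2.2.not_ge h
  · exact nomatch (box_mem_vertexEvents.1 h)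

variable (B) in
theorem liftedModel_ev_cornerVertex : B.liftedModel.ev B.cornerVertex = B.spine := by
  ext (⟨k, t⟩ | i)
  · exact iff_of_true (le_corner_of_mem_planes t.2.1) ⟨k, t, rfl⟩
  · refine iff_of_false (fun h => nomatch (box_mem_vertexEvents.1 h)) ?_
    rintro ⟨k, t, h⟩
    exact nomatch h

/-! ### Two-connectedness of the lifted graph -/

theorem exists_gridPoint_adj (p : Fin 3 → ℝ) (hp : p ∈ B.gridPoints) {k : Fin 3} {a b : ℝ}
    (ha : a ∈ B.planes k) (hb : b ∈ B.planes k) (hab : a < b) (hap : a ≤ p k) (hpb : p k ≤ b) :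
    ∃ q ∈ B.gridPoints, (∀ l, l ≠ k → p l = q l) ∧ p k ≠ q k ∧ a ≤ q k ∧ q k ≤ b ∧
      ∀ r ∈ B.planes k, ¬ (p k < r ∧ r < q k) ∧ ¬ (q k < r ∧ r < p k) := by
  obtain ⟨u, hu, hau, hub, hne, hmid⟩ := exists_neighbor_plane ha hb hab hap hpb
  refine ⟨Function.update p k u, fun l => ?_, fun l hl => ?_, ?_, ?_, ?_, ?_⟩
  · by_cases hl : l = k
    · subst hl
      rwa [Function.update_self]
    · rw [Function.update_of_ne hl]
      exact hp l
  · rw [Function.update_of_ne hl]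
  all_goals rwa [Function.update_self]

/-- Two grid neighbors in different directions of a vertex lie on a common 4-cycle with it. -/
theorem reachable_of_gridAdj_of_ne {x y z : B.LiftedVertex}
    (hy : y.1.1 = none) (hz : z.1.1 = none) {k l : Fin 3} (hkl : k ≠ l)
    (hy1 : ∀ m, m ≠ k → x.1.2 m = y.1.2 m) (hy2 : x.1.2 k ≠ y.1.2 k)
    (hy3 : ∀ r ∈ B.planes k, ¬ (x.1.2 k < r ∧ r < y.1.2 k) ∧ ¬ (y.1.2 k < r ∧ r < x.1.2 k))
    (hz1 : ∀ m, m ≠ l → x.1.2 m = z.1.2 m) (hz2 : x.1.2 l ≠ z.1.2 l)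
    (hz3 : ∀ r ∈ B.planes l, ¬ (x.1.2 l < r ∧ r < z.1.2 l) ∧ ¬ (z.1.2 l < r ∧ r < x.1.2 l))
    (hyx : y ≠ x) (hzx : z ≠ x) :
    (B.liftedGraph.induce {x}ᶜ).Reachable ⟨y, hyx⟩ ⟨z, hzx⟩ := by
  let q : Fin 3 → ℝ := Function.update z.1.2 k (y.1.2 k)
  have hqk : q k = y.1.2 k := Function.update_self ..
  have hq : ∀ m, m ≠ k → q m = z.1.2 m := fun m hm => Function.update_of_ne hm ..
  let w : B.LiftedVertex := ⟨(none, q), fun m => by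
    by_cases hm : m = k
    · subst hm
      exact Set.mem_of_eq_of_mem hqk (y.2.1 m)
    · exact Set.mem_of_eq_of_mem (hq m hm) (z.2.1 m), fun _ h => nomatch h⟩
  have hw : w ≠ x := fun h => hy2 (by rw [← hqk, ← h])
  refine reachable_induce_compl hyx hw hzx (liftedGraph_adj_iff.2 (Or.inl ⟨hy, l, ?_, ?_, ?_⟩))
    (liftedGraph_adj_iff.2 (Or.inl ⟨hz.symm, k, hq, ?_, ?_⟩))
  · intro m hm
    by_cases hmk : m = k
    · subst hmk
      exact hqk.symm
    · exact ((hy1 m hmk).symm.trans (hz1 m hm)).trans (hq m hmk).symm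
  · change y.1.2 l ≠ q l
    rwa [← hy1 l hkl.symm, hq l hkl.symm]
  · change ∀ r ∈ B.planes l, ¬ (y.1.2 l < r ∧ r < q l) ∧ ¬ (q l < r ∧ r < y.1.2 l)
    rwa [← hy1 l hkl.symm, hq l hkl.symm]
  · change q k ≠ z.1.2 k
    rw [hqk, ← hz1 k hkl]
    exact hy2.symm
  · change ∀ r ∈ B.planes k, ¬ (q k < r ∧ r < z.1.2 k) ∧ ¬ (z.1.2 k < r ∧ r < q k)
    rw [hqk, ← hz1 k hkl]
    exact fun r hr => (hy3 r hr).symm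

theorem not_isArticulation_of_lifted {x : B.LiftedVertex} {i : Fin B.size} (hx : x.1.1 = some i) :
    ¬ B.liftedGraph.IsArticulation x := by
  let c : B.LiftedVertex := ⟨(none, x.1.2), x.2.1, fun _ h => nomatch h⟩
  have hc : c ≠ x := by
    intro h
    rw [← h] at hx
    exact nomatch hx
  refine not_isArticulation_of_link B.liftedModel.connected.preconnected ?_
  suffices h : ∀ y (hy : B.liftedGraph.Adj x y),
      (B.liftedGraph.induce {x}ᶜ).Reachable ⟨y, hy.ne'⟩ ⟨c, hc⟩ from
    fun y z hy hz => (h y hy).trans (h z hz).symm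
  intro y hy
  rcases liftedGraph_adj_iff.1 hy with ⟨h1, h2⟩ | ⟨-, h2, -⟩ | ⟨h1, h2, h3⟩
  · let w : B.LiftedVertex := ⟨(none, y.1.2), y.2.1, fun _ h => nomatch h⟩
    have hw : w ≠ x := by
      intro h
      rw [← h] at hx
      exact nomatch hx
    refine reachable_induce_compl hy.ne' hw hc (liftedGraph_adj_iff.2 (Or.inr (Or.inr ?_)))
      (liftedGraph_adj_iff.2 (Or.inl ⟨rfl, gridAdj_symm h2⟩))
    refine ⟨rfl, ?_, rfl⟩
    rw [← h1, hx]
    simp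
  · exact absurd h2 (by simp [hx])
  · have : y = c := Subtype.ext (Prod.ext h3 h1.symm)
    subst this
    rfl

theorem not_isArticulation_of_grid {x : B.LiftedVertex} (hx : x.1.1 = none) :
    ¬ B.liftedGraph.IsArticulation x := by
  have hneighbor : ∀ k, ∃ q ∈ B.gridPoints, (∀ l, l ≠ k → x.1.2 l = q l) ∧ x.1.2 k ≠ q k ∧
      ∀ r ∈ B.planes k, ¬ (x.1.2 k < r ∧ r < q k) ∧ ¬ (q k < r ∧ r < x.1.2 k) := by
    intro k
    obtain ⟨q, hq, h1, h2, -, -, h3⟩ := exists_gridPoint_adj x.1.2 x.2.1 (B.zero_mem_planes k)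
      (B.corner_mem_planes k) (B.corner_pos k) (nonneg_of_mem_planes (x.2.1 k))
      (le_corner_of_mem_planes (x.2.1 k))
    exact ⟨q, hq, h1, h2, h3⟩
  choose q hq hq1 hq2 hq3 using hneighbor
  let c : Fin 3 → B.LiftedVertex := fun k => ⟨(none, q k), hq k, fun _ h => nomatch h⟩
  have hc : ∀ k, c k ≠ x := fun k h => hq2 k (by rw [← h])
  -- a neighbor in the direction of the axis `k` reaches `c 0` directly or through `c 1`
  have hgrid : ∀ y (hy : y ≠ x) k, y.1.1 = none → (∀ m, m ≠ k → x.1.2 m = y.1.2 m) →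
      x.1.2 k ≠ y.1.2 k →
      (∀ r ∈ B.planes k, ¬ (x.1.2 k < r ∧ r < y.1.2 k) ∧ ¬ (y.1.2 k < r ∧ r < x.1.2 k)) →
      (B.liftedGraph.induce {x}ᶜ).Reachable ⟨y, hy⟩ ⟨c 0, hc 0⟩ := by
    intro y hy k h0 h1 h2 h3
    have hstep : ∀ l, k ≠ l → (B.liftedGraph.induce {x}ᶜ).Reachable ⟨y, hy⟩ ⟨c l, hc l⟩ :=
      fun l hl => reachable_of_gridAdj_of_ne h0 rfl hl h1 h2 h3 (hq1 l) (hq2 l) (hq3 l) hy (hc l)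
    by_cases hk : k = 0
    · refine (hstep 1 (by rw [hk]; decide)).trans ?_
      exact reachable_of_gridAdj_of_ne rfl rfl (by decide) (hq1 1) (hq2 1) (hq3 1) (hq1 0)
        (hq2 0) (hq3 0) _ _
    · exact hstep 0 hk
  refine not_isArticulation_of_link B.liftedModel.connected.preconnected ?_
  suffices h : ∀ y (hy : B.liftedGraph.Adj x y),
      (B.liftedGraph.induce {x}ᶜ).Reachable ⟨y, hy.ne'⟩ ⟨c 0, hc 0⟩ from
    fun y z hy hz => (h y hy).trans (h z hz).symm
  intro y hy
  rcases liftedGraph_adj_iff.1 hy with ⟨h1, k, h2, h3, h4⟩ | ⟨h1, -, h3⟩ | ⟨-, h2, -⟩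
  · exact hgrid y hy.ne' k (h1 ▸ hx) h2 h3 h4
  · -- the box is nondegenerate, so it contains a neighboring grid point, which is lifted as well
    obtain ⟨i, hi⟩ := Option.ne_none_iff_exists'.1 h3
    have hbox := y.2.2 i hi
    rw [← h1] at hbox
    obtain ⟨r, hr, hr1, hr2, hr3, hr4, hr5⟩ := exists_gridPoint_adj x.1.2 x.2.1
      (B.lo_mem_planes i 0) (B.hi_mem_planes i 0) (B.lo_lt_hi i 0) (hbox.1 0) (hbox.2 0)
    have hrbox : r ∈ B.box i := by
      refine ⟨fun l => ?_, fun l => ?_⟩ <;> by_cases hl : l = 0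
      · rwa [hl]
      · exact (hr1 l hl) ▸ hbox.1 l
      · rwa [hl]
      · exact (hr1 l hl) ▸ hbox.2 l
    let w : B.LiftedVertex :=
      ⟨(some i, r), hr, fun j hj => Option.some_injective _ hj ▸ hrbox⟩
    let z : B.LiftedVertex := ⟨(none, r), hr, fun _ h => nomatch h⟩
    have hw : w ≠ x := fun h => hr2 (by rw [← h])
    have hz : z ≠ x := fun h => hr2 (by rw [← h])
    refine (reachable_induce_compl hy.ne' hw hz (liftedGraph_adj_iff.2 (Or.inl ⟨hi, 0, ?_⟩))
      (liftedGraph_adj_iff.2 (Or.inr (Or.inr ⟨rfl, Option.some_ne_none i, rfl⟩)))).trans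
      (hgrid z hz 0 rfl hr1 hr2 hr5)
    rw [← h1]
    exact ⟨hr1, hr2, hr5⟩
  · exact absurd hx h2

variable (B) in
theorem not_isArticulation_liftedGraph (x : B.LiftedVertex) :
    ¬ B.liftedGraph.IsArticulation x := by
  rcases hx : x.1.1 with - | i
  exacts [not_isArticulation_of_grid hx, not_isArticulation_of_lifted hx]

variable (B) in
theorem isTwoConnected_liftedGraph : B.liftedGraph.IsTwoConnected := by
  refine ⟨?_, B.liftedModel.connected, B.not_isArticulation_liftedGraph⟩
  let f : Fin 3 → B.LiftedVertex := fun j => ⟨(none, Function.update 0 j (B.corner j)), fun k => by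
    by_cases hk : k = j
    · subst hk
      exact Set.mem_of_eq_of_mem (Function.update_self ..) (B.corner_mem_planes k)
    · exact Set.mem_of_eq_of_mem (Function.update_of_ne hk ..) (B.zero_mem_planes k),
    fun _ h => nomatch h⟩
  have hf : Function.Injective f := by
    intro j k h
    by_contra hjk
    have h' : Function.update (0 : Fin 3 → ℝ) j (B.corner j) j =
        Function.update (0 : Fin 3 → ℝ) k (B.corner k) j :=
      congrFun (congrArg (fun x : B.LiftedVertex => x.1.2) h) j
    rw [Function.update_self, Function.update_of_ne hjk] at h'
    exact (B.corner_pos j).ne' h'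
  have := ENat.card_le_card_of_injective hf
  rwa [ENat.card_eq_coe_fintype_card, Fintype.card_fin] at this

/-! ### Independent events -/

theorem inter_box_nonempty_iff {i j : Fin B.size} :
    (B.box i ∩ B.box j).Nonempty ↔ ∀ k, B.lo i k ≤ B.hi j k ∧ B.lo j k ≤ B.hi i k := by
  rw [box, box, Set.Icc_inter_Icc, Set.nonempty_Icc, sup_le_iff, le_inf_iff, le_inf_iff]
  constructor
  · exact fun h k => ⟨h.1.2 k, h.2.1 k⟩
  · exact fun h => ⟨⟨fun k => (B.lo_lt_hi i k).le, fun k => (h k).1⟩,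
      ⟨fun k => (h k).2, fun k => (B.lo_lt_hi j k).le⟩⟩

theorem intersectionGraph_adj_iff {i j : Fin B.size} :
    B.intersectionGraph.Adj i j ↔ i ≠ j ∧ (B.box i ∩ B.box j).Nonempty := by
  rw [intersectionGraph, SimpleGraph.fromRel_adj, Set.inter_comm (B.box j), or_self]

/-- Boxes are always in conflict; the conflict is minimal exactly if no plane separates them,
that is, if they intersect. -/
theorem independent_box_iff {i j : Fin B.size} :
    B.eventStructure.Independent (.box i) (.box j) ↔ B.intersectionGraph.Adj i j := by
  rw [intersectionGraph_adj_iff, inter_box_nonempty_iff]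
  constructor
  · intro h
    have hij : i ≠ j := fun hij => h.ne (congrArg _ hij)
    refine ⟨hij, fun k => ⟨?_, ?_⟩⟩
    · by_contra! hlt
      let g : B.Event := .plane k ⟨B.lo i k, B.lo_mem_planes i k, B.lo_pos i k⟩
      exact h.not_conflict_of_lt (g := g) (le_refl (B.lo i k)) (by simp [g]) hlt
    · by_contra! hlt
      let g : B.Event := .plane k ⟨B.lo j k, B.lo_mem_planes j k, B.lo_pos j k⟩
      exact h.symm.not_conflict_of_lt (g := g) (le_refl (B.lo j k)) (by simp [g]) hlt
  · rintro ⟨hij, h⟩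
    refine Or.inr ⟨hij, ?_⟩
    rintro ⟨⟨k, t⟩ | l, hi, hj, ⟨h1, h2⟩ | ⟨h1, h2⟩⟩
    · exact ((lt_of_lt_of_le h2 h1).trans_le (h k).1).false
    · exact ((lt_of_lt_of_le h2 h1).trans_le (h k).2).false
    · exact hi (congrArg _ h1)
    · exact hj (congrArg _ h1)

theorem degree_eventStructure_le : B.eventStructure.degree ≤ 3 + B.intersectionGraph.cliqueNum := by
  classical
  refine EventStructure.degree_le_of_forall fun A hA => ?_
  have hsplit : A = (A ∩ B.spine) ∪ Event.box '' {i | Event.box i ∈ A} := by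
    ext (⟨k, t⟩ | i)
    · constructor
      · exact fun h => Or.inl ⟨h, k, t, rfl⟩
      · rintro (h | ⟨i, hi, h⟩)
        exacts [h.1, nomatch h]
    · constructor
      · exact fun h => Or.inr ⟨i, h, rfl⟩
      · rintro (h | ⟨j, hj, h⟩)
        exacts [h.1, h ▸ hj]
  have hplanes : (A ∩ B.spine).encard ≤ 3 := by
    let axis : B.Event → Fin 3 := fun e => match e with
      | .plane k _ => k
      | .box _ => 0
    have hinj : Set.InjOn axis (A ∩ B.spine) := by
      rintro _ ⟨he, k, s, rfl⟩ _ ⟨hf, l, t, rfl⟩ hkl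
      obtain rfl : k = l := hkl
      by_contra hne
      have hind := hA he hf hne
      rcases le_total s.1 t.1 with h | h
      · exact hind.not_le ⟨rfl, h⟩
      · exact hind.symm.not_le ⟨rfl, h⟩
    rw [← hinj.encard_image]
    exact (Set.encard_le_encard (Set.subset_univ _)).trans (by simp)
  have hboxes : (Event.box '' {i | Event.box i ∈ A}).encard ≤ B.intersectionGraph.cliqueNum := by
    have hbox : Function.Injective (Event.box (B := B)) := fun i j h => by simpa using h
    rw [hbox.encard_image]
    have hcl : B.intersectionGraph.IsClique
        ((Finset.univ.filter fun i => Event.box i ∈ A : Finset (Fin B.size)) :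
          Set (Fin B.size)) := by
      intro i hi j hj hij
      simp only [Finset.coe_filter, Finset.mem_univ, true_and] at hi hj
      exact independent_box_iff.1 (hA hi hj fun h => hij (hbox h))
    have hcoe : {i | Event.box i ∈ A} =
        ((Finset.univ.filter fun i => Event.box i ∈ A : Finset (Fin B.size)) :
          Set (Fin B.size)) := by simp
    rw [hcoe, Set.encard_coe_eq_coe_finsetCard]
    exact_mod_cast hcl.card_le_cliqueNum
  rw [hsplit]
  exact (Set.encard_union_le _ _).trans (add_le_add hplanes hboxes)

/-- The three gaps that follow the lower corner of the intersection of two boxes are pairwise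
independent, and independent of both boxes. -/
theorem five_le_degree_eventStructure (hB : ∀ i k, B.hi i k < B.corner k) {i j : Fin B.size}
    (hij : B.intersectionGraph.Adj i j) : 5 ≤ B.eventStructure.degree := by
  obtain ⟨hne, hint⟩ := intersectionGraph_adj_iff.1 hij
  rw [inter_box_nonempty_iff] at hint
  have hnext : ∀ k, ∃ u ∈ B.planes k, max (B.lo i k) (B.lo j k) < u ∧
      ∀ r ∈ B.planes k, max (B.lo i k) (B.lo j k) < r → u ≤ r := by
    intro k
    obtain ⟨u, hu, h1, -, h2⟩ := exists_next_plane (B.corner_mem_planes k)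
      (s := max (B.lo i k) (B.lo j k))
      (max_lt ((B.lo_lt_hi i k).trans (hB i k)) ((B.lo_lt_hi j k).trans (hB j k)))
    exact ⟨u, hu, h1, h2⟩
  choose u hu hlt hmin using hnext
  have hpos : ∀ k, 0 < u k := fun k =>
    (B.lo_pos i k).trans ((le_max_left _ _).trans_lt (hlt k))
  let g : Fin 3 → B.Event := fun k => .plane k ⟨u k, hu k, hpos k⟩
  have hgg : ∀ k l, k ≠ l → B.eventStructure.Independent (g k) (g l) := fun k l hkl =>
    Or.inl ⟨fun h => hkl h.1, fun h => hkl h.1.symm, id⟩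
  have hgb : ∀ k b, b = i ∨ b = j → B.eventStructure.Independent (g k) (.box b) := by
    intro k b hb
    have hlo : B.lo b k < u k := by
      rcases hb with rfl | rfl
      exacts [(le_max_left _ _).trans_lt (hlt k), (le_max_right _ _).trans_lt (hlt k)]
    have hhi : max (B.lo i k) (B.lo j k) ≤ B.hi b k := by
      rcases hb with rfl | rfl
      exacts [max_le (B.lo_lt_hi _ k).le (hint k).2, max_le (hint k).1 (B.lo_lt_hi _ k).le]
    by_cases hc : B.hi b k < u k
    · refine Or.inr ⟨hc, ?_⟩
      rintro ⟨⟨l, t⟩ | b', h1, h2, ⟨h3, h4⟩ | ⟨h3, h4⟩⟩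
      · obtain ⟨rfl, h3⟩ := h3
        have := hmin l t.1 t.2.1 (hhi.trans_lt h4)
        exact h1 (congrArg _ (Subtype.ext (le_antisymm h3 this)))
      · exact h4
      · exact h3
      · exact h2 (congrArg _ h3)
    · exact Or.inl ⟨hlo.not_ge, id, hc⟩
  let f : Fin 3 ⊕ Bool → B.Event := Sum.elim g fun c => .box (if c then i else j)
  have hind : ∀ a b, a ≠ b → B.eventStructure.Independent (f a) (f b) := by
    have hor : ∀ c : Bool, (if c then i else j) = i ∨ (if c then i else j) = j := by
      intro c
      cases c
      exacts [Or.inr rfl, Or.inl rfl]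
    rintro (k | c) (l | d) hab
    · exact hgg k l fun h => hab (h ▸ rfl)
    · exact hgb k _ (hor d)
    · exact (hgb l _ (hor c)).symm
    · cases c <;> cases d
      · exact absurd rfl hab
      · exact independent_box_iff.2 hij.symm
      · exact independent_box_iff.2 hij
      · exact absurd rfl hab
  have hf : Function.Injective f := by
    intro a b h
    by_contra hab
    exact (hind a b hab).ne h
  refine le_iSup_of_le (f := fun A : {A : Set B.Event // A.Pairwise B.eventStructure.Independent} =>
      (A : Set B.Event).encard) ⟨Set.range f, ?_⟩ ?_
  · rintro _ ⟨a, rfl⟩ _ ⟨b, rfl⟩ hab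
    exact hind a b fun h => hab (h ▸ rfl)
  · change 5 ≤ (Set.range f).encard
    rw [← Set.image_univ, hf.encard_image, Set.encard_univ, ENat.card_eq_coe_fintype_card]
    simp

theorem degree_eventStructure (hB : ∀ i k, B.hi i k < B.corner k)
    (h2 : B.intersectionGraph.cliqueNum = 2) {i j : Fin B.size}
    (hij : B.intersectionGraph.Adj i j) : B.eventStructure.degree = 5 := by
  refine le_antisymm ?_ (five_le_degree_eventStructure hB hij)
  refine degree_eventStructure_le.trans ?_
  rw [h2]
  norm_num

end BoxHypergraph

/-! ### Burling's families of boxes -/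

/-- The affine map sending `0` to `a` and `1` to `b`. -/
def affine (a b t : ℝ) : ℝ := a + (b - a) * t

section affine

variable {a b s t : ℝ}

theorem affine_le_affine_iff (h : a < b) : affine a b s ≤ affine a b t ↔ s ≤ t := by
  rw [affine, affine, add_le_add_iff_left, mul_le_mul_iff_right₀ (sub_pos.2 h)]

theorem affine_lt_affine_iff (h : a < b) : affine a b s < affine a b t ↔ s < t := by
  rw [← not_le, affine_le_affine_iff h, not_le]

theorem affine_zero : affine a b 0 = a := by simp [affine]

theorem affine_one : affine a b 1 = b := by simp [affine]

theorem le_affine (h : a < b) (ht : 0 ≤ t) : a ≤ affine a b t := by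
  rw [← affine_le_affine_iff h, affine_zero] at ht
  exact ht

theorem affine_le (h : a < b) (ht : t ≤ 1) : affine a b t ≤ b := by
  rw [← affine_le_affine_iff h, affine_one] at ht
  exact ht

end affine

/-- The box `[x₀, x₁] × [y₀, y₁] × [z₀, z₁]`. -/
structure Box3 where
  (x₀ x₁ y₀ y₁ z₀ z₁ : ℝ)

/-- The two boxes intersect. -/
def Box3.Meet (a b : Box3) : Prop :=
  (a.x₀ ≤ b.x₁ ∧ b.x₀ ≤ a.x₁) ∧ (a.y₀ ≤ b.y₁ ∧ b.y₀ ≤ a.y₁) ∧ (a.z₀ ≤ b.z₁ ∧ b.z₀ ≤ a.z₁)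

theorem Box3.Meet.symm {a b : Box3} (h : a.Meet b) : b.Meet a :=
  ⟨h.1.symm, h.2.1.symm, h.2.2.symm⟩

/-- A triangle-free finite family of nondegenerate boxes in the unit cube, with finitely many
probes. A probe `p` is a rectangle `[left p, right p] × [bot p, top p]` in the horizontal plane.
It sees exactly the boxes that meet the vertical slab above `[left p, ∞) × [bot p, top p]`; these
boxes are required to lie over the whole rectangle, and to be pairwise disjoint. Distinct probes
have disjoint ranges `[bot p, top p]`. -/
structure BurlingFamily where
  ι : Type
  π : Type
  finite_ι : Finite ι
  finite_π : Finite π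
  box : ι → Box3
  (left right bot top : π → ℝ)
  sees : π → ι → Prop
  box_x : ∀ i, 0 ≤ (box i).x₀ ∧ (box i).x₀ < (box i).x₁ ∧ (box i).x₁ ≤ 1
  box_y : ∀ i, 0 ≤ (box i).y₀ ∧ (box i).y₀ < (box i).y₁ ∧ (box i).y₁ ≤ 1
  box_z : ∀ i, 0 ≤ (box i).z₀ ∧ (box i).z₀ < (box i).z₁ ∧ (box i).z₁ ≤ 1
  probe_x : ∀ p, 0 ≤ left p ∧ left p < right p ∧ right p ≤ 1
  probe_y : ∀ p, 0 ≤ bot p ∧ bot p < top p ∧ top p ≤ 1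
  disjoint : ∀ p q, bot p ≤ top q → bot q ≤ top p → p = q
  covers_x : ∀ p i, sees p i → (box i).x₀ ≤ left p ∧ right p ≤ (box i).x₁
  covers_y : ∀ p i, sees p i → (box i).y₀ ≤ bot p ∧ top p ≤ (box i).y₁
  sees_of_meet : ∀ p i, left p ≤ (box i).x₁ → bot p ≤ (box i).y₁ → (box i).y₀ ≤ top p → sees p i
  independent : ∀ p i j, sees p i → sees p j → (box i).Meet (box j) → i = j
  triangle_free : ∀ i j l, (box i).Meet (box j) → (box j).Meet (box l) → (box i).Meet (box l) →
    i = j ∨ j = l ∨ i = l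

namespace BurlingFamily

/-- In every proper coloring of the family, some probe sees at least `n` colors. -/
def HasColors (F : BurlingFamily) (n : ℕ) : Prop :=
  ∀ c : F.ι → ℕ, (∀ i j, i ≠ j → (F.box i).Meet (F.box j) → c i ≠ c j) →
    ∃ p, n ≤ (c '' {i | F.sees p i}).ncard

/-- The family without boxes, with one probe. -/
def empty : BurlingFamily where
  ι := Empty
  π := Unit
  finite_ι := inferInstance
  finite_π := inferInstance
  box := Empty.elim
  left _ := 0
  right _ := 1
  bot _ := 0
  top _ := 1
  sees _ _ := False
  box_x i := i.elim
  box_y i := i.elim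
  box_z i := i.elim
  probe_x _ := by norm_num
  probe_y _ := by norm_num
  disjoint _ _ _ _ := rfl
  covers_x _ i := i.elim
  covers_y _ i := i.elim
  sees_of_meet _ i := i.elim
  independent _ i := i.elim
  triangle_free i := i.elim

variable (F : BurlingFamily)

/-- The `x`-coordinate of a copy of the family placed over the left half of the probe `p`. -/
noncomputable def toX (p : F.π) (x : ℝ) : ℝ := affine (F.left p) ((F.left p + F.right p) / 2) x

/-- The `y`-coordinate of a copy of the family placed over the probe `p`. -/
noncomputable def toY (p : F.π) (y : ℝ) : ℝ := affine (F.bot p) (F.top p) y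

/-- The end of the lower third of the range of a probe. -/
noncomputable def lowerThird (q : F.π) : ℝ := affine (F.bot q) (F.top q) (1 / 3)

/-- The beginning of the upper third of the range of a probe. -/
noncomputable def upperThird (q : F.π) : ℝ := affine (F.bot q) (F.top q) (2 / 3)

/-- The boxes of the next family: the family itself, moved upwards; for each probe `p` a copy of
the family below it, over the left half of `p`; for each probe `q` of that copy a box over the
lower third of the range of `q`, extending to the right end of `p` (a long box). -/
noncomputable def stepBox : F.ι ⊕ (F.π × F.ι) ⊕ (F.π × F.π) → Box3
  | .inl i =>
    { x₀ := (F.box i).x₀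
      x₁ := (F.box i).x₁
      y₀ := (F.box i).y₀
      y₁ := (F.box i).y₁
      z₀ := affine (2 / 3) 1 (F.box i).z₀
      z₁ := affine (2 / 3) 1 (F.box i).z₁ }
  | .inr (.inl (p, i)) =>
    { x₀ := F.toX p (F.box i).x₀
      x₁ := F.toX p (F.box i).x₁
      y₀ := F.toY p (F.box i).y₀
      y₁ := F.toY p (F.box i).y₁
      z₀ := affine 0 (1 / 3) (F.box i).z₀
      z₁ := affine 0 (1 / 3) (F.box i).z₁ }
  | .inr (.inr (p, q)) =>
    { x₀ := F.toX p (F.left q)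
      x₁ := F.right p
      y₀ := F.toY p (F.bot q)
      y₁ := F.toY p (F.lowerThird q)
      z₀ := 0
      z₁ := 1 / 3 }

/-- For each probe `p` and each probe `q` of the copy below `p`, the first probe (`false`) is the
upper third of `q`, and the second one (`true`) is the lower third of the range of `q`,
in the right quarter of `p`. -/
def stepSees : (F.π × F.π) × Bool → F.ι ⊕ (F.π × F.ι) ⊕ (F.π × F.π) → Prop
  | ((p, _), _), .inl i => F.sees p i
  | ((p, q), b), .inr (.inl (p', i)) => b = false ∧ p' = p ∧ F.sees q i
  | ((p, q), b), .inr (.inr (p', q')) => b = true ∧ p' = p ∧ q' = q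

/-- The left ends of the new probes. -/
noncomputable def stepLeft : (F.π × F.π) × Bool → ℝ
  | ((p, q), false) => F.toX p (F.left q)
  | ((p, _), true) => affine (F.left p) (F.right p) (3 / 4)

/-- The right ends of the new probes. -/
noncomputable def stepRight : (F.π × F.π) × Bool → ℝ
  | ((p, q), false) => F.toX p (F.right q)
  | ((p, _), true) => F.right p

/-- The lower ends of the ranges of the new probes. -/
noncomputable def stepBot : (F.π × F.π) × Bool → ℝ
  | ((p, q), false) => F.toY p (F.upperThird q)
  | ((p, q), true) => F.toY p (F.bot q)

/-- The upper ends of the ranges of the new probes. -/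
noncomputable def stepTop : (F.π × F.π) × Bool → ℝ
  | ((p, q), false) => F.toY p (F.top q)
  | ((p, q), true) => F.toY p (F.lowerThird q)

variable {F}

theorem left_lt_mid (p : F.π) : F.left p < (F.left p + F.right p) / 2 := by
  linarith [(F.probe_x p).2.1]

theorem toX_le_toX_iff {p : F.π} {s t : ℝ} : F.toX p s ≤ F.toX p t ↔ s ≤ t :=
  affine_le_affine_iff (left_lt_mid p)

theorem toX_lt_toX_iff {p : F.π} {s t : ℝ} : F.toX p s < F.toX p t ↔ s < t :=
  affine_lt_affine_iff (left_lt_mid p)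

theorem toY_le_toY_iff {p : F.π} {s t : ℝ} : F.toY p s ≤ F.toY p t ↔ s ≤ t :=
  affine_le_affine_iff (F.probe_y p).2.1

theorem toY_lt_toY_iff {p : F.π} {s t : ℝ} : F.toY p s < F.toY p t ↔ s < t :=
  affine_lt_affine_iff (F.probe_y p).2.1

theorem left_le_toX {p : F.π} {t : ℝ} (ht : 0 ≤ t) : F.left p ≤ F.toX p t :=
  le_affine (left_lt_mid p) ht

theorem toX_le_mid {p : F.π} {t : ℝ} (ht : t ≤ 1) : F.toX p t ≤ (F.left p + F.right p) / 2 :=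
  affine_le (left_lt_mid p) ht

theorem toX_lt_right {p : F.π} {t : ℝ} (ht : t ≤ 1) : F.toX p t < F.right p := by
  linarith [toX_le_mid (p := p) ht, (F.probe_x p).2.1]

theorem toX_lt_stepLeft {p q : F.π} {t : ℝ} (ht : t ≤ 1) :
    F.toX p t < F.stepLeft ((p, q), true) := by
  have := toX_le_mid (p := p) ht
  have := (F.probe_x p).2.1
  simp only [stepLeft, affine]
  linarith

theorem bot_le_toY {p : F.π} {t : ℝ} (ht : 0 ≤ t) : F.bot p ≤ F.toY p t :=
  le_affine (F.probe_y p).2.1 ht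

theorem toY_le_top {p : F.π} {t : ℝ} (ht : t ≤ 1) : F.toY p t ≤ F.top p :=
  affine_le (F.probe_y p).2.1 ht

theorem bot_lt_lowerThird (q : F.π) : F.bot q < F.lowerThird q := by
  simp only [lowerThird, affine]
  linarith [(F.probe_y q).2.1]

theorem lowerThird_lt_upperThird (q : F.π) : F.lowerThird q < F.upperThird q := by
  simp only [lowerThird, upperThird, affine]
  linarith [(F.probe_y q).2.1]

theorem upperThird_lt_top (q : F.π) : F.upperThird q < F.top q := by
  simp only [upperThird, affine]
  linarith [(F.probe_y q).2.1]

/-- Subranges of the ranges of two probes only overlap if the probes are equal. -/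
theorem eq_of_toY_le {p p' : F.π} {s s' t t' : ℝ} (hs : 0 ≤ s) (ht : t ≤ 1) (hs' : 0 ≤ s')
    (ht' : t' ≤ 1) (h : F.toY p s ≤ F.toY p' t') (h' : F.toY p' s' ≤ F.toY p t) : p = p' :=
  F.disjoint p p' ((bot_le_toY hs).trans (h.trans (toY_le_top ht')))
    ((bot_le_toY hs').trans (h'.trans (toY_le_top ht)))

theorem meet_inl_iff {i j : F.ι} :
    (F.stepBox (.inl i)).Meet (F.stepBox (.inl j)) ↔ (F.box i).Meet (F.box j) := by
  simp only [Box3.Meet, stepBox, affine_le_affine_iff (show (2 / 3 : ℝ) < 1 by norm_num)]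

theorem not_meet_inl_inr {i : F.ι} {a : (F.π × F.ι) ⊕ (F.π × F.π)} :
    ¬ (F.stepBox (.inl i)).Meet (F.stepBox (.inr a)) := by
  rintro ⟨-, -, h, -⟩
  have h1 : (2 / 3 : ℝ) ≤ (F.stepBox (.inl i)).z₀ := le_affine (by norm_num) (F.box_z i).1
  have h2 : (F.stepBox (.inr a)).z₁ ≤ 1 / 3 := by
    rcases a with ⟨p, j⟩ | ⟨p, q⟩
    · exact affine_le (by norm_num) (F.box_z j).2.2
    · exact le_rfl
  linarith

theorem meet_copy_iff {p p' : F.π} {i j : F.ι} :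
    (F.stepBox (.inr (.inl (p, i)))).Meet (F.stepBox (.inr (.inl (p', j)))) ↔
      p = p' ∧ (F.box i).Meet (F.box j) := by
  constructor
  · intro h
    obtain rfl : p = p' := eq_of_toY_le (F.box_y i).1 (F.box_y i).2.2 (F.box_y j).1
      (F.box_y j).2.2 h.2.1.1 h.2.1.2
    simp only [Box3.Meet, stepBox, affine_le_affine_iff (show (0 : ℝ) < 1 / 3 by norm_num),
      toX_le_toX_iff, toY_le_toY_iff] at h
    exact ⟨rfl, h⟩
  · rintro ⟨rfl, h⟩
    simp only [Box3.Meet, stepBox, affine_le_affine_iff (show (0 : ℝ) < 1 / 3 by norm_num),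
      toX_le_toX_iff, toY_le_toY_iff]
    exact h

theorem lowerThird_le_one (q : F.π) : F.lowerThird q ≤ 1 :=
  ((lowerThird_lt_upperThird q).trans (upperThird_lt_top q)).le.trans (F.probe_y q).2.2

theorem meet_copy_long_iff {p p' q : F.π} {i : F.ι} :
    (F.stepBox (.inr (.inl (p, i)))).Meet (F.stepBox (.inr (.inr (p', q)))) ↔
      p = p' ∧ F.sees q i := by
  have hthird := (lowerThird_lt_upperThird q).trans (upperThird_lt_top q)
  constructor
  · intro h
    obtain rfl : p = p' := eq_of_toY_le (F.box_y i).1 (F.box_y i).2.2 (F.probe_y q).1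
      (lowerThird_le_one q) h.2.1.1 h.2.1.2
    refine ⟨rfl, F.sees_of_meet q i (toX_le_toX_iff.1 h.1.2) (toY_le_toY_iff.1 h.2.1.2) ?_⟩
    exact (toY_le_toY_iff.1 h.2.1.1).trans hthird.le
  · rintro ⟨rfl, h⟩
    have hx := F.covers_x q i h
    have hy := F.covers_y q i h
    refine ⟨⟨?_, ?_⟩, ⟨?_, ?_⟩, ⟨?_, ?_⟩⟩
    · exact (toX_lt_right (((F.box_x i).2.1.le).trans (F.box_x i).2.2)).le
    · exact toX_le_toX_iff.2 ((F.probe_x q).2.1.le.trans hx.2)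
    · exact toY_le_toY_iff.2 (hy.1.trans (bot_lt_lowerThird q).le)
    · exact toY_le_toY_iff.2 ((F.probe_y q).2.1.le.trans hy.2)
    · exact (affine_le (a := 0) (b := 1 / 3) (by norm_num)
        ((F.box_z i).2.1.le.trans (F.box_z i).2.2) :)
    · exact (le_affine (a := 0) (b := 1 / 3) (by norm_num)
        ((F.box_z i).1.trans (F.box_z i).2.1.le) :)

theorem eq_of_meet_long {a b : F.π × F.π}
    (h : (F.stepBox (.inr (.inr a))).Meet (F.stepBox (.inr (.inr b)))) : a = b := by
  obtain ⟨p, q⟩ := a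
  obtain ⟨p', q'⟩ := b
  obtain rfl : p = p' := eq_of_toY_le (F.probe_y q).1 (lowerThird_le_one q) (F.probe_y q').1
    (lowerThird_le_one q') h.2.1.1 h.2.1.2
  have hq := (lowerThird_lt_upperThird q).trans (upperThird_lt_top q)
  have hq' := (lowerThird_lt_upperThird q').trans (upperThird_lt_top q')
  obtain rfl : q = q' := F.disjoint q q' ((toY_le_toY_iff.1 h.2.1.1).trans hq'.le)
    ((toY_le_toY_iff.1 h.2.1.2).trans hq.le)
  rfl

theorem step_triangle_free (i j l : F.ι ⊕ (F.π × F.ι) ⊕ (F.π × F.π))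
    (hij : (F.stepBox i).Meet (F.stepBox j)) (hjl : (F.stepBox j).Meet (F.stepBox l))
    (hil : (F.stepBox i).Meet (F.stepBox l)) : i = j ∨ j = l ∨ i = l := by
  -- a long box only meets copies of boxes that are seen by one probe, hence pairwise disjoint
  have hlong : ∀ {p p' : F.π} {i j : F.ι} {a : F.π × F.π},
      (F.stepBox (.inr (.inl (p, i)))).Meet (F.stepBox (.inr (.inl (p', j)))) →
      (F.stepBox (.inr (.inl (p, i)))).Meet (F.stepBox (.inr (.inr a))) →
      (F.stepBox (.inr (.inl (p', j)))).Meet (F.stepBox (.inr (.inr a))) →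
      (p, i) = (p', j) := by
    intro p p' i j a h h1 h2
    obtain ⟨rfl, h3⟩ := meet_copy_iff.1 h
    rw [F.independent _ i j (meet_copy_long_iff.1 h1).2 (meet_copy_long_iff.1 h2).2 h3]
  rcases i with i | ⟨p, i⟩ | a
  · rcases j with j | j
    · rcases l with l | l
      · rw [meet_inl_iff] at hij hjl hil
        simpa only [Sum.inl.injEq] using F.triangle_free i j l hij hjl hil
      · exact absurd hil not_meet_inl_inr
    · exact absurd hij not_meet_inl_inr
  · rcases j with j | ⟨p', j⟩ | b
    · exact absurd hij.symm not_meet_inl_inr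
    · rcases l with l | ⟨p'', l⟩ | c
      · exact absurd hil.symm not_meet_inl_inr
      · obtain ⟨rfl, h1⟩ := meet_copy_iff.1 hij
        obtain ⟨rfl, h2⟩ := meet_copy_iff.1 hjl
        simpa only [Sum.inr.injEq, Sum.inl.injEq, Prod.mk.injEq, true_and] using
          F.triangle_free i j l h1 h2 (meet_copy_iff.1 hil).2
      · exact Or.inl (by rw [hlong hij hil hjl])
    · rcases l with l | ⟨p'', l⟩ | c
      · exact absurd hil.symm not_meet_inl_inr
      · exact Or.inr (Or.inr (by rw [hlong hil hij hjl.symm]))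
      · exact Or.inr (Or.inl (by rw [eq_of_meet_long hjl]))
  · rcases j with j | ⟨p', j⟩ | b
    · exact absurd hij.symm not_meet_inl_inr
    · rcases l with l | ⟨p'', l⟩ | c
      · exact absurd hil.symm not_meet_inl_inr
      · exact Or.inr (Or.inl (by rw [hlong hjl hij.symm hil.symm]))
      · exact Or.inr (Or.inr (by rw [eq_of_meet_long hil]))
    · exact Or.inl (by rw [eq_of_meet_long hij])

theorem step_independent (p : (F.π × F.π) × Bool) (i j : F.ι ⊕ (F.π × F.ι) ⊕ (F.π × F.π))
    (hi : F.stepSees p i) (hj : F.stepSees p j) (h : (F.stepBox i).Meet (F.stepBox j)) :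
    i = j := by
  obtain ⟨⟨p, q⟩, b⟩ := p
  rcases i with i | ⟨p', i⟩ | ⟨p', q'⟩
  · rcases j with j | j
    · rw [F.independent p i j hi hj (meet_inl_iff.1 h)]
    · exact absurd h not_meet_inl_inr
  · rcases j with j | ⟨p'', j⟩ | ⟨p'', q''⟩
    · exact absurd h.symm not_meet_inl_inr
    · obtain ⟨-, rfl, hi⟩ := hi
      obtain ⟨-, rfl, hj⟩ := hj
      rw [F.independent q i j hi hj (meet_copy_iff.1 h).2]
    · rw [hi.1] at hj
      exact nomatch hj.1
  · rcases j with j | ⟨p'', j⟩ | ⟨p'', q''⟩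
    · exact absurd h.symm not_meet_inl_inr
    · rw [hi.1] at hj
      exact nomatch hj.1
    · rw [eq_of_meet_long h]

theorem step_probe_x (p : (F.π × F.π) × Bool) :
    F.left p.1.1 ≤ F.stepLeft p ∧ F.stepLeft p < F.stepRight p ∧
      F.stepRight p ≤ F.right p.1.1 := by
  obtain ⟨⟨p, q⟩, b⟩ := p
  have hp := (F.probe_x p).2.1
  cases b
  · exact ⟨left_le_toX (F.probe_x q).1, toX_lt_toX_iff.2 (F.probe_x q).2.1,
      (toX_lt_right (F.probe_x q).2.2).le⟩
  · refine ⟨le_affine hp (by norm_num), ?_, le_rfl⟩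
    simp only [stepLeft, stepRight, affine]
    linarith

theorem step_probe_y (p : (F.π × F.π) × Bool) :
    F.toY p.1.1 (F.bot p.1.2) ≤ F.stepBot p ∧ F.stepBot p < F.stepTop p ∧
      F.stepTop p ≤ F.toY p.1.1 (F.top p.1.2) := by
  obtain ⟨⟨p, q⟩, b⟩ := p
  have h1 := bot_lt_lowerThird q
  have h2 := lowerThird_lt_upperThird q
  have h3 := upperThird_lt_top q
  cases b
  · exact ⟨toY_le_toY_iff.2 (h1.trans h2).le, toY_lt_toY_iff.2 h3, le_rfl⟩
  · exact ⟨le_rfl, toY_lt_toY_iff.2 h1, toY_le_toY_iff.2 (h2.trans h3).le⟩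

theorem bot_le_stepBot (p : (F.π × F.π) × Bool) : F.bot p.1.1 ≤ F.stepBot p :=
  (bot_le_toY (F.probe_y p.1.2).1).trans (step_probe_y p).1

theorem stepTop_le_top (p : (F.π × F.π) × Bool) : F.stepTop p ≤ F.top p.1.1 :=
  (step_probe_y p).2.2.trans (toY_le_top (F.probe_y p.1.2).2.2)

theorem step_disjoint (p p' : (F.π × F.π) × Bool) (h : F.stepBot p ≤ F.stepTop p')
    (h' : F.stepBot p' ≤ F.stepTop p) : p = p' := by
  have hp : p.1.1 = p'.1.1 := F.disjoint _ _
    ((bot_le_stepBot p).trans (h.trans (stepTop_le_top p')))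
    ((bot_le_stepBot p').trans (h'.trans (stepTop_le_top p)))
  have h1 := (step_probe_y p).1.trans (h.trans (step_probe_y p').2.2)
  have h2 := (step_probe_y p').1.trans (h'.trans (step_probe_y p).2.2)
  rw [hp, toY_le_toY_iff] at h1
  rw [hp, toY_le_toY_iff] at h2
  have hq : p.1.2 = p'.1.2 := F.disjoint _ _ h1 h2
  obtain ⟨⟨p, q⟩, b⟩ := p
  obtain ⟨⟨p', q'⟩, b'⟩ := p'
  obtain rfl : p = p' := hp
  obtain rfl : q = q' := hq
  have h3 := toY_lt_toY_iff (p := p).2 (lowerThird_lt_upperThird q)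
  cases b <;> cases b'
  · rfl
  · exact absurd h h3.not_ge
  · exact absurd h' h3.not_ge
  · rfl

theorem step_covers_x (p : (F.π × F.π) × Bool) (i : F.ι ⊕ (F.π × F.ι) ⊕ (F.π × F.π))
    (h : F.stepSees p i) :
    (F.stepBox i).x₀ ≤ F.stepLeft p ∧ F.stepRight p ≤ (F.stepBox i).x₁ := by
  rcases i with i | ⟨p', i⟩ | ⟨p', q'⟩
  · have := F.covers_x p.1.1 i h
    exact ⟨this.1.trans (step_probe_x p).1, (step_probe_x p).2.2.trans this.2⟩
  · obtain ⟨⟨p, q⟩, b⟩ := p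
    obtain ⟨rfl, rfl, h⟩ := h
    have := F.covers_x q i h
    exact ⟨toX_le_toX_iff.2 this.1, toX_le_toX_iff.2 this.2⟩
  · obtain ⟨⟨p, q⟩, b⟩ := p
    obtain ⟨rfl, rfl, rfl⟩ := h
    exact ⟨(toX_lt_stepLeft ((F.probe_x q').2.1.le.trans (F.probe_x q').2.2)).le, le_rfl⟩

theorem step_covers_y (p : (F.π × F.π) × Bool) (i : F.ι ⊕ (F.π × F.ι) ⊕ (F.π × F.π))
    (h : F.stepSees p i) :
    (F.stepBox i).y₀ ≤ F.stepBot p ∧ F.stepTop p ≤ (F.stepBox i).y₁ := by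
  rcases i with i | ⟨p', i⟩ | ⟨p', q'⟩
  · have := F.covers_y p.1.1 i h
    exact ⟨this.1.trans (bot_le_stepBot p), (stepTop_le_top p).trans this.2⟩
  · have hp := step_probe_y p
    obtain ⟨⟨p, q⟩, b⟩ := p
    obtain ⟨rfl, rfl, h⟩ := h
    have := F.covers_y q i h
    exact ⟨(toY_le_toY_iff.2 this.1).trans hp.1, hp.2.2.trans (toY_le_toY_iff.2 this.2)⟩
  · obtain ⟨⟨p, q⟩, b⟩ := p
    obtain ⟨rfl, rfl, rfl⟩ := h
    exact ⟨le_rfl, le_rfl⟩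

theorem step_sees_of_meet (p : (F.π × F.π) × Bool) (i : F.ι ⊕ (F.π × F.ι) ⊕ (F.π × F.π))
    (hx : F.stepLeft p ≤ (F.stepBox i).x₁) (hy : F.stepBot p ≤ (F.stepBox i).y₁)
    (hy' : (F.stepBox i).y₀ ≤ F.stepTop p) : F.stepSees p i := by
  rcases i with i | ⟨p', i⟩ | ⟨p', q'⟩
  · exact F.sees_of_meet p.1.1 i ((step_probe_x p).1.trans hx) ((bot_le_stepBot p).trans hy)
      (hy'.trans (stepTop_le_top p))
  · have hp := step_probe_y p
    obtain ⟨⟨p, q⟩, b⟩ := p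
    have h1 := hp.1.trans hy
    have h2 := hy'.trans hp.2.2
    obtain rfl : p = p' := eq_of_toY_le (F.probe_y q).1 (F.probe_y q).2.2 (F.box_y i).1
      (F.box_y i).2.2 h1 h2
    cases b
    · exact ⟨rfl, rfl, F.sees_of_meet q i (toX_le_toX_iff.1 hx) (toY_le_toY_iff.1 h1)
        (toY_le_toY_iff.1 h2)⟩
    · exact absurd hx (toX_lt_stepLeft (F.box_x i).2.2).not_ge
  · -- the range of the long box is the range of a new probe
    have := step_disjoint p ((p', q'), true) hy hy'
    subst this
    exact ⟨rfl, rfl, rfl⟩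

theorem zero_le_toX {p : F.π} {t : ℝ} (ht : 0 ≤ t) : 0 ≤ F.toX p t :=
  (F.probe_x p).1.trans (left_le_toX ht)

theorem toX_le_one {p : F.π} {t : ℝ} (ht : t ≤ 1) : F.toX p t ≤ 1 :=
  (toX_lt_right ht).le.trans (F.probe_x p).2.2

theorem zero_le_toY {p : F.π} {t : ℝ} (ht : 0 ≤ t) : 0 ≤ F.toY p t :=
  (F.probe_y p).1.trans (bot_le_toY ht)

theorem toY_le_one {p : F.π} {t : ℝ} (ht : t ≤ 1) : F.toY p t ≤ 1 :=
  (toY_le_top ht).trans (F.probe_y p).2.2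

variable (F) in
/-- The next family in Burling's construction. -/
noncomputable def step : BurlingFamily where
  ι := F.ι ⊕ (F.π × F.ι) ⊕ (F.π × F.π)
  π := (F.π × F.π) × Bool
  finite_ι := by
    have := F.finite_ι
    have := F.finite_π
    infer_instance
  finite_π := by
    have := F.finite_π
    infer_instance
  box := F.stepBox
  left := F.stepLeft
  right := F.stepRight
  bot := F.stepBot
  top := F.stepTop
  sees := F.stepSees
  box_x i := by
    rcases i with i | ⟨p, i⟩ | ⟨p, q⟩
    · exact F.box_x i
    · obtain ⟨h1, h2, h3⟩ := F.box_x i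
      exact ⟨zero_le_toX h1, toX_lt_toX_iff.2 h2, toX_le_one h3⟩
    · obtain ⟨h1, h2, h3⟩ := F.probe_x q
      exact ⟨zero_le_toX h1, toX_lt_right (h2.le.trans h3), (F.probe_x p).2.2⟩
  box_y i := by
    rcases i with i | ⟨p, i⟩ | ⟨p, q⟩
    · exact F.box_y i
    · obtain ⟨h1, h2, h3⟩ := F.box_y i
      exact ⟨zero_le_toY h1, toY_lt_toY_iff.2 h2, toY_le_one h3⟩
    · exact ⟨zero_le_toY (F.probe_y q).1, toY_lt_toY_iff.2 (bot_lt_lowerThird q),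
        toY_le_one (lowerThird_le_one q)⟩
  box_z i := by
    rcases i with i | ⟨p, i⟩ | ⟨p, q⟩
    · obtain ⟨h1, h2, h3⟩ := F.box_z i
      exact ⟨le_trans (by norm_num) (le_affine (by norm_num) h1),
        (affine_lt_affine_iff (by norm_num)).2 h2, affine_le (by norm_num) h3⟩
    · obtain ⟨h1, h2, h3⟩ := F.box_z i
      exact ⟨le_affine (by norm_num) h1, (affine_lt_affine_iff (by norm_num)).2 h2,
        (affine_le (by norm_num) h3).trans (by norm_num)⟩
    · exact ⟨le_rfl, by norm_num [stepBox], by norm_num [stepBox]⟩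
  probe_x p := ⟨(F.probe_x p.1.1).1.trans (step_probe_x p).1, (step_probe_x p).2.1,
    (step_probe_x p).2.2.trans (F.probe_x p.1.1).2.2⟩
  probe_y p := ⟨(F.probe_y p.1.1).1.trans (bot_le_stepBot p), (step_probe_y p).2.1,
    (stepTop_le_top p).trans (F.probe_y p.1.1).2.2⟩
  disjoint := step_disjoint
  covers_x := step_covers_x
  covers_y := step_covers_y
  sees_of_meet := step_sees_of_meet
  independent := step_independent
  triangle_free := step_triangle_free

/-- Let the probe `p` and the probe `q` of the copy below `p` see `n` colors each. If these
are not the same colors, then the upper probe sees one more; otherwise the long box has a color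
different from them, and the lower probe sees it. -/
theorem HasColors.step {n : ℕ} (hF : F.HasColors n) : F.step.HasColors (n + 1) := by
  have := F.finite_ι
  have := F.step.finite_ι
  intro c hc
  obtain ⟨p, hp⟩ := hF (fun i => c (.inl i))
    fun i j hij h => hc _ _ (fun h' => hij (Sum.inl.inj h')) (meet_inl_iff.2 h)
  obtain ⟨q, hq⟩ := hF (fun i => c (.inr (.inl (p, i))))
    fun i j hij h => hc _ _
      (fun h' => hij (Prod.ext_iff.1 (Sum.inl.inj (Sum.inr.inj h'))).2) (meet_copy_iff.2 ⟨rfl, h⟩)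
  set A := (fun i => c (.inl i)) '' {i | F.sees p i} with hA
  set C := (fun i => c (.inr (.inl (p, i)))) '' {i | F.sees q i} with hC
  have hAfin : A.Finite := Set.toFinite _
  have hCfin : C.Finite := Set.toFinite _
  have hsub : ∀ b, A ⊆ c '' {i | F.step.sees ((p, q), b) i} := by
    rintro b _ ⟨i, hi, rfl⟩
    exact ⟨.inl i, hi, rfl⟩
  by_cases hcard : n + 1 ≤ (A ∪ C).ncard
  · refine ⟨((p, q), false), hcard.trans (Set.ncard_le_ncard (Set.union_subset (hsub _) ?_)
      (Set.toFinite _))⟩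
    rintro _ ⟨i, hi, rfl⟩
    exact ⟨.inr (.inl (p, i)), ⟨rfl, rfl, hi⟩, rfl⟩
  · have h1 : A = A ∪ C := Set.eq_of_subset_of_ncard_le Set.subset_union_left (by omega)
      (hAfin.union hCfin)
    have h2 : C = A ∪ C := Set.eq_of_subset_of_ncard_le Set.subset_union_right (by omega)
      (hAfin.union hCfin)
    have hAC : A = C := h1.trans h2.symm
    have hnot : c (.inr (.inr (p, q))) ∉ A := by
      rw [hAC]
      rintro ⟨i, hi, h⟩
      exact hc (.inr (.inl (p, i))) (.inr (.inr (p, q)))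
        (fun h' => nomatch Sum.inr.inj h')
        (meet_copy_long_iff.2 ⟨rfl, hi⟩) h
    refine ⟨((p, q), true), ?_⟩
    calc n + 1 ≤ (insert (c (.inr (.inr (p, q)))) A).ncard := by
          rw [Set.ncard_insert_of_notMem hnot hAfin]
          omega
      _ ≤ _ := by
          refine Set.ncard_le_ncard (Set.insert_subset ?_ (hsub _)) (Set.toFinite _)
          exact ⟨.inr (.inr (p, q)), ⟨rfl, rfl, rfl⟩, rfl⟩

theorem exists_hasColors (n : ℕ) : ∃ F : BurlingFamily, F.HasColors n := by
  induction n with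
  | zero => exact ⟨empty, fun _ _ => ⟨(), Nat.zero_le _⟩⟩
  | succ n ih =>
    obtain ⟨F, hF⟩ := ih
    exact ⟨F.step, hF.step⟩

/-! ### The box hypergraph of a family -/

variable (F) in
/-- The boxes of the family, moved to the cube `[1, 2] ^ 3`, inside of the box `[0, 3] ^ 3`. -/
noncomputable def toBoxHypergraph : BoxHypergraph where
  size := Nat.card F.ι
  lo i :=
    have b := F.box ((@Finite.equivFin F.ι F.finite_ι).symm i)
    ![1 + b.x₀, 1 + b.y₀, 1 + b.z₀]
  hi i :=
    have b := F.box ((@Finite.equivFin F.ι F.finite_ι).symm i)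
    ![1 + b.x₁, 1 + b.y₁, 1 + b.z₁]
  corner _ := 3
  lo_pos i k := by
    have hx := F.box_x ((@Finite.equivFin F.ι F.finite_ι).symm i)
    have hy := F.box_y ((@Finite.equivFin F.ι F.finite_ι).symm i)
    have hz := F.box_z ((@Finite.equivFin F.ι F.finite_ι).symm i)
    fin_cases k <;> simp <;> linarith
  lo_lt_hi i k := by
    have hx := F.box_x ((@Finite.equivFin F.ι F.finite_ι).symm i)
    have hy := F.box_y ((@Finite.equivFin F.ι F.finite_ι).symm i)
    have hz := F.box_z ((@Finite.equivFin F.ι F.finite_ι).symm i)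
    fin_cases k <;> simp <;> linarith
  hi_le_corner i k := by
    have hx := F.box_x ((@Finite.equivFin F.ι F.finite_ι).symm i)
    have hy := F.box_y ((@Finite.equivFin F.ι F.finite_ι).symm i)
    have hz := F.box_z ((@Finite.equivFin F.ι F.finite_ι).symm i)
    fin_cases k <;> simp <;> linarith
  corner_pos _ := by norm_num

theorem toBoxHypergraph_hi_lt_corner (i k) :
    F.toBoxHypergraph.hi i k < F.toBoxHypergraph.corner k := by
  have hx := F.box_x ((@Finite.equivFin F.ι F.finite_ι).symm i)
  have hy := F.box_y ((@Finite.equivFin F.ι F.finite_ι).symm i)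
  have hz := F.box_z ((@Finite.equivFin F.ι F.finite_ι).symm i)
  fin_cases k <;> simp [toBoxHypergraph] <;> linarith

theorem toBoxHypergraph_adj_iff {i j : Fin F.toBoxHypergraph.size} :
    F.toBoxHypergraph.intersectionGraph.Adj i j ↔ i ≠ j ∧
      (F.box ((@Finite.equivFin F.ι F.finite_ι).symm i)).Meet
        (F.box ((@Finite.equivFin F.ι F.finite_ι).symm j)) := by
  rw [BoxHypergraph.intersectionGraph_adj_iff, BoxHypergraph.inter_box_nonempty_iff]
  simp [Fin.forall_fin_succ, toBoxHypergraph, Box3.Meet]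

theorem HasColors.le_chromaticNumber {n : ℕ} (hF : F.HasColors n) :
    n ≤ F.toBoxHypergraph.intersectionGraph.chromaticNumber := by
  rw [SimpleGraph.le_chromaticNumber_iff_colorable]
  rintro m ⟨c⟩
  let e := @Finite.equivFin F.ι F.finite_ι
  obtain ⟨p, hp⟩ := hF (fun i => (c (e i)).val) (by
    intro i j hij h heq
    refine c.valid (toBoxHypergraph_adj_iff.2 ⟨e.injective.ne hij, ?_⟩) (Fin.ext heq)
    change (F.box (e.symm (e i))).Meet (F.box (e.symm (e j)))
    rwa [e.symm_apply_apply, e.symm_apply_apply])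
  refine hp.trans ?_
  have hsub : (fun i => (c (e i)).val) '' {i | F.sees p i} ⊆ Set.Iio m := by
    rintro _ ⟨i, -, rfl⟩
    exact (c (e i)).2
  have := Set.ncard_le_ncard hsub (Set.finite_Iio m)
  rwa [← Finset.coe_Iio, Set.ncard_coe_finset, Nat.card_Iio] at this

theorem cliqueNum_toBoxHypergraph_le : F.toBoxHypergraph.intersectionGraph.cliqueNum ≤ 2 := by
  obtain ⟨s, hs⟩ := SimpleGraph.exists_isNClique_cliqueNum
    (G := F.toBoxHypergraph.intersectionGraph)
  rw [← hs.card_eq]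
  by_contra! hcard
  obtain ⟨i, j, l, hi, hj, hl, hij, hil, hjl⟩ := Finset.two_lt_card_iff.1 hcard
  have h1 := toBoxHypergraph_adj_iff.1 (hs.isClique hi hj hij)
  have h2 := toBoxHypergraph_adj_iff.1 (hs.isClique hj hl hjl)
  have h3 := toBoxHypergraph_adj_iff.1 (hs.isClique hi hl hil)
  rcases F.triangle_free _ _ _ h1.2 h2.2 h3.2 with h | h | h
  exacts [hij (Equiv.injective _ h), hjl (Equiv.injective _ h), hil (Equiv.injective _ h)]

end BurlingFamily

theorem SimpleGraph.exists_adj_of_one_lt_chromaticNumber {V : Type*} {G : SimpleGraph V}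
    (h : 1 < G.chromaticNumber) : ∃ x y, G.Adj x y := by
  by_contra! hcon
  have : G.Colorable 1 := ⟨⟨fun _ => 0, fun {x y} hxy => absurd hxy (hcon x y)⟩⟩
  exact h.not_ge (by exact_mod_cast this.chromaticNumber_le)

/-- Burling's theorem: there are finite families of boxes in space with a triangle-free
intersection graph of arbitrarily large chromatic number. -/
theorem exists_boxHypergraph (n : ℕ) : ∃ B : BoxHypergraph,
    B.intersectionGraph.cliqueNum = 2 ∧ ((n + 1 : ℕ) : ℕ∞) < B.intersectionGraph.chromaticNumber ∧
      (∀ i k, B.hi i k < B.corner k) ∧ ∃ i j, B.intersectionGraph.Adj i j := by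
  obtain ⟨F, hF⟩ := BurlingFamily.exists_hasColors (n + 2)
  have hlt : ((n + 1 : ℕ) : ℕ∞) < F.toBoxHypergraph.intersectionGraph.chromaticNumber :=
    lt_of_lt_of_le (by exact_mod_cast Nat.lt_succ_self (n + 1)) hF.le_chromaticNumber
  obtain ⟨i, j, hij⟩ := SimpleGraph.exists_adj_of_one_lt_chromaticNumber
    (lt_of_le_of_lt (by exact_mod_cast Nat.le_add_left 1 n) hlt)
  refine ⟨F.toBoxHypergraph, le_antisymm BurlingFamily.cliqueNum_toBoxHypergraph_le ?_, hlt,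
    BurlingFamily.toBoxHypergraph_hi_lt_corner, i, j, hij⟩
  have hcl : F.toBoxHypergraph.intersectionGraph.IsClique
      (({i, j} : Finset (Fin F.toBoxHypergraph.size)) : Set (Fin F.toBoxHypergraph.size)) := by
    rw [Finset.coe_pair, SimpleGraph.isClique_pair]
    exact fun _ => hij
  rw [← Finset.card_pair hij.ne]
  exact hcl.card_le_cliqueNum

/-! ### The infinite chain of lifted graphs -/

section Conclusion

variable {B : ℕ → BoxHypergraph}

variable (B) in
/-- The event structure of the infinite chain of lifted graphs. -/
def boxChainEvents : EventStructure (Σ n, (B n).Event) :=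
  chainEvents (fun n => (B n).eventStructure) (fun n => (B n).spine)
    fun n => (B n).isConfiguration_spine

variable (B) in
/-- The chain of lifted graphs is the covering graph of the domain of the chain of event
structures. -/
noncomputable def boxChainModel : DomainModel (boxChain B) (boxChainEvents B) :=
  chainModel (fun n => (B n).liftedModel) (fun n => (B n).liftedModel_ev_originVertex)
    (fun n => (B n).liftedModel_ev_cornerVertex) fun n => (B n).spine_nonempty

variable (B) in
theorem boxChainModel_ev_base : (boxChainModel B).ev (boxChainBase B) = ∅ := by
  change chainSet (fun n => (B n).spine) 0 ((B 0).liftedModel.ev (B 0).originVertex) = ∅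
  rw [(B 0).liftedModel_ev_originVertex, Set.eq_empty_iff_forall_notMem]
  rintro p (h | ⟨f, hf, -⟩)
  exacts [Nat.not_lt_zero _ h.1, hf]

variable (B) in
theorem isArticulation_boxChain_iff (hB : ∀ n i k, (B n).hi i k < (B n).corner k)
    (p : BoxChainVertex B) :
    (boxChain B).IsArticulation p ↔ ∃ n, p = boxChainMk B n (B n).cornerVertex := by
  constructor
  · exact exists_eq_of_isArticulation_chainGraph (fun n => (B n).liftedModel)
      (fun n => (B n).liftedModel_ev_originVertex) (fun n => (B n).liftedModel_ev_cornerVertex)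
      fun n => (B n).not_isArticulation_liftedGraph
  · rintro ⟨n, rfl⟩
    exact isArticulation_chainMk_spine (fun n => (B n).liftedModel)
      (fun n => (B n).liftedModel_ev_originVertex) (fun n => (B n).liftedModel_ev_cornerVertex)
      (fun n => (B n).spine_nonempty)
      (fun n => BoxHypergraph.exists_conflict_of_notMem_spine (hB n)) n

/-- A nice labeling of the chain restricts to proper colorings of the intersection graphs. -/
theorem infinite_range_of_isNiceLabeling
    (hχ : ∀ n : ℕ, (n : ℕ∞) < (B n).intersectionGraph.chromaticNumber) {L : Type*}
    {lab : (Σ n, (B n).Event) → L} (hlab : (boxChainEvents B).IsNiceLabeling lab) :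
    (Set.range lab).Infinite := by
  intro hfin
  have := hfin.to_subtype
  let n := Nat.card (Set.range lab)
  let e : Set.range lab ≃ Fin n := Finite.equivFin _
  have hcol : (B n).intersectionGraph.Colorable n :=
    ⟨⟨fun i => e ⟨lab ⟨n, .box i⟩, _, rfl⟩, fun {i j} hij heq => by
      refine hlab ⟨n, .box i⟩ ⟨n, .box j⟩ ?_ (congrArg Subtype.val (e.injective heq))
      exact chainEvents_independent_level_iff.2 (BoxHypergraph.independent_box_iff.2 hij)⟩⟩
  exact (hχ n).not_ge hcol.chromaticNumber_le

theorem infinite_boxChainVertex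
    (hχ : ∀ n : ℕ, (n : ℕ∞) < (B n).intersectionGraph.chromaticNumber) :
    Infinite (BoxChainVertex B) := by
  by_contra hfin
  rw [not_infinite_iff_finite] at hfin
  -- a finite graph has finitely many classes of edges, hence finitely many events
  have : Finite (boxChain B).ThetaClass := Quot.finite _
  have : Finite (Σ n, (B n).Event) := Finite.of_equiv _ (boxChainModel B).eventEquiv
  refine infinite_range_of_isNiceLabeling hχ (lab := id) (fun e f h => h.ne) (Set.toFinite _)

end Conclusion

theorem mainTheorem1 :
    ∃ B : ℕ → BoxHypergraph,
      (∀ n, (B n).intersectionGraph.cliqueNum = 2 ∧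
        ((n + 1 : ℕ) : ℕ∞) < (B n).intersectionGraph.chromaticNumber) ∧
      Infinite (BoxChainVertex B) ∧
      (∀ n, (B n).liftedGraph.IsTwoConnected) ∧
      (∀ p : BoxChainVertex B, (boxChain B).IsArticulation p ↔
        ∃ n, p = boxChainMk B n (B n).cornerVertex) ∧
      (boxChain B).IsMedian ∧
      (boxChain B).maxOutDegree (boxChainBase B) = 5 ∧
      ((boxChain B).pointedContactGraph (boxChainBase B)).chromaticNumber = ⊤ ∧
      ∃ S : EventStructure (boxChain B).ThetaClass,
        (boxChain B).IsEventStructureOf (boxChainBase B) S ∧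
        (boxChain B).IsHasseOfDomain (boxChainBase B) S ∧
        S.degree = 5 ∧
        ∀ (L : Type*) (lab : (boxChain B).ThetaClass → L),
          S.IsNiceLabeling lab → (Set.range lab).Infinite := by
  choose B hclique hchrom hcorner hadj using exists_boxHypergraph
  have hχ : ∀ n : ℕ, (n : ℕ∞) < (B n).intersectionGraph.chromaticNumber := fun n =>
    lt_trans (by exact_mod_cast Nat.lt_succ_self n) (hchrom n)
  have hbase := boxChainModel_ev_base B
  have hdegree : (boxChainEvents B).degree = 5 := by
    refine degree_chainEvents (fun n => BoxHypergraph.exists_conflict_of_notMem_spine (hcorner n))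
      fun n => ?_
    obtain ⟨i, j, hij⟩ := hadj n
    exact BoxHypergraph.degree_eventStructure (hcorner n) (hclique n) hij
  refine ⟨B, fun n => ⟨hclique n, hchrom n⟩, infinite_boxChainVertex hχ,
    fun n => (B n).isTwoConnected_liftedGraph, isArticulation_boxChain_iff B hcorner,
    (boxChainModel B).isMedian, ?_, ?_, (boxChainEvents B).comap (boxChainModel B).eventEquiv,
    (boxChainModel B).isEventStructureOf hbase, (boxChainModel B).isHasseOfDomain hbase, ?_, ?_⟩
  · rw [(boxChainModel B).maxOutDegree_eq_degree hbase, hdegree]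
  · exact (boxChainModel B).chromaticNumber_pointedContactGraph_eq_top hbase
      fun L lab => infinite_range_of_isNiceLabeling hχ
  · rw [EventStructure.degree_comap, hdegree]
  · intro L lab hlab
    let θ := (boxChainModel B).eventEquiv
    have hnice : (boxChainEvents B).IsNiceLabeling (lab ∘ θ.symm) := fun e f hef => by
      refine hlab _ _ ((EventStructure.comap_independent_iff θ).2 ?_)
      rwa [θ.apply_symm_apply, θ.apply_symm_apply]
    have := infinite_range_of_isNiceLabeling hχ hnice
    rwa [θ.symm.surjective.range_comp] at this
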